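/- **Setting.** An admissible set $\mathbb A$ is a transitive set over urelements, carrying possibly further relations and functions of a language $L$, which is a model of KPU with separation and collection for all $\Delta_0$-formulas of $L\cup\{\in\}$. $\Sigma$-definability in $\mathbb A$ is by $\Sigma$-formulas with parameters from $\mathbb A$. Let $G$ be a closed subgroup of $S_\infty$ (the permutations of $\omega$ with the topology of pointwise convergence), and let $X$ be a Polish $G$-space with a basis $\{A_i:i\in\omega\}$. Let $S_{<\infty}$ be the set of bijections between finite subsets of $\omega$, and $S^G_{<\infty}=\{f|_d: f\in G,\ d\subseteq\omega\text{ finite}\}$; put $V^G_\sigma=\{f\in G:f\supseteq\sigma\}$, and $V^G_c=\{f\in G: f(k)=k\text{ for all }k\in c\}$ for finite $c\subseteq\omega$. For $x\in X$ and $\sigma\in S^G_{<\infty}$ with $d=\mathrm{dom}[\sigma]$, $c=\mathrm{rng}[\sigma]$, the $\alpha$-sets ($\alpha\ge1$) are $$B_1(x,\sigma)=\bigcap\{V^G_cA_l: V^G_\sigma x\cap A_l\ne\emptyset\}\cap\bigcap\{X\setminus V^G_cA_l: V^G_\sigma x\cap A_l=\emptyset\},$$ $$B_{\alpha+1}(x,\sigma)=\bigcap_{b\supseteq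 d}\bigcup\{B_\alpha(x,\sigma'):\sigma'\supseteq\sigma,\ \mathrm{dom}[\sigma']=b\}\cap\bigcap_{a\supseteq c}\bigcup\{B_\alpha(x,\sigma'):\sigma'\supseteq\sigma,\ \mathrm{rng}[\sigma']=a\}$$ ($\sigma'\in S^G_{<\infty}$; $a,b\subseteq\omega$ finite), and $B_\lambda(x,\sigma)=\bigcap_{1\le\alpha<\lambda}B_\alpha(x,\sigma)$ for $\lambda$ limit. Suppose that $\omega$ is realizable in $\mathbb A$, i.e. $\mathbb A$ contains as an element a copy of $(\omega,<)$; fix such a copy, and write $\omega$, $S_{<\infty}$, ... also for the corresponding objects of $\mathbb A$. In $\mathbb A$, a $1$-multicode is a function $u:\omega\to\{0,1\}$; a co-$\alpha$-multicode is a pair $(0,u')$ with $u'$ an $\alpha$-multicode; for $\alpha>1$ an $\alpha$-multicode is a function with domain $\omega$ if $\alpha$ is a successor, and $\alpha$ if $\alpha$ is a limit, each of whose values is a $\beta$-multicode or a co-$\beta$-multicode for some $\beta<\alpha$. A multicode $u$ describes the set $B_u$: $\bigcup\{A_n:u(n)=1\}$ for a $1$-multicode, $X\setminus B_{u'}$ for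 $u=(0,u')$, and $\bigcup\{B_{u'}:u'\in\mathrm{rng}[u]\}$ for an $\alpha$-multicode with $\alpha>1$. A Borel set $B$ is constructible in $\mathbb A$ if $B=B_u$ for some $u\in\mathbb A$ which is an $\alpha$-multicode or a co-$\alpha$-multicode with $\alpha\in\mathbb A$ a countable ordinal. The point $x$ is codable in $\mathbb A$ if the function on $S_{<\infty}$ with $F_1(\sigma)=\{l:V^G_\sigma x\cap A_l\neq\emptyset\}$ for $\sigma\in S^G_{<\infty}$ and $F_1(\sigma)=\emptyset$ otherwise is an element of $\mathbb A$. **Theorem.** Suppose that $x\in X$ is codable in $\mathbb A$ and that the relation $$Imp(c,l,k)\iff c\in[\omega]^{<\omega}\wedge l,k\in\omega\wedge A_k\subseteq V^G_cA_l$$ is $\Sigma$-definable in $\mathbb A$. Then for every $\sigma\in S^G_{<\infty}$ and every countable ordinal $\alpha\ge1$ in $\mathbb A$ the set $B_\alpha(x,\sigma)$ is Borel and constructible in $\mathbb A$. Moreover, there is a function $u_x(\alpha,\sigma)$, $\Sigma$-definable in $\mathbb A$ and defined for all ordinals $\alpha\ge1$ in $\mathbb A$ and all $\sigma\in S^G_{<\infty}$,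 such that for countable $\alpha$, written $\alpha=\lambda+n$ with $\lambda$ zero or a limit ordinal and $n<\omega$, $u_x(\alpha,\sigma)$ is a co-$(\lambda+2n)$-multicode and $B_{u_x(\alpha,\sigma)}=B_\alpha(x,\sigma)$. (In particular it is a co-$\alpha$-multicode when $\alpha$ is a limit ordinal.) -/

import Mathlib

open FirstOrder FirstOrder.Language TopologicalSpace Set

universe u v w z

namespace AdmCoding

/-! ### Set formulas: the symbols for membership and for being an urelement -/

/-- The relation symbols of set theory with urelements. -/
inductive SetRel : ℕ → Type
  | mem : SetRel 2
  | ur : SetRel 1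

/-- The language with a membership symbol and a predicate for urelements. -/
def setLang : FirstOrder.Language.{0, 0} := ⟨fun _ => Empty, SetRel⟩

/-- A transitive set over a collection of urelements, presented up to isomorphism (Mostowski):
a well-founded membership relation, urelements without elements, and extensionality for sets. -/
class TransitiveUniverse (A : Type w) where
  /-- membership -/
  mem : A → A → Prop
  /-- being an urelement -/
  IsUr : A → Prop
  wf : WellFounded mem
  not_mem_ur : ∀ p x, IsUr p → ¬ mem x p
  ext : ∀ a b, ¬ IsUr a → ¬ IsUr b → (∀ x, mem x a ↔ mem x b) → a = b

infix:50 " ε " => TransitiveUniverse.mem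

/-- `a` is a set, that is, not an urelement. -/
def IsSet {A : Type w} [TransitiveUniverse A] (a : A) : Prop := ¬ TransitiveUniverse.IsUr a

instance {A : Type w} [TransitiveUniverse A] : setLang.Structure A where
  funMap := fun f => Empty.elim f
  RelMap := fun r v =>
    match r, v with
    | SetRel.mem, v => v 0 ε v 1
    | SetRel.ur, v => TransitiveUniverse.IsUr (v 0)

instance {A : Type w} [TransitiveUniverse A] :
    IsWellFounded A (fun x y : A => x ε y) := ⟨TransitiveUniverse.wf⟩

section Formulas

variable {L : FirstOrder.Language.{u, v}} {α : Type z} {n : ℕ}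

/-- The membership symbol of the language extending `L`. -/
def memSymb (L : FirstOrder.Language.{u, v}) : (L.sum setLang).Relations 2 :=
  Sum.inr (SetRel.mem : setLang.Relations 2)

/-- The atomic formula `x ε y`, for variables `x`, `y`. -/
def memF (x y : α ⊕ Fin n) : (L.sum setLang).BoundedFormula α n :=
  (memSymb L).boundedFormula₂ (Term.var x) (Term.var y)

/-- The bounded quantifier `∀ y ε x, φ`, where `y` is the last variable of `φ`. -/
def ballF (x : α ⊕ Fin n) (φ : (L.sum setLang).BoundedFormula α (n + 1)) :
    (L.sum setLang).BoundedFormula α n :=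
  (memF (Sum.inr (Fin.last n)) (Sum.map id Fin.castSucc x) ⟹ φ).all

/-- The bounded quantifier `∃ y ε x, φ`, where `y` is the last variable of `φ`. -/
def bexF (x : α ⊕ Fin n) (φ : (L.sum setLang).BoundedFormula α (n + 1)) :
    (L.sum setLang).BoundedFormula α n :=
  (memF (Sum.inr (Fin.last n)) (Sum.map id Fin.castSucc x) ⊓ φ).ex

/-- `Δ₀`-formulas: closed under propositional connectives and bounded quantifiers. -/
inductive IsDelta0 : {n : ℕ} → (L.sum setLang).BoundedFormula α n → Prop
  | qf {n : ℕ} {φ : (L.sum setLang).BoundedFormula α n} : φ.IsQF → IsDelta0 φ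
  | imp {n : ℕ} {φ ψ : (L.sum setLang).BoundedFormula α n} :
      IsDelta0 φ → IsDelta0 ψ → IsDelta0 (φ ⟹ ψ)
  | ball {n : ℕ} (x : α ⊕ Fin n) {φ : (L.sum setLang).BoundedFormula α (n + 1)} :
      IsDelta0 φ → IsDelta0 (ballF x φ)
  | bex {n : ℕ} (x : α ⊕ Fin n) {φ : (L.sum setLang).BoundedFormula α (n + 1)} :
      IsDelta0 φ → IsDelta0 (bexF x φ)

/-- `Σ`-formulas: the closure of the `Δ₀`-formulas under conjunction, disjunction, bounded
quantifiers and unbounded existential quantifiers. -/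
inductive IsSigma : {n : ℕ} → (L.sum setLang).BoundedFormula α n → Prop
  | delta0 {n : ℕ} {φ : (L.sum setLang).BoundedFormula α n} : IsDelta0 φ → IsSigma φ
  | inf {n : ℕ} {φ ψ : (L.sum setLang).BoundedFormula α n} :
      IsSigma φ → IsSigma ψ → IsSigma (φ ⊓ ψ)
  | sup {n : ℕ} {φ ψ : (L.sum setLang).BoundedFormula α n} :
      IsSigma φ → IsSigma ψ → IsSigma (φ ⊔ ψ)
  | ball {n : ℕ} (x : α ⊕ Fin n) {φ : (L.sum setLang).BoundedFormula α (n + 1)} :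
      IsSigma φ → IsSigma (ballF x φ)
  | bex {n : ℕ} (x : α ⊕ Fin n) {φ : (L.sum setLang).BoundedFormula α (n + 1)} :
      IsSigma φ → IsSigma (bexF x φ)
  | ex {n : ℕ} {φ : (L.sum setLang).BoundedFormula α (n + 1)} :
      IsSigma φ → IsSigma φ.ex

end Formulas

/-- `A`, with its additional `L`-structure, is an admissible set (admissible with respect to `L`):
a model of KPU, where separation and collection range over all `Δ₀`-formulas of the language
extended by `L`, with parameters. Extensionality and full foundation hold because `A` is a
transitive set. -/
structure Admissible (L : FirstOrder.Language.{u, v}) (A : Type w) [TransitiveUniverse A] [L.Structure A] :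
    Prop where
  exists_set : ∃ a : A, IsSet a
  pair : ∀ x y : A, ∃ a, IsSet a ∧ x ε a ∧ y ε a
  union : ∀ a : A, ∃ b, IsSet b ∧ ∀ y, y ε a → ∀ x, x ε y → x ε b
  separation : ∀ (m : ℕ) (φ : (L.sum setLang).Formula (Fin (m + 1))), IsDelta0 φ →
    ∀ (p : Fin m → A) (a : A), ∃ b, IsSet b ∧
      ∀ x, x ε b ↔ x ε a ∧ φ.Realize (Fin.cons x p : Fin (m + 1) → A)
  collection : ∀ (m : ℕ) (φ : (L.sum setLang).Formula (Fin (m + 2))), IsDelta0 φ →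
    ∀ (p : Fin m → A) (a : A),
      (∀ x, x ε a → ∃ y, φ.Realize (Fin.cons x (Fin.cons y p) : Fin (m + 2) → A)) →
      ∃ b, IsSet b ∧ ∀ x, x ε a → ∃ y, y ε b ∧
        φ.Realize (Fin.cons x (Fin.cons y p) : Fin (m + 2) → A)

/-- A relation on `A` is `Σ`-definable in `A`: by a `Σ`-formula with parameters from `A`. -/
def SigmaDefinable (L : FirstOrder.Language.{u, v}) {A : Type w} [TransitiveUniverse A] [L.Structure A]
    {k : ℕ} (S : (Fin k → A) → Prop) : Prop :=
  ∃ (m : ℕ) (φ : (L.sum setLang).Formula (Fin k ⊕ Fin m)) (p : Fin m → A),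
    IsSigma φ ∧ ∀ s : Fin k → A, S s ↔ φ.Realize (Sum.elim s p)

/-! ### Elementary set theory inside `A` -/

section Inside

variable {A : Type w} [TransitiveUniverse A]

/-- `a = ∅`. -/
def IsEmptySet (a : A) : Prop := IsSet a ∧ ∀ x, ¬ x ε a

/-- `a = {∅}`, which is also the ordinal `1`. -/
def IsOne (a : A) : Prop := IsSet a ∧ ∀ x, x ε a ↔ IsEmptySet x

/-- `a = {x, y}`. -/
def IsPairSet (a x y : A) : Prop := IsSet a ∧ ∀ t, t ε a ↔ t = x ∨ t = y

/-- `p = (x, y) = {{x}, {x, y}}`. -/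
def IsOPair (p x y : A) : Prop :=
  ∃ s d, IsPairSet s x x ∧ IsPairSet d x y ∧ IsPairSet p s d

/-- `a` is an ordinal: a transitive set of transitive sets. -/
def IsOrd (a : A) : Prop :=
  IsSet a ∧ (∀ y, y ε a → ∀ t, t ε y → t ε a) ∧
    ∀ y, y ε a → IsSet y ∧ ∀ t, t ε y → ∀ r, r ε t → r ε y

/-- `a` is a limit ordinal (in particular nonzero). -/
def IsLimitOrd (a : A) : Prop :=
  IsOrd a ∧ (∃ b, b ε a) ∧ ∀ b, b ε a → ∃ c, c ε a ∧ b ε c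

/-- `a` is a successor ordinal. -/
def IsSuccOrd (a : A) : Prop := IsOrd a ∧ ∃ b, b ε a ∧ ∀ c, c ε a ↔ c ε b ∨ c = b

/-- The rank of an element of `A`; for an ordinal of `A` this is its order type. -/
noncomputable def ordOf (a : A) : Ordinal.{w} := IsWellFounded.rank (fun x y : A => x ε y) a

/-- The pair `(x, y)` belongs to `f`. -/
def Maps (f x y : A) : Prop := ∃ p, p ε f ∧ IsOPair p x y

/-- `f` is a function. -/
def IsFunction (f : A) : Prop :=
  IsSet f ∧ (∀ p, p ε f → ∃ x y, IsOPair p x y) ∧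
    ∀ x y y', Maps f x y → Maps f x y' → y = y'

/-- `dom[f] = d`. -/
def HasDomain (f d : A) : Prop := ∀ x, x ε d ↔ ∃ y, Maps f x y

/-- `y ∈ rng[f]`. -/
def InRange (f y : A) : Prop := ∃ x, Maps f x y

/-- `q = (0, q')`. -/
def IsCoOf (q q' : A) : Prop := ∃ o, IsEmptySet o ∧ IsOPair q o q'

end Inside

/-- A realization of `ω` in `A`: elements `carrier` and `order` of `A` such that
`(carrier, order)` is a copy of `(ω, <)`, with its isomorphism `num`. -/
structure OmegaCopy (A : Type w) [TransitiveUniverse A] where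
  carrier : A
  order : A
  num : ℕ → A
  num_injective : Function.Injective num
  mem_carrier : ∀ a, a ε carrier ↔ ∃ n, a = num n
  mem_order : ∀ a, a ε order ↔ ∃ m n, m < n ∧ IsOPair a (num m) (num n)

/-! ### Borel multicodes -/

section Multicodes

variable {A : Type w} [TransitiveUniverse A] (W : OmegaCopy A)

/-- `q` is a function from (the copy of) `ω` to `{0, 1}`. -/
def IsOneCode (q : A) : Prop :=
  IsFunction q ∧ HasDomain q W.carrier ∧ ∀ y, InRange q y → IsEmptySet y ∨ IsOne y

/-- `q` is an `a`-multicode (`B_Σ(a, q)`). -/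
def BSigma (a q : A) : Prop :=
  (IsOne a ∧ IsOneCode W q) ∨
  (IsOrd a ∧ (∃ o, o ε a ∧ IsOne o) ∧ IsFunction q ∧
    (IsLimitOrd a → HasDomain q a) ∧ (IsSuccOrd a → HasDomain q W.carrier) ∧
    ∀ q', InRange q q' → ∃ b, ∃ _ : b ε a,
      (∃ q'', IsCoOf q' q'' ∧ BSigma b q'') ∨ BSigma b q')
termination_by (TransitiveUniverse.wf (A := A)).wrap a
decreasing_by all_goals assumption

/-- `q` is a co-`a`-multicode (`B_Π(a, q)`). -/
def BPi (a q : A) : Prop := ∃ q', IsCoOf q q' ∧ BSigma W a q'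

theorem transGen_of_isOPair {p x y : A} (h : IsOPair p x y) :
    Relation.TransGen (fun x y : A => x ε y) y p := by
  obtain ⟨s, d, _, hd, hp⟩ := h
  exact .tail (.single ((hd.2 y).2 (Or.inr rfl))) ((hp.2 d).2 (Or.inr rfl))

theorem transGen_of_isCoOf {q q' : A} (h : IsCoOf q q') :
    Relation.TransGen (fun x y : A => x ε y) q' q := by
  obtain ⟨_, _, h⟩ := h
  exact transGen_of_isOPair h

theorem transGen_of_inRange {q q' : A} (h : InRange q q') :
    Relation.TransGen (fun x y : A => x ε y) q' q := by
  obtain ⟨_, p, hp, h⟩ := h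
  exact .tail (transGen_of_isOPair h) hp

/-- The set `B_q` described by a (co-)multicode `q`, relative to the basis `U`: the union of the
`U n` with `q(n) = 1` for a `1`-multicode, the complement of `B_{q'}` for `q = (0, q')`, the union
of the `B_{q'}`, `q' ∈ rng[q]`, for the other multicodes. -/
def codedSet {X : Type z} (U : ℕ → Set X) (q : A) : Set X :=
  {y | (IsOneCode W q ∧ ∃ n, (∃ i, IsOne i ∧ Maps q (W.num n) i) ∧ y ∈ U n) ∨
    (¬ IsOneCode W q ∧ ∃ q', ∃ _ : IsCoOf q q', y ∉ codedSet U q') ∨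
    (¬ IsOneCode W q ∧ ∃ q', ∃ _ : InRange q q', y ∈ codedSet U q')}
termination_by (TransitiveUniverse.wf (A := A)).transGen.wrap q
decreasing_by
  · exact transGen_of_isCoOf ‹_›
  · exact transGen_of_inRange ‹_›

/-- The Borel set `B` is constructible in `A`: it is described by an `a`-multicode or a
co-`a`-multicode belonging to `A`, for a countable ordinal `a` of `A`. -/
def Constructible {X : Type z} [TopologicalSpace X] (U : ℕ → Set X) (B : Set X) : Prop :=
  @MeasurableSet X (borel X) B ∧
    ∃ q a : A, IsOrd a ∧ {b | b ε a}.Countable ∧ (BSigma W a q ∨ BPi W a q) ∧ codedSet W U q = B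

end Multicodes

/-! ### Closed permutation groups and `α`-sets -/

/-- The topology of pointwise convergence on the group of all permutations of `ω`. -/
instance permTopology : TopologicalSpace (Equiv.Perm ℕ) :=
  TopologicalSpace.induced (fun f : Equiv.Perm ℕ => (f : ℕ → ℕ)) inferInstance

/-- `σ` is (the graph of) a bijection between finite subsets of `ω`. -/
def IsFinBij (σ : Finset (ℕ × ℕ)) : Prop :=
  ∀ p ∈ σ, ∀ q ∈ σ, p.1 = q.1 ↔ p.2 = q.2

/-- `dom[σ]`. -/
def fdom (σ : Finset (ℕ × ℕ)) : Finset ℕ := σ.image Prod.fst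

/-- `rng[σ]`. -/
def frng (σ : Finset (ℕ × ℕ)) : Finset ℕ := σ.image Prod.snd

section Action

variable (G : Subgroup (Equiv.Perm ℕ))

/-- The set of all restrictions of elements of `G` to finite sets. -/
def finRestrictions : Set (Finset (ℕ × ℕ)) :=
  {σ | ∃ f ∈ G, ∃ d : Finset ℕ, σ = d.image fun k => (k, f k)}

/-- The elements of `G` extending `σ`. -/
def extensions (σ : Finset (ℕ × ℕ)) : Set G := {f | ∀ p ∈ σ, (f : Equiv.Perm ℕ) p.1 = p.2}

/-- The pointwise stabilizer in `G` of the finite set `c`. -/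
def pointStab (c : Finset ℕ) : Set G := {f | ∀ k ∈ c, (f : Equiv.Perm ℕ) k = k}

variable {X : Type z} [MulAction G X]

/-- The saturation `V_c^G B` of `B ⊆ X` under the stabilizer of `c`. -/
def saturation (c : Finset ℕ) (B : Set X) : Set X :=
  {y | ∃ f ∈ pointStab G c, ∃ t ∈ B, y = f • t}

/-- `V_σ^G x ∩ B ≠ ∅`. -/
def Meets (x : X) (σ : Finset (ℕ × ℕ)) (B : Set X) : Prop :=
  ∃ f ∈ extensions G σ, f • x ∈ B

/-- The `α`-set `B_α(x, σ)`, for `α ≥ 1`. The index `0` is not used: its value is the whole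
space, so that it does not contribute at limits. -/
noncomputable def alphaSet (U : ℕ → Set X) (x : X) (α : Ordinal.{w}) :
    Finset (ℕ × ℕ) → Set X :=
  Ordinal.limitRecOn α
    (fun _ => Set.univ)
    (fun β B σ =>
      {y | (β = 0 →
          (∀ l, Meets G x σ (U l) → y ∈ saturation G (frng σ) (U l)) ∧
          (∀ l, ¬ Meets G x σ (U l) → y ∉ saturation G (frng σ) (U l))) ∧
        (β ≠ 0 →
          (∀ b : Finset ℕ, fdom σ ⊆ b →
            ∃ σ' ∈ finRestrictions G, σ ⊆ σ' ∧ fdom σ' = b ∧ y ∈ B σ') ∧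
          (∀ a : Finset ℕ, frng σ ⊆ a →
            ∃ σ' ∈ finRestrictions G, σ ⊆ σ' ∧ frng σ' = a ∧ y ∈ B σ'))})
    (fun α _ B σ => {y | ∀ β, ∀ h : β < α, y ∈ B β h σ})

end Action

/-! ### Coding of points -/

section Coding

variable {A : Type w} [TransitiveUniverse A] (W : OmegaCopy A)

/-- `s` is the copy in `A` of the finite set `c` of natural numbers. -/
def CodesFinset (c : Finset ℕ) (s : A) : Prop :=
  IsSet s ∧ ∀ t, t ε s ↔ ∃ k ∈ c, t = W.num k

/-- `s` is the copy in `A` of the finite bijection `σ`. -/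
def CodesFinBij (σ : Finset (ℕ × ℕ)) (s : A) : Prop :=
  IsSet s ∧ ∀ t, t ε s ↔ ∃ p ∈ σ, IsOPair t (W.num p.1) (W.num p.2)

variable (G : Subgroup (Equiv.Perm ℕ)) {X : Type z} [MulAction G X] (U : ℕ → Set X)

/-- `t` is the value at `σ` of the function coding `x`: the empty set if `σ` is not a restriction
of an element of `G`, and `{l : V_σ^G x ∩ U l ≠ ∅}` otherwise. -/
def IsCodeValue (x : X) (σ : Finset (ℕ × ℕ)) (t : A) : Prop :=
  IsSet t ∧ ∀ r, r ε t ↔ σ ∈ finRestrictions G ∧ ∃ l, Meets G x σ (U l) ∧ r = W.num l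

/-- `x` is codable in `A` (for the realization `W` of `ω`): the function which maps every finite
bijection `σ` to the value described in `IsCodeValue` is an element of `A`. -/
def Codable (x : X) : Prop :=
  ∃ f : A, IsSet f ∧
    (∀ p, p ε f → ∃ σ s t, IsFinBij σ ∧ CodesFinBij W σ s ∧ IsCodeValue W G U x σ t ∧
      IsOPair p s t) ∧
    ∀ σ, IsFinBij σ → ∃ s t, CodesFinBij W σ s ∧ IsCodeValue W G U x σ t ∧ Maps f s t

/-- The relation `Imp(c, l, k)`: `U k ⊆ V_c^G (U l)`, as a relation on `A`. -/
def Imp (s : Fin 3 → A) : Prop :=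
  ∃ (c : Finset ℕ) (l k : ℕ), CodesFinset W c (s 0) ∧ s 1 = W.num l ∧ s 2 = W.num k ∧
    U k ⊆ saturation G c (U l)

end Coding

/-- For `α = λ + n` with `λ` zero or limit and `n` finite, the ordinal `λ + 2n`. -/
noncomputable def codeLevel (α : Ordinal.{w}) : Ordinal.{w} :=
  Ordinal.omega0 * (α / Ordinal.omega0) + 2 * (α % Ordinal.omega0)

end AdmCoding

open AdmCoding

/-!
The main point is that the saturations `V_c (U l)`, from which the `1`-sets are built, can be replaced
by objects which are definable in `A` from the code of `x`. For `σ` in the set `S` of finite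
restrictions of elements of `G`, let `MovesInto G U x σ l k` say that, for some `τ ∈ S` fixing the
range of `σ` pointwise, the extensions of `τ` move `U k` into `U l`, as far as this is visible in the
basic open sets met by the sets `V_ρ x`, `ρ ∈ S`. This condition quantifies over `S` only, and so is
`Δ₀` in the code of `x`. By regularity of `X` and joint continuity of the action, `B_1(x, σ)` consists
of the points `y` such that, for each `l`, `y ∉ U l` if `V_σ x` does not meet `U l`, and `y` lies in
the union of the `U k` with `MovesInto G U x σ l k` if it does (`mem_alphaSet_one_iff`): the first
condition puts `y` into the closure of `V_σ x`, and for such `y` the condition `MovesInto` really moves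
`y` into the closure of `U l`. Hence the complement of `B_1(x, σ)` has a `2`-multicode, which is
definable from `σ`.

For the other `α` one codes the complement of `B_α(x, σ)` as well. The complement of `B_{α+1}(x, σ)` is
the union, over the requirements on the domain or the range of an extension of `σ`, of the complements
of the union of the sets `B_α(x, τ)` over the extensions `τ` meeting the requirement. This increases
the level by two. To write these unions as sequences indexed by `ω`, an enumeration of the finite
relations on `ω` is needed as an element of `A`; it is obtained by recursion on `ω`, by adding `1` to
binary numbers (`exists_enumeration`). At a limit `λ` the complement is the union of the
complements of the earlier sets, and the sequence of their codes is a `λ`-multicode, as the codes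
for `α < λ` have levels below `λ`. The function which maps `α` to the codes of the complements of the
sets `B_α(x, σ)`, for all `σ` simultaneously, is therefore given by a `Σ`-recursion on the ordinals of
`A` (`exists_recursion`, `exists_alphaCodes`). That its values code the right sets is not expressible
in `A`; it is carried along the recursion as an invariant. A pair with first component `0`
finally gives the co-multicode of `B_α(x, σ)`.

To keep the definability of all these predicates out of the way, formulas are handled semantically:
`D0` and `Sg` are classes of predicates on contexts of variables, closed under the
operations with which formulas are built, so that instance search finds the defining formulas.
-/

namespace AdmCoding

/-! ### Relations definable by bounded formulas -/

section Definability

variable {A : Type w} [TransitiveUniverse A]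

/-- The relations on `A`, with variables indexed by `ι`, which are definable by `Δ₀`-formulas of
the language of set theory with urelements, with parameters. An atomic formula has as its arguments
variables or parameters, that is, elements of `ι ⊕ A`; a bounded quantifier adds the variable
`none`. -/
inductive Delta0Rel : {ι : Type} → ((ι → A) → Prop) → Prop
  | mem {ι : Type} (s t : ι ⊕ A) :
      Delta0Rel fun v : ι → A => Sum.elim v id s ε Sum.elim v id t
  | eq {ι : Type} (s t : ι ⊕ A) :
      Delta0Rel fun v : ι → A => Sum.elim v id s = Sum.elim v id t
  | ur {ι : Type} (s : ι ⊕ A) :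
      Delta0Rel fun v : ι → A => TransitiveUniverse.IsUr (Sum.elim v id s)
  | false {ι : Type} : Delta0Rel fun _ : ι → A => False
  | imp {ι : Type} {P Q : (ι → A) → Prop} :
      Delta0Rel P → Delta0Rel Q → Delta0Rel fun v => P v → Q v
  | ball {ι : Type} (t : ι ⊕ A) {P : (Option ι → A) → Prop} : Delta0Rel P →
      Delta0Rel fun v : ι → A => ∀ x, x ε Sum.elim v id t → P fun o => o.elim x v

/-- Substitution of variables and parameters for variables. -/
theorem Delta0Rel.subst {ι : Type} {P : (ι → A) → Prop} (h : Delta0Rel P) :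
    ∀ {κ : Type} (f : ι → κ ⊕ A),
      Delta0Rel fun v : κ → A => P fun i => Sum.elim v id (f i) := by
  have key : ∀ {ι κ : Type} (f : ι → κ ⊕ A) (s : ι ⊕ A) (v : κ → A),
      Sum.elim (fun i => Sum.elim v id (f i)) id s = Sum.elim v id (Sum.elim f Sum.inr s) := by
    rintro ι κ f (i | a) v <;> rfl
  induction h with
  | mem s t => intro κ f; simp only [key]; exact .mem _ _
  | eq s t => intro κ f; simp only [key]; exact .eq _ _
  | ur s => intro κ f; simp only [key]; exact .ur _
  | false => intro κ f; exact .false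
  | imp _ _ h₁ h₂ => intro κ f; exact .imp (h₁ f) (h₂ f)
  | @ball ι t P _ ih =>
    intro κ f
    simp only [key]
    have h := Delta0Rel.ball (Sum.elim f Sum.inr t)
      (ih (fun o : Option ι => o.elim (Sum.inl none) fun i => Sum.map some id (f i)))
    convert h using 6 with v x hx o
    rcases o with _ | i
    · rfl
    · change Sum.elim v id (f i) = Sum.elim _ id (Sum.map some id (f i))
      rcases f i with k | a <;> rfl

/-- A `Δ₀`-relation is defined by a `Δ₀`-formula. The variables of the relation may be
distributed in any way over the free and the bound variables of the formula, and the finitely many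
parameters over its free variables. -/
theorem Delta0Rel.exists_formula (L : FirstOrder.Language.{u, v}) [L.Structure A]
    {ι : Type} {P : (ι → A) → Prop} (h : Delta0Rel P) :
    ∃ (m : ℕ) (p : Fin m → A), ∀ (α : Type) (j : ℕ) (e : ι → α ⊕ Fin j) (pe : Fin m → α),
      ∃ φ : (L.sum setLang).BoundedFormula α j, IsDelta0 φ ∧
        ∀ (v : α → A) (xs : Fin j → A), (∀ i, v (pe i) = p i) →
          (φ.Realize v xs ↔ P fun i => Sum.elim v xs (e i)) := by
  have term : ∀ {ι : Type} (t : ι ⊕ A), ∃ (m : ℕ) (p : Fin m → A),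
      ∀ (α : Type) (j : ℕ) (e : ι → α ⊕ Fin j) (pe : Fin m → α), ∃ y : α ⊕ Fin j,
        ∀ (v : α → A) (xs : Fin j → A), (∀ i, v (pe i) = p i) →
          Sum.elim (fun i => Sum.elim v xs (e i)) id t = Sum.elim v xs y := by
    rintro ι (i | a)
    · exact ⟨0, Fin.elim0, fun α j e pe => ⟨e i, fun v xs _ => rfl⟩⟩
    · exact ⟨1, fun _ => a, fun α j e pe => ⟨Sum.inl (pe 0), fun v xs h => (h 0).symm⟩⟩
  have left : ∀ {α : Type} {m n : ℕ} {p : Fin m → A} {q : Fin n → A} {pe : Fin (m + n) → α}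
      {v : α → A}, (∀ i, v (pe i) = Fin.append p q i) →
      (∀ i, v (pe (Fin.castAdd n i)) = p i) ∧ ∀ i, v (pe (Fin.natAdd m i)) = q i := by
    intro α m n p q pe v h
    exact ⟨fun i => by simp [h], fun i => by simp [h]⟩
  induction h with
  | mem s t =>
    obtain ⟨m, p, hs⟩ := term s
    obtain ⟨n, q, ht⟩ := term t
    refine ⟨m + n, Fin.append p q, fun α j e pe => ?_⟩
    obtain ⟨y, hy⟩ := hs α j e fun i => pe (Fin.castAdd n i)
    obtain ⟨y', hy'⟩ := ht α j e fun i => pe (Fin.natAdd m i)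
    refine ⟨memF y y', .qf (.of_isAtomic (.rel _ _)), fun v xs h => ?_⟩
    beta_reduce
    rw [hy v xs (left h).1, hy' v xs (left h).2]
    exact BoundedFormula.realize_rel₂
  | eq s t =>
    obtain ⟨m, p, hs⟩ := term s
    obtain ⟨n, q, ht⟩ := term t
    refine ⟨m + n, Fin.append p q, fun α j e pe => ?_⟩
    obtain ⟨y, hy⟩ := hs α j e fun i => pe (Fin.castAdd n i)
    obtain ⟨y', hy'⟩ := ht α j e fun i => pe (Fin.natAdd m i)
    refine ⟨(Term.var y).bdEqual (Term.var y'), .qf (.of_isAtomic (.equal _ _)), fun v xs h => ?_⟩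
    beta_reduce
    rw [hy v xs (left h).1, hy' v xs (left h).2]
    exact BoundedFormula.realize_bdEqual _ _
  | ur s =>
    obtain ⟨m, p, hs⟩ := term s
    refine ⟨m, p, fun α j e pe => ?_⟩
    obtain ⟨y, hy⟩ := hs α j e pe
    refine ⟨Relations.boundedFormula₁ (L := L.sum setLang)
      (Sum.inr (SetRel.ur : setLang.Relations 1)) (Term.var y),
      .qf (.of_isAtomic (.rel _ _)), fun v xs h => ?_⟩
    beta_reduce
    rw [hy v xs h]
    exact BoundedFormula.realize_rel₁ (L := L.sum setLang)
  | false =>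
    exact ⟨0, Fin.elim0, fun α j e pe => ⟨⊥, .qf .falsum, fun v xs _ => Iff.rfl⟩⟩
  | imp _ _ h₁ h₂ =>
    obtain ⟨m, p, hs⟩ := h₁
    obtain ⟨n, q, ht⟩ := h₂
    refine ⟨m + n, Fin.append p q, fun α j e pe => ?_⟩
    obtain ⟨φ, hφ, hy⟩ := hs α j e fun i => pe (Fin.castAdd n i)
    obtain ⟨ψ, hψ, hy'⟩ := ht α j e fun i => pe (Fin.natAdd m i)
    refine ⟨φ ⟹ ψ, .imp hφ hψ, fun v xs h => ?_⟩
    rw [BoundedFormula.realize_imp, hy v xs (left h).1, hy' v xs (left h).2]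
  | @ball ι t P _ ih =>
    obtain ⟨m, p, hs⟩ := term t
    obtain ⟨n, q, ht⟩ := ih
    refine ⟨m + n, Fin.append p q, fun α j e pe => ?_⟩
    obtain ⟨y, hy⟩ := hs α j e fun i => pe (Fin.castAdd n i)
    obtain ⟨φ, hφ, hy'⟩ := ht α (j + 1)
      (fun o => o.elim (Sum.inr (Fin.last j)) fun i => Sum.map id Fin.castSucc (e i))
      fun i => pe (Fin.natAdd m i)
    refine ⟨ballF y φ, .ball y hφ, fun v xs h => ?_⟩
    beta_reduce
    rw [hy v xs (left h).1]
    have hsum : ∀ (x : A) (y : α ⊕ Fin j),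
        Sum.elim v (Fin.snoc xs x : Fin (j + 1) → A) (Sum.map id Fin.castSucc y) =
          Sum.elim v xs y := by
      rintro x (a | i) <;> simp
    have hlast : ∀ x : A, (Fin.snoc xs x : Fin (j + 1) → A) (Fin.last j) = x := by simp
    refine BoundedFormula.realize_all.trans (forall_congr' fun x => ?_)
    rw [BoundedFormula.realize_imp, hy' v _ (left h).2]
    refine imp_congr (BoundedFormula.realize_rel₂.trans ?_) (iff_of_eq (congrArg P ?_))
    · change (Fin.snoc xs x : Fin (j + 1) → A) (Fin.last j) ε
        Sum.elim v (Fin.snoc xs x : Fin (j + 1) → A) (Sum.map id Fin.castSucc y) ↔ _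
      rw [hsum, hlast]
    · funext o
      rcases o with _ | i
      · exact hlast x
      · exact hsum x (e i)

end Definability

section Contexts

variable {A : Type w}

/-- The empty context of variables for elements of `A`. -/
inductive NilCtx (A : Type w) : Type w
  | nil

/-- A context: a type whose elements assign elements of `A` to certain variables. The contexts in
use are `NilCtx A` and `Γ × A` for a context `Γ`, so that formulas with several variables can be
written as predicates on iterated products. -/
class Ctx (A : outParam (Type w)) (Γ : Type w) where
  /-- the variables -/
  idx : Type
  /-- the values of the variables -/
  val : Γ → idx → A

instance : Ctx A (NilCtx A) := ⟨Empty, fun _ => Empty.elim⟩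

instance {Γ : Type w} [Ctx A Γ] : Ctx A (Γ × A) :=
  ⟨Option (Ctx.idx Γ), fun p o => o.elim p.2 (Ctx.val p.1)⟩

variable {Γ Δ : Type w} [Ctx A Γ] [Ctx A Δ]

/-- `f` is a variable or a constant. -/
class Tm (f : Γ → A) : Prop where
  out : ∃ t : Ctx.idx Γ ⊕ A, ∀ γ, f γ = Sum.elim (Ctx.val γ) id t

instance Tm.const (a : A) : Tm fun _ : Γ => a := ⟨Sum.inr a, fun _ => rfl⟩

instance Tm.var0 : Tm fun p : Γ × A => p.2 := ⟨Sum.inl none, fun _ => rfl⟩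

theorem Tm.weaken {f : Γ → A} (h : Tm f) : Tm fun p : Γ × A => f p.1 := by
  obtain ⟨t, ht⟩ := h
  refine ⟨Sum.map some id t, fun p => ?_⟩
  rw [ht]
  rcases t with i | a <;> rfl

instance Tm.var1 : Tm fun p : (Γ × A) × A => p.1.2 := Tm.weaken Tm.var0
instance Tm.var2 : Tm fun p : ((Γ × A) × A) × A => p.1.1.2 := Tm.weaken Tm.var1
instance Tm.var3 : Tm fun p : (((Γ × A) × A) × A) × A => p.1.1.1.2 := Tm.weaken Tm.var2
instance Tm.var4 : Tm fun p : ((((Γ × A) × A) × A) × A) × A => p.1.1.1.1.2 :=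
  Tm.weaken Tm.var3
instance Tm.var5 : Tm fun p : (((((Γ × A) × A) × A) × A) × A) × A => p.1.1.1.1.1.2 :=
  Tm.weaken Tm.var4
instance Tm.var6 : Tm fun p : ((((((Γ × A) × A) × A) × A) × A) × A) × A => p.1.1.1.1.1.1.2 :=
  Tm.weaken Tm.var5
instance Tm.var7 : Tm fun p : (((((((Γ × A) × A) × A) × A) × A) × A) × A) × A =>
    p.1.1.1.1.1.1.1.2 := Tm.weaken Tm.var6
instance Tm.var8 : Tm fun p : ((((((((Γ × A) × A) × A) × A) × A) × A) × A) × A) × A =>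
    p.1.1.1.1.1.1.1.1.2 := Tm.weaken Tm.var7
instance Tm.var9 : Tm fun p : (((((((((Γ × A) × A) × A) × A) × A) × A) × A) × A) × A) × A =>
    p.1.1.1.1.1.1.1.1.1.2 := Tm.weaken Tm.var8

instance Tm.var10 :
    Tm fun p : ((((((((((Γ × A) × A) × A) × A) × A) × A) × A) × A) × A) × A) × A =>
    p.1.1.1.1.1.1.1.1.1.1.2 := Tm.weaken Tm.var9

/-- A map between contexts is a substitution if each of its components is a variable or a
constant. -/
def Subst (f : Δ → Γ) : Prop := ∀ i, Tm fun δ => Ctx.val (f δ) i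

theorem Subst.id : Subst fun γ : Γ => γ := fun i => ⟨Sum.inl i, fun _ => rfl⟩

theorem Subst.const (γ : Γ) : Subst fun _ : Δ => γ := fun i => Tm.const (Ctx.val γ i)

theorem Subst.weaken {f : Δ → Γ} (h : Subst f) : Subst fun p : Δ × A => f p.1 :=
  fun i => Tm.weaken (h i)

theorem Subst.pair {f : Δ → Γ} (h : Subst f) (g : Δ → A) [hg : Tm g] :
    Subst fun δ => (f δ, g δ)
  | none => hg
  | some i => h i

end Contexts

section Formulas

variable {A : Type w} [TransitiveUniverse A] {Γ Δ : Type w} [Ctx A Γ] [Ctx A Δ]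

/-- The predicate `P` is `Δ₀` with parameters. This is a class, so that a definition of a predicate
by bounded quantifiers is recognized as such by instance search. -/
class D0 (P : Γ → Prop) : Prop where
  out : ∃ P' : (Ctx.idx Γ → A) → Prop, Delta0Rel P' ∧ ∀ γ, P γ ↔ P' (Ctx.val γ)

/-- The predicate `P` is `Σ₁` with parameters. -/
class Sg (P : Γ → Prop) : Prop where
  out : ∃ P₀ : Γ × A → Prop, D0 P₀ ∧ ∀ γ, P γ ↔ ∃ w, P₀ (γ, w)

theorem D0.comp {P : Γ → Prop} (h : D0 P) {f : Δ → Γ} (hf : Subst f) : D0 fun δ => P (f δ) := by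
  obtain ⟨P', h, hP⟩ := h
  choose t ht using fun i => (hf i).out
  refine ⟨_, h.subst t, fun δ => ?_⟩
  rw [hP]
  exact iff_of_eq (congrArg P' (funext fun i => ht i δ))

theorem D0.congr {P Q : Γ → Prop} (h : ∀ γ, P γ ↔ Q γ) (hQ : D0 Q) : D0 P := by
  obtain rfl : P = Q := funext fun γ => propext (h γ)
  exact hQ

/-- A `Δ₀`-predicate of one variable may be applied to any variable or constant. -/
theorem D0.app₁ {R : A → Prop} (h : D0 fun p : NilCtx A × A => R p.2) (f : Γ → A) [Tm f] :
    D0 fun γ => R (f γ) :=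
  h.comp ((Subst.const .nil).pair f)

theorem D0.app₂ {R : A → A → Prop} (h : D0 fun p : (NilCtx A × A) × A => R p.1.2 p.2)
    (f g : Γ → A) [Tm f] [Tm g] : D0 fun γ => R (f γ) (g γ) :=
  h.comp (((Subst.const .nil).pair f).pair g)

theorem D0.app₃ {R : A → A → A → Prop}
    (h : D0 fun p : ((NilCtx A × A) × A) × A => R p.1.1.2 p.1.2 p.2)
    (f g k : Γ → A) [Tm f] [Tm g] [Tm k] : D0 fun γ => R (f γ) (g γ) (k γ) :=
  h.comp ((((Subst.const .nil).pair f).pair g).pair k)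

instance D0.mem (f g : Γ → A) [hf : Tm f] [hg : Tm g] : D0 fun γ => f γ ε g γ := by
  obtain ⟨s, hs⟩ := hf
  obtain ⟨t, ht⟩ := hg
  exact ⟨_, .mem s t, fun γ => by rw [hs, ht]⟩

instance D0.eq (f g : Γ → A) [hf : Tm f] [hg : Tm g] : D0 fun γ => f γ = g γ := by
  obtain ⟨s, hs⟩ := hf
  obtain ⟨t, ht⟩ := hg
  exact ⟨_, .eq s t, fun γ => by rw [hs, ht]⟩

instance D0.false : D0 fun _ : Γ => False := ⟨_, .false, fun _ => Iff.rfl⟩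

instance D0.imp (P Q : Γ → Prop) [hP : D0 P] [hQ : D0 Q] : D0 fun γ => P γ → Q γ := by
  obtain ⟨P', hP', h⟩ := hP
  obtain ⟨Q', hQ', h'⟩ := hQ
  exact ⟨_, .imp hP' hQ', fun γ => by rw [h, h']⟩

instance D0.not (P : Γ → Prop) [D0 P] : D0 fun γ => ¬ P γ := D0.imp P fun _ => False

instance D0.true : D0 fun _ : Γ => True :=
  D0.congr (Q := fun _ => ¬ False) (fun _ => by simp) inferInstance

instance D0.and (P Q : Γ → Prop) [D0 P] [D0 Q] : D0 fun γ => P γ ∧ Q γ :=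
  D0.congr (Q := fun γ => ¬ (P γ → ¬ Q γ)) (fun γ => by tauto) inferInstance

instance D0.or (P Q : Γ → Prop) [D0 P] [D0 Q] : D0 fun γ => P γ ∨ Q γ :=
  D0.congr (Q := fun γ => ¬ P γ → Q γ) (fun γ => by tauto) inferInstance

instance D0.iff (P Q : Γ → Prop) [D0 P] [D0 Q] : D0 fun γ => P γ ↔ Q γ :=
  D0.congr (Q := fun γ => (P γ → Q γ) ∧ (Q γ → P γ)) (fun γ => by tauto) inferInstance

instance D0.ball (f : Γ → A) (Q : Γ → A → Prop) [hf : Tm f] [hQ : D0 fun p : Γ × A => Q p.1 p.2] :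
    D0 fun γ => ∀ x, x ε f γ → Q γ x := by
  obtain ⟨s, hs⟩ := hf
  obtain ⟨Q', hQ', h⟩ := hQ
  refine ⟨_, .ball s hQ', fun γ => ?_⟩
  rw [hs]
  exact forall₂_congr fun x _ => h (γ, x)

instance D0.bex (f : Γ → A) (Q : Γ → A → Prop) [Tm f] [D0 fun p : Γ × A => Q p.1 p.2] :
    D0 fun γ => ∃ x, x ε f γ ∧ Q γ x :=
  D0.congr (Q := fun γ => ¬ ∀ x, x ε f γ → ¬ Q γ x) (fun γ => by simp) inferInstance

instance D0.isUr (f : Γ → A) [hf : Tm f] : D0 fun γ => TransitiveUniverse.IsUr (f γ) := by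
  obtain ⟨s, hs⟩ := hf
  exact ⟨_, .ur s, fun γ => by rw [hs]⟩

instance D0.isSet (f : Γ → A) [Tm f] : D0 fun γ => IsSet (f γ) :=
  D0.not fun γ => TransitiveUniverse.IsUr (f γ)

end Formulas

/-! ### The axioms of Kripke–Platek set theory -/

/-- The axioms of `KPU`, for `Δ₀`-predicates of the language of set theory. -/
class KPU (A : Type w) [TransitiveUniverse A] : Prop where
  exists_set : ∃ a : A, IsSet a
  pair : ∀ x y : A, ∃ a, IsSet a ∧ x ε a ∧ y ε a
  union : ∀ a : A, ∃ b, IsSet b ∧ ∀ y, y ε a → ∀ x, x ε y → x ε b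
  separation : ∀ (P : A → Prop) [D0 fun p : NilCtx A × A => P p.2] (a : A),
    ∃ b, IsSet b ∧ ∀ x, x ε b ↔ x ε a ∧ P x
  collection : ∀ (P : A → A → Prop) [D0 fun p : (NilCtx A × A) × A => P p.1.2 p.2] (a : A),
    (∀ x, x ε a → ∃ y, P x y) → ∃ b, IsSet b ∧ ∀ x, x ε a → ∃ y, y ε b ∧ P x y

theorem Admissible.kpu {L : FirstOrder.Language.{u, v}} {A : Type w} [TransitiveUniverse A]
    [L.Structure A] (hA : Admissible L A) : KPU A where
  exists_set := hA.exists_set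
  pair := hA.pair
  union := hA.union
  separation := by
    rintro P ⟨P', hP', h⟩ a
    obtain ⟨m, p, hp⟩ := hP'.exists_formula L
    obtain ⟨φ, hφ, hφP⟩ := hp (Fin (m + 1)) 0
      (fun o : Option Empty => o.elim (Sum.inl 0) Empty.elim) Fin.succ
    obtain ⟨b, hb, hba⟩ := hA.separation m φ hφ p a
    refine ⟨b, hb, fun x => (hba x).trans (and_congr_right fun _ => ?_)⟩
    refine (hφP _ _ fun i => rfl).trans (Iff.trans (iff_of_eq (congrArg P' ?_)) (h (.nil, x)).symm)
    funext o
    rcases o with _ | ⟨⟨⟩⟩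
    rfl
  collection := by
    rintro P ⟨P', hP', h⟩ a hx
    obtain ⟨m, p, hp⟩ := hP'.exists_formula L
    obtain ⟨φ, hφ, hφP⟩ := hp (Fin (m + 2)) 0
      (fun o : Option (Option Empty) => o.elim (Sum.inl 1) fun o => o.elim (Sum.inl 0) Empty.elim)
      fun i => i.succ.succ
    have key : ∀ x y, P x y ↔
        Formula.Realize φ (Fin.cons x (Fin.cons y p : Fin (m + 1) → A) : Fin (m + 2) → A) := by
      intro x y
      refine (h ((.nil, x), y)).trans (Iff.trans (iff_of_eq (congrArg P' ?_))
        (hφP _ _ fun i => rfl).symm)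
      funext o
      rcases o with _ | _ | ⟨⟨⟩⟩ <;> rfl
    simp only [key] at hx ⊢
    exact hA.collection m φ hφ p a hx

section Sigma

variable {A : Type w} [TransitiveUniverse A] {Γ Δ : Type w} [Ctx A Γ] [Ctx A Δ]

theorem Sg.comp {P : Γ → Prop} (h : Sg P) {f : Δ → Γ} (hf : Subst f) : Sg fun δ => P (f δ) := by
  obtain ⟨P₀, hP₀, h⟩ := h
  exact ⟨fun p => P₀ (f p.1, p.2), hP₀.comp (hf.weaken.pair fun p => p.2), fun δ => h (f δ)⟩

theorem Sg.app₂ {R : A → A → Prop} (h : Sg fun p : (NilCtx A × A) × A => R p.1.2 p.2)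
    (f g : Γ → A) [Tm f] [Tm g] : Sg fun γ => R (f γ) (g γ) :=
  h.comp (((Subst.const .nil).pair f).pair g)

theorem Sg.app₃ {R : A → A → A → Prop}
    (h : Sg fun p : ((NilCtx A × A) × A) × A => R p.1.1.2 p.1.2 p.2)
    (f g k : Γ → A) [Tm f] [Tm g] [Tm k] : Sg fun γ => R (f γ) (g γ) (k γ) :=
  h.comp ((((Subst.const .nil).pair f).pair g).pair k)

variable [KPU A]

instance (priority := low) D0.sg (P : Γ → Prop) [h : D0 P] : Sg P :=
  ⟨fun p => P p.1, h.comp Subst.id.weaken, fun γ => by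
    have ⟨a, _⟩ := KPU.exists_set (A := A)
    exact ⟨fun h => ⟨a, h⟩, fun ⟨_, h⟩ => h⟩⟩

instance Sg.or (P Q : Γ → Prop) [hP : Sg P] [hQ : Sg Q] : Sg fun γ => P γ ∨ Q γ := by
  obtain ⟨P₀, hP₀, h⟩ := hP
  obtain ⟨Q₀, hQ₀, h'⟩ := hQ
  exact ⟨fun p => P₀ p ∨ Q₀ p, inferInstance, fun γ => by rw [h, h', exists_or]⟩

instance Sg.imp (P Q : Γ → Prop) [D0 P] [Sg Q] : Sg fun γ => P γ → Q γ := by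
  simp only [imp_iff_not_or]
  infer_instance

instance Sg.and (P Q : Γ → Prop) [hP : Sg P] [hQ : Sg Q] : Sg fun γ => P γ ∧ Q γ := by
  obtain ⟨P₀, hP₀, h⟩ := hP
  obtain ⟨Q₀, hQ₀, h'⟩ := hQ
  have := hP₀.comp (Δ := (Γ × A) × A) (Subst.id.weaken.weaken.pair fun p => p.2)
  have := hQ₀.comp (Δ := (Γ × A) × A) (Subst.id.weaken.weaken.pair fun p => p.2)
  refine ⟨fun p => (∃ w, w ε p.2 ∧ P₀ (p.1, w)) ∧ ∃ w, w ε p.2 ∧ Q₀ (p.1, w), inferInstance,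
    fun γ => ⟨fun ⟨hp, hq⟩ => ?_, fun ⟨b, ⟨w, _, hp⟩, w', _, hq⟩ =>
      ⟨(h γ).2 ⟨w, hp⟩, (h' γ).2 ⟨w', hq⟩⟩⟩⟩
  obtain ⟨w, hw⟩ := (h γ).1 hp
  obtain ⟨w', hw'⟩ := (h' γ).1 hq
  obtain ⟨b, _, hb, hb'⟩ := KPU.pair w w'
  exact ⟨b, ⟨w, hb, hw⟩, w', hb', hw'⟩

instance Sg.ex (Q : Γ → A → Prop) [hQ : Sg fun p : Γ × A => Q p.1 p.2] :
    Sg fun γ => ∃ x, Q γ x := by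
  obtain ⟨Q₀, hQ₀, h⟩ := hQ
  have := hQ₀.comp (Δ := ((Γ × A) × A) × A)
    ((Subst.id.weaken.weaken.weaken.pair fun p => p.1.2).pair fun p => p.2)
  refine ⟨fun p => ∃ x, x ε p.2 ∧ ∃ w, w ε p.2 ∧ Q₀ ((p.1, x), w), inferInstance,
    fun γ => ⟨fun ⟨x, hx⟩ => ?_, fun ⟨b, x, _, w, _, hw⟩ => ⟨x, (h (γ, x)).2 ⟨w, hw⟩⟩⟩⟩
  obtain ⟨w, hw⟩ := (h (γ, x)).1 hx
  obtain ⟨b, _, hb, hb'⟩ := KPU.pair x w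
  exact ⟨b, x, hb, w, hb', hw⟩

instance Sg.bex (f : Γ → A) (Q : Γ → A → Prop) [Tm f] [Sg fun p : Γ × A => Q p.1 p.2] :
    Sg fun γ => ∃ x, x ε f γ ∧ Q γ x :=
  have : Tm fun p : Γ × A => f p.1 := Tm.weaken ‹_›
  inferInstance

instance Sg.ball (f : Γ → A) (Q : Γ → A → Prop) [hf : Tm f] [hQ : Sg fun p : Γ × A => Q p.1 p.2] :
    Sg fun γ => ∀ x, x ε f γ → Q γ x := by
  obtain ⟨Q₀, hQ₀, h⟩ := hQ
  have := hQ₀.comp (Δ := ((Γ × A) × A) × A)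
    ((Subst.id.weaken.weaken.weaken.pair fun p => p.1.2).pair fun p => p.2)
  have : Tm fun p : Γ × A => f p.1 := hf.weaken
  refine ⟨fun p => ∀ x, x ε f p.1 → ∃ w, w ε p.2 ∧ Q₀ ((p.1, x), w), inferInstance,
    fun γ => ⟨fun hx => ?_, fun ⟨b, hb⟩ x hx => ?_⟩⟩
  · have := hQ₀.comp (Δ := (NilCtx A × A) × A)
      (((Subst.const γ).pair fun p => p.1.2).pair fun p => p.2)
    obtain ⟨b, _, hb⟩ := KPU.collection (fun x w => Q₀ ((γ, x), w)) (f γ)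
      fun x hxf => (h (γ, x)).1 (hx x hxf)
    exact ⟨b, hb⟩
  · obtain ⟨w, _, hw⟩ := hb x hx
    exact (h (γ, x)).2 ⟨w, hw⟩

omit [KPU A] in
/-- A `Σ₁`-predicate of three variables is `Σ`-definable in the sense of formulas. -/
theorem Sg.sigmaDefinable (L : FirstOrder.Language.{u, v}) [L.Structure A] (R : A → A → A → Prop)
    [hR : Sg fun p : ((NilCtx A × A) × A) × A => R p.1.1.2 p.1.2 p.2] :
    SigmaDefinable L (fun s : Fin 3 → A => R (s 0) (s 1) (s 2)) := by
  obtain ⟨R₀, ⟨R', hR', h'⟩, h⟩ := hR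
  obtain ⟨m, p, hp⟩ := hR'.exists_formula L
  obtain ⟨φ, hφ, hφR⟩ := hp (Fin 3 ⊕ Fin m) 1
    (fun o : Option (Option (Option (Option Empty))) => o.elim (Sum.inr 0) fun o =>
      o.elim (Sum.inl (Sum.inl 2)) fun o => o.elim (Sum.inl (Sum.inl 1)) fun o =>
        o.elim (Sum.inl (Sum.inl 0)) Empty.elim) Sum.inr
  refine ⟨m, φ.ex, p, .ex (.delta0 hφ), fun s => ?_⟩
  refine (h (((.nil, s 0), s 1), s 2)).trans (Iff.trans ?_ BoundedFormula.realize_ex.symm)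
  refine exists_congr fun x => (h' _).trans (Iff.trans (iff_of_eq (congrArg R' ?_))
    (hφR (Sum.elim s p) _ fun i => rfl).symm)
  funext o
  rcases o with _ | _ | _ | _ | ⟨⟨⟩⟩ <;> rfl

end Sigma

/-! ### Pairs, finite sets and functions in a model of `KPU` -/

section Sets

variable {A : Type w} [TransitiveUniverse A]

theorem isSet_of_mem {a x : A} (h : x ε a) : IsSet a :=
  fun hu => TransitiveUniverse.not_mem_ur a x hu h

theorem IsSet.ext {a b : A} (ha : IsSet a) (hb : IsSet b) (h : ∀ x, x ε a ↔ x ε b) : a = b :=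
  TransitiveUniverse.ext a b ha hb h

theorem IsEmptySet.unique {a b : A} (ha : IsEmptySet a) (hb : IsEmptySet b) : a = b :=
  ha.1.ext hb.1 fun x => iff_of_false (ha.2 x) (hb.2 x)

theorem IsPairSet.unique {a b x y : A} (ha : IsPairSet a x y) (hb : IsPairSet b x y) : a = b :=
  ha.1.ext hb.1 fun t => (ha.2 t).trans (hb.2 t).symm

theorem IsOPair.unique {p q x y : A} (hp : IsOPair p x y) (hq : IsOPair q x y) : p = q := by
  obtain ⟨s, d, hs, hd, hp⟩ := hp
  obtain ⟨s', d', hs', hd', hq⟩ := hq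
  obtain rfl := hs.unique hs'
  obtain rfl := hd.unique hd'
  exact hp.unique hq

theorem IsOPair.inj {p x y x' y' : A} (h : IsOPair p x y) (h' : IsOPair p x' y') :
    x = x' ∧ y = y' := by
  obtain ⟨s, d, ⟨_, hs⟩, ⟨_, hd⟩, _, hp⟩ := h
  obtain ⟨s', d', ⟨_, hs'⟩, ⟨_, hd'⟩, _, hp'⟩ := h'
  have h1 := (hp' s).1 ((hp s).2 (.inl rfl))
  have h2 := (hp' d).1 ((hp d).2 (.inr rfl))
  have h4 := (hp d').1 ((hp' d').2 (.inr rfl))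
  have e1 := (hs x).2 (.inl rfl)
  have e2 := (hd y).2 (.inr rfl)
  have e3 := (hd' x').2 (.inl rfl)
  have e4 := (hd' y').2 (.inr rfl)
  have hx : x = x' := by grind
  subst hx
  exact ⟨rfl, by grind⟩

theorem IsOPair.exists_mem {p x y : A} (h : IsOPair p x y) : ∃ d, d ε p ∧ x ε d ∧ y ε d := by
  obtain ⟨s, d, hs, hd, hp⟩ := h
  exact ⟨d, (hp.2 d).2 (.inr rfl), (hd.2 x).2 (.inl rfl), (hd.2 y).2 (.inr rfl)⟩

theorem IsCoOf.unique {q q₁ q₂ : A} (h₁ : IsCoOf q q₁) (h₂ : IsCoOf q q₂) : q₁ = q₂ := by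
  obtain ⟨_, _, h₁⟩ := h₁
  obtain ⟨_, _, h₂⟩ := h₂
  exact (h₁.inj h₂).2

theorem IsCoOf.unique_left {p q r : A} (hp : IsCoOf p r) (hq : IsCoOf q r) : p = q := by
  obtain ⟨_, ho, hp⟩ := hp
  obtain ⟨_, ho', hq⟩ := hq
  obtain rfl := ho.unique ho'
  exact hp.unique hq

theorem IsFunction.eq {f g d : A} (hf : IsFunction f) (hg : IsFunction g) (hd : HasDomain f d)
    (hd' : HasDomain g d) (h : ∀ x y, x ε d → Maps f x y → Maps g x y) : f = g := by
  refine hf.1.ext hg.1 fun p => ⟨fun hp => ?_, fun hp => ?_⟩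
  · obtain ⟨x, y, hpxy⟩ := hf.2.1 p hp
    have hm : Maps f x y := ⟨p, hp, hpxy⟩
    obtain ⟨q, hq, hqxy⟩ := h x y ((hd x).2 ⟨y, hm⟩) hm
    rwa [hpxy.unique hqxy]
  · obtain ⟨x, y, hpxy⟩ := hg.2.1 p hp
    have hx := (hd' x).2 ⟨y, p, hp, hpxy⟩
    obtain ⟨y', hy'⟩ := (hd x).1 hx
    obtain rfl := hg.2.2 x y y' ⟨p, hp, hpxy⟩ (h x y' hx hy')
    obtain ⟨q, hq, hqxy⟩ := hy'
    rwa [hpxy.unique hqxy]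

section Bounded

variable {Γ : Type w} [Ctx A Γ] (f g h : Γ → A) [Tm f] [Tm g] [Tm h]

instance : D0 fun γ => IsEmptySet (f γ) :=
  D0.app₁ (D0.congr (Q := fun γ : NilCtx A × A => IsSet γ.2 ∧ ∀ x, x ε γ.2 → False)
    (fun _ => Iff.rfl) inferInstance) f

instance : D0 fun γ => IsPairSet (f γ) (g γ) (h γ) :=
  D0.app₃ (D0.congr (Q := fun γ : ((NilCtx A × A) × A) × A =>
      IsSet γ.1.1.2 ∧ γ.1.2 ε γ.1.1.2 ∧ γ.2 ε γ.1.1.2 ∧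
      ∀ t, t ε γ.1.1.2 → t = γ.1.2 ∨ t = γ.2) (fun γ => by
    refine and_congr_right fun _ => ⟨fun H => ⟨(H _).2 (.inl rfl), (H _).2 (.inr rfl),
      fun t => (H t).1⟩, fun ⟨h₁, h₂, h₃⟩ t => ⟨h₃ t, ?_⟩⟩
    rintro (rfl | rfl) <;> assumption) inferInstance) f g h

instance : D0 fun γ => IsOPair (f γ) (g γ) (h γ) :=
  D0.app₃ (D0.congr (Q := fun γ : ((NilCtx A × A) × A) × A => ∃ s, s ε γ.1.1.2 ∧ ∃ d, d ε γ.1.1.2 ∧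
      IsPairSet s γ.1.2 γ.1.2 ∧ IsPairSet d γ.1.2 γ.2 ∧ IsPairSet γ.1.1.2 s d) (fun γ => by
    constructor
    · rintro ⟨s, d, hs, hd, hp⟩
      exact ⟨s, (hp.2 s).2 (.inl rfl), d, (hp.2 d).2 (.inr rfl), hs, hd, hp⟩
    · rintro ⟨s, _, d, _, h⟩
      exact ⟨s, d, h⟩) inferInstance) f g h

instance : D0 fun γ => Maps (f γ) (g γ) (h γ) :=
  D0.app₃ (D0.congr
    (Q := fun γ : ((NilCtx A × A) × A) × A => ∃ p, p ε γ.1.1.2 ∧ IsOPair p γ.1.2 γ.2)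
    (fun _ => Iff.rfl) inferInstance) f g h

instance : D0 fun γ => IsCoOf (f γ) (g γ) :=
  D0.app₂ (D0.congr (Q := fun γ : (NilCtx A × A) × A =>
      ∃ d, d ε γ.1.2 ∧ ∃ o, o ε d ∧ IsEmptySet o ∧ IsOPair γ.1.2 o γ.2)
    (fun γ => by
      constructor
      · rintro ⟨o, ho, h⟩
        obtain ⟨d, hd, hod, _⟩ := h.exists_mem
        exact ⟨d, hd, o, hod, ho, h⟩
      · rintro ⟨_, _, o, _, h⟩
        exact ⟨o, h⟩) inferInstance) f g

instance : D0 fun γ => IsFunction (f γ) :=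
  D0.app₁ (D0.congr (Q := fun γ : NilCtx A × A => IsSet γ.2 ∧
      (∀ p, p ε γ.2 → ∃ d, d ε p ∧ ∃ x, x ε d ∧ ∃ y, y ε d ∧ IsOPair p x y) ∧
      ∀ p, p ε γ.2 → ∀ d, d ε p → ∀ x, x ε d → ∀ y, y ε d → ∀ p', p' ε γ.2 →
        ∀ d', d' ε p' → ∀ y', y' ε d' → IsOPair p x y → IsOPair p' x y' → y = y') (fun γ => by
    refine and_congr_right fun _ => and_congr ?_ ?_
    · refine forall₂_congr fun p _ => ⟨fun ⟨x, y, h⟩ => ?_, fun ⟨_, _, x, _, y, _, h⟩ => ⟨x, y, h⟩⟩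
      obtain ⟨d, hd, hx, hy⟩ := h.exists_mem
      exact ⟨d, hd, x, hx, y, hy, h⟩
    · constructor
      · intro H p hp _ _ x _ y _ p' hp' _ _ y' _ h h'
        exact H x y y' ⟨p, hp, h⟩ ⟨p', hp', h'⟩
      · rintro H x y y' ⟨p, hp, h⟩ ⟨p', hp', h'⟩
        obtain ⟨d, hd, hx, hy⟩ := h.exists_mem
        obtain ⟨d', hd', _, hy'⟩ := h'.exists_mem
        exact H p hp d hd x hx y hy p' hp' d' hd' y' hy' h h') inferInstance) f

instance : D0 fun γ => HasDomain (f γ) (g γ) :=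
  D0.app₂ (D0.congr (Q := fun γ : (NilCtx A × A) × A =>
      (∀ x, x ε γ.2 → ∃ p, p ε γ.1.2 ∧ ∃ d, d ε p ∧ ∃ y, y ε d ∧ IsOPair p x y) ∧
      ∀ p, p ε γ.1.2 → ∀ d, d ε p → ∀ x, x ε d → ∀ y, y ε d → IsOPair p x y → x ε γ.2) (fun γ => by
    constructor
    · refine fun H => ⟨fun x hx => ?_, fun p hp _ _ x _ y _ h => (H x).2 ⟨y, p, hp, h⟩⟩
      obtain ⟨y, p, hp, h⟩ := (H x).1 hx
      obtain ⟨d, hd, _, hy⟩ := h.exists_mem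
      exact ⟨p, hp, d, hd, y, hy, h⟩
    · refine fun ⟨H, H'⟩ x => ⟨fun hx => ?_, fun ⟨y, p, hp, h⟩ => ?_⟩
      · obtain ⟨p, hp, _, _, y, _, h⟩ := H x hx
        exact ⟨y, p, hp, h⟩
      · obtain ⟨d, hd, hx, hy⟩ := h.exists_mem
        exact H' p hp d hd x hx y hy h) inferInstance) f g

instance : D0 fun γ => IsOrd (f γ) :=
  D0.app₁ (D0.congr (Q := fun γ : NilCtx A × A => IsSet γ.2 ∧ (∀ y, y ε γ.2 → ∀ t, t ε y → t ε γ.2) ∧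
    ∀ y, y ε γ.2 → IsSet y ∧ ∀ t, t ε y → ∀ r, r ε t → r ε y) (fun _ => Iff.rfl) inferInstance) f

instance : D0 fun γ => IsLimitOrd (f γ) :=
  D0.app₁ (D0.congr (Q := fun γ : NilCtx A × A => IsOrd γ.2 ∧ (∃ b, b ε γ.2 ∧ True) ∧
    ∀ b, b ε γ.2 → ∃ c, c ε γ.2 ∧ b ε c) (fun γ => by simp [IsLimitOrd]) inferInstance) f

end Bounded

variable [KPU A]

theorem exists_empty : ∃ o : A, IsEmptySet o := by
  obtain ⟨a, _⟩ := KPU.exists_set (A := A)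
  obtain ⟨b, hb, h⟩ := KPU.separation (fun _ : A => False) a
  exact ⟨b, hb, fun x hx => ((h x).1 hx).2⟩

theorem exists_pairSet (x y : A) : ∃ a, IsPairSet a x y := by
  obtain ⟨a, _, hx, hy⟩ := KPU.pair x y
  obtain ⟨b, hb, h⟩ := KPU.separation (fun t => t = x ∨ t = y) a
  refine ⟨b, hb, fun t => (h t).trans ⟨fun h => h.2, fun h => ⟨?_, h⟩⟩⟩
  rcases h with rfl | rfl <;> assumption

theorem exists_isOPair (x y : A) : ∃ p, IsOPair p x y := by
  obtain ⟨s, hs⟩ := exists_pairSet x x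
  obtain ⟨d, hd⟩ := exists_pairSet x y
  obtain ⟨p, hp⟩ := exists_pairSet s d
  exact ⟨p, s, d, hs, hd, hp⟩

theorem exists_isCoOf (x : A) : ∃ p, IsCoOf p x := by
  obtain ⟨o, ho⟩ := exists_empty (A := A)
  obtain ⟨p, hp⟩ := exists_isOPair o x
  exact ⟨p, o, ho, hp⟩

theorem exists_sUnion (a : A) : ∃ b, IsSet b ∧ ∀ x, x ε b ↔ ∃ y, y ε a ∧ x ε y := by
  obtain ⟨b, _, hb⟩ := KPU.union a
  obtain ⟨c, hc, h⟩ := KPU.separation (fun x => ∃ y, y ε a ∧ x ε y) b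
  exact ⟨c, hc, fun x => (h x).trans ⟨fun h => h.2, fun h => ⟨by grind, h⟩⟩⟩

theorem exists_insert (a x : A) : ∃ b, IsSet b ∧ ∀ t, t ε b ↔ t ε a ∨ t = x := by
  obtain ⟨s, hs⟩ := exists_pairSet x x
  obtain ⟨p, hp⟩ := exists_pairSet a s
  obtain ⟨b, hb, h⟩ := exists_sUnion p
  refine ⟨b, hb, fun t => (h t).trans ?_⟩
  simp [hp.2, hs.2]

/-- Every finite subset of `A` is an element of `A`. -/
theorem exists_finite {s : Set A} (hs : s.Finite) : ∃ a, IsSet a ∧ ∀ t, t ε a ↔ t ∈ s := by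
  induction s, hs using Set.Finite.induction_on with
  | empty =>
    obtain ⟨o, ho, h⟩ := exists_empty (A := A)
    exact ⟨o, ho, fun t => iff_of_false (h t) (Set.notMem_empty t)⟩
  | @insert x s _ _ ih =>
    obtain ⟨a, ha, h⟩ := ih
    obtain ⟨b, hb, h'⟩ := exists_insert a x
    exact ⟨b, hb, fun t => by rw [h', h, Set.mem_insert_iff, or_comm]⟩

theorem exists_isOne : ∃ a : A, IsOne a := by
  obtain ⟨o, ho⟩ := exists_empty (A := A)
  obtain ⟨a, ha⟩ := exists_pairSet o o
  refine ⟨a, ha.1, fun x => (ha.2 x).trans ⟨?_, fun h => .inl (h.unique ho)⟩⟩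
  rintro (rfl | rfl) <;> exact ho

instance {Γ : Type w} [Ctx A Γ] (f : Γ → A) [Tm f] : D0 fun γ => IsOne (f γ) :=
  D0.app₁ (D0.congr (Q := fun γ : NilCtx A × A =>
      (∀ x, x ε γ.2 → IsEmptySet x) ∧ ∃ x, x ε γ.2 ∧ IsEmptySet x)
    (fun γ => by
      constructor
      · rintro ⟨_, h⟩
        obtain ⟨o, ho⟩ := exists_empty (A := A)
        exact ⟨fun x => (h x).1, o, (h o).2 ho, ho⟩
      · rintro ⟨h, x, hx, hx'⟩
        exact ⟨isSet_of_mem hx, fun y => ⟨h y, fun hy => by rwa [hy.unique hx']⟩⟩) inferInstance) f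

/-- The image of a set under a `Σ`-definable function is a set (`Σ`-replacement). -/
theorem exists_image (Q : A → A → Prop) [hQ : Sg fun p : (NilCtx A × A) × A => Q p.1.2 p.2] (d : A)
    (hex : ∀ x, x ε d → ∃ y, Q x y) (huniq : ∀ x y y', x ε d → Q x y → Q x y' → y = y') :
    ∃ c, IsSet c ∧ ∀ y, y ε c ↔ ∃ x, x ε d ∧ Q x y := by
  obtain ⟨Q₀, hQ₀, h⟩ := hQ
  have hQ' : ∀ x y, Q x y ↔ ∃ w, Q₀ (((.nil, x), y), w) := fun x y => h ((.nil, x), y)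
  have := hQ₀.comp (Δ := (((NilCtx A × A) × A) × A) × A)
    ((((Subst.const NilCtx.nil).pair fun p => p.1.1.1.2).pair fun p => p.1.2).pair fun p => p.2)
  have := hQ₀.comp (Δ := ((NilCtx A × A) × A) × A)
    ((((Subst.const NilCtx.nil).pair fun p => p.1.2).pair fun p => p.1.1.2).pair fun p => p.2)
  obtain ⟨b, _, hb⟩ := KPU.collection
    (fun x v => ∃ y, y ε v ∧ ∃ w, w ε v ∧ Q₀ (((.nil, x), y), w)) d (fun x hx => by
      obtain ⟨y, hy⟩ := hex x hx
      obtain ⟨w, hw⟩ := (hQ' x y).1 hy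
      obtain ⟨v, _, hyv, hwv⟩ := KPU.pair y w
      exact ⟨v, y, hyv, w, hwv, hw⟩)
  obtain ⟨e, _, he⟩ := KPU.union b
  obtain ⟨c, hc, hce⟩ := KPU.separation
    (fun y => ∃ x, x ε d ∧ ∃ w, w ε e ∧ Q₀ (((.nil, x), y), w)) e
  refine ⟨c, hc, fun y => (hce y).trans ⟨?_, ?_⟩⟩
  · rintro ⟨_, x, hx, w, _, hw⟩
    exact ⟨x, hx, (hQ' x y).2 ⟨w, hw⟩⟩
  · rintro ⟨x, hx, hxy⟩
    obtain ⟨v, hv, y', hy', w, hw, hq⟩ := hb x hx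
    obtain rfl := huniq x y y' hx hxy ((hQ' x y').2 ⟨w, hq⟩)
    exact ⟨he v hv y hy', x, hx, w, he v hv w hw, hq⟩

/-- `f` is a function with domain `d` whose values are given by the relation `Q`, which need not be
functional. -/
def IsMapOn (d : A) (Q : A → A → Prop) (f : A) : Prop :=
  IsFunction f ∧ HasDomain f d ∧ ∀ x, x ε d → ∃ y, Q x y ∧ Maps f x y

instance {Γ : Type w} [Ctx A Γ] (d f : Γ → A) (Q : Γ → A → A → Prop) [hd : Tm d] [hf : Tm f]
    [Sg fun p : (Γ × A) × A => Q p.1.1 p.1.2 p.2] :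
    Sg fun γ => IsMapOn (d γ) (Q γ) (f γ) := by
  have := hd.weaken
  have := hf.weaken.weaken
  unfold IsMapOn
  infer_instance

omit [KPU A] in
theorem IsMapOn.maps_iff {d f : A} {Q : A → A → Prop} (h : IsMapOn d Q f)
    (huniq : ∀ x y y', x ε d → Q x y → Q x y' → y = y') {x y : A} :
    Maps f x y ↔ x ε d ∧ Q x y := by
  constructor
  · intro hxy
    have hx := (h.2.1 x).2 ⟨y, hxy⟩
    obtain ⟨y', hq, hy'⟩ := h.2.2 x hx
    exact ⟨hx, by rwa [h.1.2.2 x y y' hxy hy']⟩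
  · rintro ⟨hx, hq⟩
    obtain ⟨y', hq', hy'⟩ := h.2.2 x hx
    rwa [huniq x y y' hx hq hq']

omit [KPU A] in
theorem IsMapOn.value {d f : A} {Q : A → A → Prop} (h : IsMapOn d Q f) {x y : A}
    (hxy : Maps f x y) : x ε d ∧ Q x y := by
  have hx := (h.2.1 x).2 ⟨y, hxy⟩
  obtain ⟨y', hq, hy'⟩ := h.2.2 x hx
  exact ⟨hx, by rwa [h.1.2.2 x y y' hxy hy']⟩

omit [KPU A] in
theorem IsMapOn.unique {d f g : A} {Q : A → A → Prop} (hf : IsMapOn d Q f) (hg : IsMapOn d Q g)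
    (huniq : ∀ x y y', x ε d → Q x y → Q x y' → y = y') : f = g :=
  hf.1.eq hg.1 hf.2.1 hg.2.1 fun _ _ _ h => (hg.maps_iff huniq).2 (hf.value h)

theorem exists_isMapOn (Q : A → A → Prop) [Sg fun p : (NilCtx A × A) × A => Q p.1.2 p.2] (d : A)
    (hex : ∀ x, x ε d → ∃ y, Q x y) (huniq : ∀ x y y', x ε d → Q x y → Q x y' → y = y') :
    ∃ f, IsMapOn d Q f := by
  have := Sg.app₂ (Γ := ((NilCtx A × A) × A) × A) ‹Sg fun p : (NilCtx A × A) × A => Q p.1.2 p.2›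
    (fun p => p.1.1.2) fun p => p.2
  obtain ⟨f, hf, h⟩ := exists_image (fun x p => ∃ y, Q x y ∧ IsOPair p x y) d
    (fun x hx => by
      obtain ⟨y, hy⟩ := hex x hx
      obtain ⟨p, hp⟩ := exists_isOPair x y
      exact ⟨p, y, hy, hp⟩)
    (by
      rintro x p p' hx ⟨y, hy, hp⟩ ⟨y', hy', hp'⟩
      obtain rfl := huniq x y y' hx hy hy'
      exact hp.unique hp')
  have hm : ∀ x y, Maps f x y ↔ x ε d ∧ Q x y := by
    intro x y
    constructor
    · rintro ⟨p, hp, hxy⟩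
      obtain ⟨x', hx', y', hy', hp'⟩ := (h p).1 hp
      obtain ⟨rfl, rfl⟩ := hxy.inj hp'
      exact ⟨hx', hy'⟩
    · rintro ⟨hx, hy⟩
      obtain ⟨p, hp⟩ := exists_isOPair x y
      exact ⟨p, (h p).2 ⟨x, hx, y, hy, hp⟩, hp⟩
  refine ⟨f, ⟨hf, fun p hp => ?_, fun x y y' hy hy' => ?_⟩, fun x => ?_, fun x hx => ?_⟩
  · obtain ⟨x, _, y, _, hxy⟩ := (h p).1 hp
    exact ⟨x, y, hxy⟩
  · exact huniq x y y' ((hm x y).1 hy).1 ((hm x y).1 hy).2 ((hm x y').1 hy').2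
  · refine ⟨fun hx => ?_, fun ⟨y, hy⟩ => ((hm x y).1 hy).1⟩
    obtain ⟨y, hy⟩ := hex x hx
    exact ⟨y, (hm x y).2 ⟨hx, hy⟩⟩
  · obtain ⟨y, hy⟩ := hex x hx
    exact ⟨y, hy, (hm x y).2 ⟨hx, hy⟩⟩

end Sets

/-! ### Ordinals -/

section Ordinals

variable {A : Type w} [TransitiveUniverse A]

theorem IsOrd.of_mem {a b : A} (ha : IsOrd a) (hb : b ε a) : IsOrd b :=
  ⟨(ha.2.2 b hb).1, fun y hy t ht => (ha.2.2 b hb).2 y hy t ht,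
    fun y hy => ha.2.2 y (ha.2.1 b hb y hy)⟩

theorem ordOf_lt_of_mem {a b : A} (h : b ε a) : ordOf b < ordOf a :=
  IsWellFounded.rank_lt_of_rel (r := fun x y : A => x ε y) h

theorem lt_ordOf_iff {a : A} {o : Ordinal.{w}} : o < ordOf a ↔ ∃ b, b ε a ∧ o ≤ ordOf b := by
  rw [ordOf, IsWellFounded.rank_eq, Ordinal.lt_iSup_iff]
  simp [ordOf]

/-- The ranks of the elements of an ordinal form an initial segment. -/
theorem IsOrd.exists_ordOf_eq {a : A} (ha : IsOrd a) {o : Ordinal.{w}} (ho : o < ordOf a) :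
    ∃ b, b ε a ∧ ordOf b = o := by
  induction a using (TransitiveUniverse.wf (A := A)).induction with
  | _ a ih =>
    obtain ⟨b, hb, hob⟩ := lt_ordOf_iff.1 ho
    rcases hob.eq_or_lt with rfl | hlt
    · exact ⟨b, hb, rfl⟩
    · obtain ⟨c, hc, h⟩ := ih b hb (ha.of_mem hb) hlt
      exact ⟨c, ha.2.1 b hb c hc, h⟩

theorem IsOrd.eq_of_ordOf_eq {a b : A} (ha : IsOrd a) (hb : IsOrd b) (h : ordOf a = ordOf b) :
    a = b := by
  induction a using (TransitiveUniverse.wf (A := A)).induction generalizing b with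
  | _ a ih =>
    refine ha.1.ext hb.1 fun x => ⟨fun hx => ?_, fun hx => ?_⟩
    · obtain ⟨y, hy, hxy⟩ := hb.exists_ordOf_eq (h ▸ ordOf_lt_of_mem hx)
      rwa [ih x hx (ha.of_mem hx) (hb.of_mem hy) hxy.symm]
    · obtain ⟨y, hy, hxy⟩ := ha.exists_ordOf_eq (h ▸ ordOf_lt_of_mem hx)
      rwa [← ih y hy (ha.of_mem hy) (hb.of_mem hx) hxy]

theorem IsOrd.mem_iff {a b : A} (ha : IsOrd a) (hb : IsOrd b) : b ε a ↔ ordOf b < ordOf a := by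
  refine ⟨ordOf_lt_of_mem, fun h => ?_⟩
  obtain ⟨c, hc, hcb⟩ := ha.exists_ordOf_eq h
  rwa [hb.eq_of_ordOf_eq (ha.of_mem hc) hcb.symm]

theorem IsEmptySet.isOrd {a : A} (h : IsEmptySet a) : IsOrd a :=
  ⟨h.1, fun y hy => (h.2 y hy).elim, fun y hy => (h.2 y hy).elim⟩

theorem IsOrd.isEmptySet_iff {a : A} (ha : IsOrd a) : IsEmptySet a ↔ ordOf a = 0 := by
  refine ⟨fun h => ?_, fun h => ⟨ha.1, fun x hx => ?_⟩⟩
  · by_contra h0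
    obtain ⟨b, hb, _⟩ := ha.exists_ordOf_eq (pos_iff_ne_zero.2 h0)
    exact h.2 b hb
  · have := ordOf_lt_of_mem hx
    rw [h] at this
    exact not_lt_zero this

theorem IsOrd.succ {a s : A} (ha : IsOrd a) (hs : IsSet s) (h : ∀ t, t ε s ↔ t ε a ∨ t = a) :
    IsOrd s := by
  refine ⟨hs, fun y hy t ht => ?_, fun y hy => ?_⟩
  · rcases (h y).1 hy with hy | rfl
    · exact (h t).2 (.inl (ha.2.1 y hy t ht))
    · exact (h t).2 (.inl ht)
  · rcases (h y).1 hy with hy | rfl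
    · exact ha.2.2 y hy
    · exact ⟨ha.1, ha.2.1⟩

theorem ordOf_succ {a s : A} (h : ∀ t, t ε s ↔ t ε a ∨ t = a) :
    ordOf s = Order.succ (ordOf a) := by
  refine eq_of_forall_lt_iff fun o => ?_
  rw [lt_ordOf_iff, Order.lt_succ_iff]
  constructor
  · rintro ⟨b, hb, hob⟩
    rcases (h b).1 hb with hb | rfl
    · exact hob.trans (ordOf_lt_of_mem hb).le
    · exact hob
  · exact fun ho => ⟨a, (h a).2 (.inr rfl), ho⟩

theorem IsOrd.isSuccOrd_iff {a : A} (ha : IsOrd a) :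
    IsSuccOrd a ↔ ∃ o, ordOf a = Order.succ o := by
  constructor
  · rintro ⟨_, b, _, h⟩
    exact ⟨_, ordOf_succ h⟩
  · rintro ⟨o, ho⟩
    obtain ⟨b, hb, rfl⟩ := ha.exists_ordOf_eq (ho ▸ Order.lt_succ o)
    refine ⟨ha, b, hb, fun c => ⟨fun hc => ?_, ?_⟩⟩
    · have h := ordOf_lt_of_mem hc
      rw [ho, Order.lt_succ_iff] at h
      rcases h.lt_or_eq with h | h
      · exact .inl (((ha.of_mem hb).mem_iff (ha.of_mem hc)).2 h)
      · exact .inr ((ha.of_mem hc).eq_of_ordOf_eq (ha.of_mem hb) h)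
    · rintro (hc | rfl)
      · exact ha.2.1 b hb c hc
      · exact hb

theorem IsOrd.isLimitOrd_iff {a : A} (ha : IsOrd a) :
    IsLimitOrd a ↔ Order.IsSuccLimit (ordOf a) := by
  rw [Ordinal.isSuccLimit_iff]
  constructor
  · rintro ⟨_, ⟨b, hb⟩, h⟩
    refine ⟨fun h0 => ((ha.isEmptySet_iff).2 h0).2 b hb, fun o ho => ?_⟩
    replace ho := ho.succ_eq
    obtain ⟨c, hc, rfl⟩ := ha.exists_ordOf_eq (ho ▸ Order.lt_succ o)
    obtain ⟨d, hd, hcd⟩ := h c hc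
    have := ordOf_lt_of_mem hd
    rw [← ho, Order.lt_succ_iff] at this
    exact this.not_gt (ordOf_lt_of_mem hcd)
  · rintro ⟨h0, hl⟩
    refine ⟨ha, ?_, fun b hb => ?_⟩
    · obtain ⟨b, hb, _⟩ := ha.exists_ordOf_eq (pos_iff_ne_zero.2 h0)
      exact ⟨b, hb⟩
    · obtain ⟨c, hc, h⟩ := ha.exists_ordOf_eq (hl.succ_lt (ordOf_lt_of_mem hb))
      exact ⟨c, hc, ((ha.of_mem hc).mem_iff (ha.of_mem hb)).2 (h ▸ Order.lt_succ _)⟩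

variable [KPU A]

theorem IsOrd.isOne_iff {a : A} (ha : IsOrd a) : IsOne a ↔ ordOf a = 1 := by
  obtain ⟨o, ho⟩ := exists_empty (A := A)
  constructor
  · rintro ⟨_, h⟩
    rw [ordOf_succ (a := o) fun t => ?_, ho.isOrd.isEmptySet_iff.1 ho, Order.succ_eq_add_one,
      zero_add]
    exact (h t).trans ⟨fun h => .inr (h.unique ho), by rintro (h | rfl); exacts [(ho.2 _ h).elim, ho]⟩
  · refine fun h => ⟨ha.1, fun x => ⟨fun hx => ?_, fun hx => ?_⟩⟩
    · refine (ha.of_mem hx).isEmptySet_iff.2 ?_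
      have := ordOf_lt_of_mem hx
      rwa [h, Order.lt_one_iff] at this
    · refine (ha.mem_iff hx.isOrd).2 ?_
      rw [hx.isOrd.isEmptySet_iff.1 hx, h]
      exact zero_lt_one

theorem exists_succ (a : A) : ∃ s, IsSet s ∧ ∀ t, t ε s ↔ t ε a ∨ t = a := exists_insert a a

theorem IsOne.isOrd {a : A} (h : IsOne a) : IsOrd a := by
  obtain ⟨o, ho⟩ := exists_empty (A := A)
  exact ho.isOrd.succ h.1 fun t => (h.2 t).trans
    ⟨fun h => .inr (h.unique ho), by rintro (h | rfl); exacts [(ho.2 _ h).elim, ho]⟩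

end Ordinals

/-! ### The levels of the codes -/

section Level

theorem codeLevel_zero : codeLevel 0 = 0 := by simp [codeLevel]

theorem codeLevel_one : codeLevel (1 : Ordinal.{w}) = 2 := by
  have h := Ordinal.one_lt_omega0.{w}
  simp [codeLevel, Ordinal.div_eq_zero_of_lt h, Ordinal.mod_eq_of_lt h]

theorem codeLevel_succ (o : Ordinal.{w}) :
    codeLevel (Order.succ o) = Order.succ (Order.succ (codeLevel o)) := by
  have hlt := Ordinal.mod_lt o Ordinal.omega0_ne_zero
  have hlt' := Ordinal.isSuccLimit_omega0.succ_lt hlt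
  have h : Order.succ o = Ordinal.omega0 * (o / Ordinal.omega0) + Order.succ (o % Ordinal.omega0) := by
    conv_lhs => rw [← Ordinal.div_add_mod o Ordinal.omega0]
    rw [Order.succ_eq_add_one, Order.succ_eq_add_one, add_assoc]
  have hd : Order.succ o / Ordinal.omega0 = o / Ordinal.omega0 := by
    rw [h, Ordinal.mul_add_div _ Ordinal.omega0_ne_zero, Ordinal.div_eq_zero_of_lt hlt', add_zero]
  have hm : Order.succ o % Ordinal.omega0 = Order.succ (o % Ordinal.omega0) := by
    rw [h, Ordinal.mul_add_mod_self, Ordinal.mod_eq_of_lt hlt']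
  rw [codeLevel, hd, hm, codeLevel]
  simp only [Order.succ_eq_add_one]
  rw [mul_add, mul_one, add_assoc, add_assoc, one_add_one_eq_two]

theorem codeLevel_limit {o : Ordinal.{w}} (h : Order.IsSuccLimit o) : codeLevel o = o := by
  obtain ⟨c, rfl⟩ := Ordinal.isSuccPrelimit_iff_omega0_dvd.1 h.isSuccPrelimit
  rw [codeLevel, Ordinal.mul_mod, mul_zero, add_zero, Ordinal.mul_div_cancel _ Ordinal.omega0_ne_zero]

theorem exists_codeLevel_eq (o : Ordinal.{w}) :
    ∃ (l : Ordinal.{w}) (n : ℕ), l ≤ o ∧ codeLevel o = l + n ∧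
      ∀ b, Order.IsSuccLimit b → o < b → l + n < b := by
  obtain ⟨n, hn⟩ := Ordinal.lt_omega0.1 (Ordinal.mod_lt o Ordinal.omega0_ne_zero)
  have hl : Ordinal.omega0 * (o / Ordinal.omega0) ≤ o := Ordinal.mul_div_le o _
  refine ⟨Ordinal.omega0 * (o / Ordinal.omega0), 2 * n, hl, ?_, ?_⟩
  · rw [codeLevel, hn]; norm_cast
  · intro b hb hob
    exact hb.add_natCast_lt (hl.trans_lt hob) _

theorem codeLevel_lt_limit {o b : Ordinal.{w}} (hb : Order.IsSuccLimit b) (h : o < b) :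
    codeLevel o < b := by
  obtain ⟨l, n, _, hl, hlt⟩ := exists_codeLevel_eq o
  rw [hl]
  exact hlt b hb h

variable {A : Type w} [TransitiveUniverse A] [KPU A]

theorem IsOrd.exists_add_nat {a : A} (ha : IsOrd a) (n : ℕ) :
    ∃ b : A, IsOrd b ∧ ordOf b = ordOf a + n := by
  induction n with
  | zero => exact ⟨a, ha, by simp⟩
  | succ n ih =>
    obtain ⟨b, hb, h⟩ := ih
    obtain ⟨s, hs, hsb⟩ := exists_succ b
    refine ⟨s, hb.succ hs hsb, ?_⟩
    rw [ordOf_succ hsb, h, Order.succ_eq_add_one, add_assoc]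
    norm_cast

theorem IsOrd.exists_codeLevel {a : A} (ha : IsOrd a) :
    ∃ b : A, IsOrd b ∧ ordOf b = codeLevel (ordOf a) := by
  obtain ⟨l, n, hl, h, _⟩ := exists_codeLevel_eq (ordOf a)
  obtain ⟨c, hc, hcl⟩ : ∃ c : A, IsOrd c ∧ ordOf c = l := by
    rcases hl.eq_or_lt with rfl | hl
    · exact ⟨a, ha, rfl⟩
    · obtain ⟨c, hc, h⟩ := ha.exists_ordOf_eq hl
      exact ⟨c, ha.of_mem hc, h⟩
  obtain ⟨b, hb, hbc⟩ := hc.exists_add_nat n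
  exact ⟨b, hb, by rw [hbc, hcl, h]⟩

end Level

/-! ### Recursion on the ordinals -/

section Recursion

variable {A : Type w} [TransitiveUniverse A]

/-- `f` is the function on the ordinal `a` obtained by recursion along the relation `H`, where
`H b r y` says that `y` is the value at `b` when `r` is the restriction of the function to `b`. -/
def IsApprox (H : A → A → A → Prop) (a f : A) : Prop :=
  IsMapOn a (fun b y => ∃ r, IsMapOn b (fun c z => Maps f c z) r ∧ H b r y) f

theorem IsApprox.restrict {H : A → A → A → Prop} {a f b r : A} (ha : IsOrd a) (h : IsApprox H a f)
    (hb : b ε a) (hr : IsMapOn b (fun c z => Maps f c z) r) : IsApprox H b r := by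
  refine ⟨hr.1, hr.2.1, fun c hc => ?_⟩
  obtain ⟨y, ⟨s, hs, hy⟩, hcy⟩ := h.2.2 c (ha.2.1 b hb c hc)
  have hrf : ∀ e, e ε b → ∀ z, Maps f e z → Maps r e z := by
    intro e he z hz
    obtain ⟨z', hz', hz''⟩ := hr.2.2 e he
    rwa [h.1.2.2 e z z' hz hz']
  refine ⟨y, ⟨s, ⟨hs.1, hs.2.1, fun e he => ?_⟩, hy⟩, hrf c hc y hcy⟩
  obtain ⟨z, hz, hz'⟩ := hs.2.2 e he
  exact ⟨z, hrf e ((ha.of_mem hb).2.1 c hc e he) z hz, hz'⟩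

variable [KPU A]

/-- Definition by `Σ`-recursion on the ordinals: if `H` is a `Σ`-definable partial function, and
`H` is defined as long as the values obtained so far satisfy `I`, with a value which
again satisfies `I`, then the recursion along `H` defines a `Σ`-definable function on all ordinals,
and its values satisfy `I`. The invariant `I` need not be definable. -/
theorem exists_recursion (H : A → A → A → Prop)
    [hH : Sg fun p : ((NilCtx A × A) × A) × A => H p.1.1.2 p.1.2 p.2]
    (huniq : ∀ a r y y', IsOrd a → H a r y → H a r y' → y = y') (I : A → A → Prop)
    (hex : ∀ a r, IsOrd a → IsFunction r → HasDomain r a → (∀ b y, Maps r b y → I b y) →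
      ∃ y, H a r y ∧ I a y) :
    ∃ F : A → A → Prop, (Sg fun p : (NilCtx A × A) × A => F p.1.2 p.2) ∧
      (∀ a y y', IsOrd a → F a y → F a y' → y = y') ∧ ∀ a, IsOrd a → ∃ y, F a y ∧ I a y := by
  have hH' : ∀ {Γ : Type w} [Ctx A Γ] (f g k : Γ → A) [Tm f] [Tm g] [Tm k],
      Sg fun γ => H (f γ) (g γ) (k γ) := fun f g k => Sg.app₃ hH f g k
  let F : A → A → Prop := fun a y => ∃ f, IsApprox H a f ∧ H a f y
  have hF : Sg fun p : (NilCtx A × A) × A => F p.1.2 p.2 := by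
    simp only [F, IsApprox]
    infer_instance
  have key : ∀ a, IsOrd a → ∃ f y, IsApprox H a f ∧ (∀ f', IsApprox H a f' → f' = f) ∧
      H a f y ∧ I a y := by
    intro a
    induction a using (TransitiveUniverse.wf (A := A)).induction with
    | _ a ih =>
      intro ha
      have hFu : ∀ b y y', b ε a → F b y → F b y' → y = y' := by
        rintro b y y' hb ⟨f, hf, hy⟩ ⟨f', hf', hy'⟩
        obtain ⟨g, _, _, hg, _⟩ := ih b hb (ha.of_mem hb)
        obtain rfl := hg f hf
        obtain rfl := hg f' hf'
        exact huniq b _ y y' (ha.of_mem hb) hy hy'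
      obtain ⟨f, hf⟩ := exists_isMapOn F a (fun b hb => by
        obtain ⟨g, y, hg, _, hy, _⟩ := ih b hb (ha.of_mem hb)
        exact ⟨y, g, hg, hy⟩) hFu
      have hmf : ∀ b y, Maps f b y ↔ b ε a ∧ F b y := fun b y => hf.maps_iff hFu
      have hap : ∀ g, IsApprox H a g → ∀ b y, b ε a → Maps g b y → F b y := by
        intro g hg b y hb hy
        obtain ⟨_, r, hr, hy'⟩ := hg.value hy
        exact ⟨r, hg.restrict ha hb hr, hy'⟩
      have happ : IsApprox H a f := by
        refine ⟨hf.1, hf.2.1, fun b hb => ?_⟩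
        obtain ⟨g, y, hg, _, hy, _⟩ := ih b hb (ha.of_mem hb)
        refine ⟨y, ⟨g, ⟨hg.1, hg.2.1, fun c hc => ?_⟩, hy⟩, (hmf b y).2 ⟨hb, g, hg, hy⟩⟩
        obtain ⟨z, ⟨r, hr, hz⟩, hcz⟩ := hg.2.2 c hc
        exact ⟨z, (hmf c z).2 ⟨ha.2.1 b hb c hc, r, hg.restrict (ha.of_mem hb) hc hr, hz⟩, hcz⟩
      obtain ⟨y, hy, hI⟩ := hex a f ha hf.1 hf.2.1 (fun b y hby => by
        obtain ⟨hb, hFy⟩ := (hmf b y).1 hby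
        obtain ⟨g, y', hg, _, hy', hI⟩ := ih b hb (ha.of_mem hb)
        rwa [hFu b y y' hb hFy ⟨g, hg, hy'⟩])
      refine ⟨f, y, happ, fun g hg => ?_, hy, hI⟩
      exact hg.1.eq hf.1 hg.2.1 hf.2.1 fun b y hb hby => (hmf b y).2 ⟨hb, hap g hg b y hb hby⟩
  refine ⟨F, hF, ?_, fun a ha => ?_⟩
  · rintro a y y' ha ⟨f, hf, hy⟩ ⟨f', hf', hy'⟩
    obtain ⟨g, _, _, hg, _⟩ := key a ha
    obtain rfl := hg f hf
    obtain rfl := hg f' hf'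
    exact huniq a _ y y' ha hy hy'
  · obtain ⟨f, y, hf, _, hy, hI⟩ := key a ha
    exact ⟨y, ⟨f, hf, hy⟩, hI⟩

end Recursion

/-! ### Recursion on the copy of `ω`, and an enumeration of the finite relations -/

section Omega

variable {A : Type w} [TransitiveUniverse A] (W : OmegaCopy A)

theorem OmegaCopy.num_mem (n : ℕ) : W.num n ε W.carrier := (W.mem_carrier _).2 ⟨n, rfl⟩

theorem OmegaCopy.ball {P : A → Prop} : (∀ a, a ε W.carrier → P a) ↔ ∀ n, P (W.num n) := by
  simp only [W.mem_carrier]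
  exact ⟨fun h n => h _ ⟨n, rfl⟩, by rintro h a ⟨n, rfl⟩; exact h n⟩

theorem OmegaCopy.bex {P : A → Prop} : (∃ a, a ε W.carrier ∧ P a) ↔ ∃ n, P (W.num n) := by
  simp only [W.mem_carrier]
  exact ⟨by rintro ⟨a, ⟨n, rfl⟩, h⟩; exact ⟨n, h⟩, fun ⟨n, h⟩ => ⟨_, ⟨n, rfl⟩, h⟩⟩

variable [KPU A]

theorem OmegaCopy.maps_order {m n : ℕ} : Maps W.order (W.num m) (W.num n) ↔ m < n := by
  constructor
  · rintro ⟨p, hp, h⟩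
    obtain ⟨i, j, hij, hp'⟩ := (W.mem_order p).1 hp
    obtain ⟨h₁, h₂⟩ := h.inj hp'
    rwa [W.num_injective h₁, W.num_injective h₂]
  · intro h
    obtain ⟨p, hp⟩ := exists_isOPair (W.num m) (W.num n)
    exact ⟨p, (W.mem_order p).2 ⟨m, n, h, hp⟩, hp⟩

variable {W} in
theorem CodesFinBij.maps_iff {σ : Finset (ℕ × ℕ)} {s : A} (h : CodesFinBij W σ s) {x y : A} :
    Maps s x y ↔ ∃ i j, (i, j) ∈ σ ∧ x = W.num i ∧ y = W.num j := by
  constructor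
  · rintro ⟨p, hp, hxy⟩
    obtain ⟨⟨i, j⟩, hij, hp'⟩ := (h.2 p).1 hp
    obtain ⟨rfl, rfl⟩ := hxy.inj hp'
    exact ⟨i, j, hij, rfl, rfl⟩
  · rintro ⟨i, j, hij, rfl, rfl⟩
    obtain ⟨p, hp⟩ := exists_isOPair (W.num i) (W.num j)
    exact ⟨p, (h.2 p).2 ⟨_, hij, hp⟩, hp⟩

variable {W} in
theorem CodesFinBij.maps_num {σ : Finset (ℕ × ℕ)} {s : A} (h : CodesFinBij W σ s) {i j : ℕ} :
    Maps s (W.num i) (W.num j) ↔ (i, j) ∈ σ := by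
  rw [h.maps_iff]
  constructor
  · rintro ⟨i', j', h, hi, hj⟩
    rwa [W.num_injective hi, W.num_injective hj]
  · exact fun h => ⟨i, j, h, rfl, rfl⟩

variable {W} in
theorem CodesFinBij.subset_iff {σ τ : Finset (ℕ × ℕ)} {s t : A} (hs : CodesFinBij W σ s)
    (ht : CodesFinBij W τ t) : (∀ p, p ε s → p ε t) ↔ σ ⊆ τ := by
  constructor
  · rintro h ⟨i, j⟩ hij
    obtain ⟨p, hp, hpij⟩ := hs.maps_num.2 hij
    exact ht.maps_num.1 ⟨p, h p hp, hpij⟩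
  · intro h p hp
    obtain ⟨q, hq, hpq⟩ := (hs.2 p).1 hp
    exact (ht.2 p).2 ⟨q, h hq, hpq⟩

variable {W} in
theorem CodesFinBij.inj {σ τ : Finset (ℕ × ℕ)} {s : A} (hs : CodesFinBij W σ s)
    (ht : CodesFinBij W τ s) : σ = τ := by
  ext ⟨i, j⟩
  rw [← hs.maps_num, ht.maps_num]

omit [KPU A] in
variable {W} in
theorem CodesFinBij.unique {σ : Finset (ℕ × ℕ)} {s t : A} (hs : CodesFinBij W σ s)
    (ht : CodesFinBij W σ t) : s = t :=
  hs.1.ext ht.1 fun p => (hs.2 p).trans (ht.2 p).symm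

theorem exists_codesFinBij (σ : Finset (ℕ × ℕ)) : ∃ s, CodesFinBij W σ s := by
  choose pr hpr using fun p : ℕ × ℕ => exists_isOPair (W.num p.1) (W.num p.2)
  obtain ⟨s, hs, h⟩ := exists_finite (σ.finite_toSet.image pr)
  refine ⟨s, hs, fun t => (h t).trans ⟨?_, ?_⟩⟩
  · rintro ⟨p, hp, rfl⟩
    exact ⟨p, hp, hpr p⟩
  · rintro ⟨p, hp, ht⟩
    exact ⟨p, hp, (hpr p).unique ht⟩

/-- Definition by recursion on `ω`: a sequence whose steps are given by a `Σ`-definable function is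
an element of `A`. -/
theorem OmegaCopy.exists_seq (N : A → A → Prop)
    [hN : Sg fun p : (NilCtx A × A) × A => N p.1.2 p.2]
    (huniq : ∀ s t t', N s t → N s t' → t = t') (e : ℕ → A) (he : ∀ n, N (e n) (e (n + 1))) :
    ∃ E, IsFunction E ∧ HasDomain E W.carrier ∧ ∀ n y, Maps E (W.num n) y ↔ y = e n := by
  have hN' : ∀ {Γ : Type w} [Ctx A Γ] (f g : Γ → A) [Tm f] [Tm g],
      Sg fun γ => N (f γ) (g γ) := fun f g => Sg.app₂ hN f g
  -- `y` is the value at `n` of a sequence in `A` which follows the recursion up to `n`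
  let Q : A → A → Prop := fun n y => ∃ f, IsFunction f ∧ Maps f (W.num 0) (e 0) ∧ Maps f n y ∧
    ∀ i, i ε W.carrier → ∀ j, j ε W.carrier → Maps W.order i j →
      (∀ k, k ε W.carrier → Maps W.order i k → Maps W.order k j → False) →
      ¬ Maps W.order n j → ∃ s t, Maps f i s ∧ Maps f j t ∧ N s t
  have hQS : Sg fun p : (NilCtx A × A) × A => Q p.1.2 p.2 := by
    simp only [Q]
    infer_instance
  have hQ : ∀ n y, Q (W.num n) y ↔ y = e n := by
    intro n y
    simp only [Q, W.ball, W.maps_order]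
    constructor
    · rintro ⟨f, hf, h0, hn, h⟩
      have key : ∀ m ≤ n, Maps f (W.num m) (e m) := by
        intro m
        induction m with
        | zero => exact fun _ => h0
        | succ m ih =>
          intro hm
          obtain ⟨s, t, hs, ht, hst⟩ := h m (m + 1) (by omega) (by omega) (by omega)
          obtain rfl := hf.2.2 _ _ _ hs (ih (by omega))
          rwa [huniq _ _ _ (he m) hst]
      exact hf.2.2 _ _ _ hn (key n le_rfl)
    · rintro rfl
      choose pr hpr using fun i => exists_isOPair (W.num i) (e i)
      obtain ⟨f, hf, hfm⟩ := exists_finite ((Set.finite_Iic n).image pr)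
      have hm : ∀ i ≤ n, Maps f (W.num i) (e i) := fun i hi =>
        ⟨pr i, (hfm _).2 ⟨i, hi, rfl⟩, hpr i⟩
      refine ⟨f, ⟨hf, fun p hp => ?_, ?_⟩, hm 0 (Nat.zero_le _), hm n le_rfl, ?_⟩
      · obtain ⟨i, _, rfl⟩ := (hfm p).1 hp
        exact ⟨_, _, hpr i⟩
      · rintro x y y' ⟨p, hp, hxy⟩ ⟨p', hp', hxy'⟩
        obtain ⟨i, _, rfl⟩ := (hfm p).1 hp
        obtain ⟨j, _, rfl⟩ := (hfm p').1 hp'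
        obtain ⟨rfl, rfl⟩ := hxy.inj (hpr i)
        obtain ⟨hij, rfl⟩ := hxy'.inj (hpr j)
        rw [W.num_injective hij]
      · intro i j hij hk hj
        obtain rfl : j = i + 1 := by
          by_contra hne
          exact hk (i + 1) (by omega) (by omega)
        exact ⟨_, _, hm i (by omega), hm (i + 1) (by omega), he i⟩
  obtain ⟨E, hE⟩ := exists_isMapOn Q W.carrier
    (W.ball.2 fun n => ⟨e n, (hQ n _).2 rfl⟩) fun x y y' hx => by
      obtain ⟨n, rfl⟩ := (W.mem_carrier x).1 hx
      rw [hQ, hQ]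
      rintro rfl rfl
      rfl
  refine ⟨E, hE.1, hE.2.1, fun n y => ?_⟩
  rw [hE.maps_iff fun x y y' hx => ?_, hQ, and_iff_right (W.num_mem n)]
  obtain ⟨n, rfl⟩ := (W.mem_carrier x).1 hx
  rw [hQ, hQ]
  rintro rfl rfl
  rfl

/-- Adding `1` to a binary number: the digits below the first digit `0` become `0`, and this
digit becomes `1`. -/
theorem exists_testBit_succ (n : ℕ) : ∃ m, n.testBit m = false ∧ (∀ i < m, n.testBit i = true) ∧
    ∀ i, (n + 1).testBit i = true ↔ i = m ∨ m < i ∧ n.testBit i = true := by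
  induction n using Nat.strong_induction_on with
  | _ n ih =>
    rcases Nat.even_or_odd' n with ⟨k, rfl | rfl⟩
    · refine ⟨0, by simp, by simp, fun i => ?_⟩
      rcases i with _ | i
      · simp
      · simp [Nat.testBit_succ, Nat.mul_add_div]
    · obtain ⟨m, hm, hlt, h⟩ := ih k (by omega)
      refine ⟨m + 1, ?_, fun i hi => ?_, fun i => ?_⟩
      · rw [Nat.testBit_succ, show (2 * k + 1) / 2 = k by omega, hm]
      · rcases i with _ | i
        · simp
        · rw [Nat.testBit_succ, show (2 * k + 1) / 2 = k by omega, hlt i (by omega)]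
      · rcases i with _ | i
        · simp [show 2 * k + 1 + 1 = 2 * (k + 1) by ring]
        · rw [Nat.testBit_succ, Nat.testBit_succ, show (2 * k + 1) / 2 = k by omega,
            show (2 * k + 1 + 1) / 2 = k + 1 by omega, h i]
          simp

/-- The finite set of pairs whose codes (under the pairing function) are the places of the
digits `1` in the binary expansion of `n`. -/
def bitPairs (n : ℕ) : Finset (ℕ × ℕ) :=
  ((Finset.range n).filter fun i => n.testBit i).image Nat.unpair

theorem mem_bitPairs {n : ℕ} {p : ℕ × ℕ} : p ∈ bitPairs n ↔ n.testBit (Nat.pair p.1 p.2) := by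
  simp only [bitPairs, Finset.mem_image, Finset.mem_filter, Finset.mem_range]
  constructor
  · rintro ⟨i, ⟨_, hi⟩, rfl⟩
    simpa using hi
  · intro h
    exact ⟨Nat.pair p.1 p.2, ⟨Nat.lt_two_pow_self.trans_le (Nat.ge_two_pow_of_testBit h), h⟩, by simp⟩

theorem bitPairs_surjective : Function.Surjective bitPairs := by
  intro s
  induction s using Finset.induction_on with
  | empty => exact ⟨0, by simp [bitPairs]⟩
  | insert p s _ ih =>
    obtain ⟨n, rfl⟩ := ih
    refine ⟨n ||| 2 ^ Nat.pair p.1 p.2, ?_⟩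
    ext q
    rw [Finset.mem_insert, mem_bitPairs, mem_bitPairs, Nat.testBit_or, Nat.testBit_two_pow]
    rw [Bool.or_eq_true, decide_eq_true_iff, Nat.pair_eq_pair, or_comm, Prod.ext_iff,
      eq_comm (a := q.1), eq_comm (a := q.2)]

/-- The pairing function orders pairs by their maximum, and pairs with the same maximum
lexicographically. -/
theorem pair_lt_pair_iff {a b c d : ℕ} : Nat.pair a b < Nat.pair c d ↔
    ((a < c ∨ a < d) ∧ (b < c ∨ b < d)) ∨
      ¬ ((c < a ∨ c < b) ∧ (d < a ∨ d < b)) ∧ (a < c ∨ a = c ∧ b < d) := by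
  have key : ∀ {a b c d : ℕ}, (a < c ∨ a < d) ∧ (b < c ∨ b < d) → Nat.pair a b < Nat.pair c d := by
    intro a b c d h
    have h₁ := Nat.pair_lt_max_add_one_sq a b
    have h₂ := Nat.max_sq_add_min_le_pair c d
    have : max a b + 1 ≤ max c d := by omega
    have := Nat.pow_le_pow_left this 2
    omega
  by_cases h₁ : (a < c ∨ a < d) ∧ (b < c ∨ b < d)
  · simp [h₁, key h₁]
  by_cases h₂ : (c < a ∨ c < b) ∧ (d < a ∨ d < b)
  · simp [h₁, h₂, (key h₂).le]
  have hm : max a b = max c d := by omega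
  simp only [h₁, h₂, not_false_eq_true, true_and, false_or]
  unfold Nat.pair
  split_ifs with h h' h'
  · obtain rfl : b = d := by omega
    omega
  · obtain rfl : b = c := by omega
    constructor
    · omega
    · intro; nlinarith
  · obtain rfl : a = d := by omega
    constructor
    · intro; nlinarith
    · omega
  · obtain rfl : a = c := by omega
    omega

/-- The order of the pairs of natural numbers given by the pairing function, in `A`. -/
def PairLT (a b c d : A) : Prop :=
  ((Maps W.order a c ∨ Maps W.order a d) ∧ (Maps W.order b c ∨ Maps W.order b d)) ∨
    ¬ ((Maps W.order c a ∨ Maps W.order c b) ∧ (Maps W.order d a ∨ Maps W.order d b)) ∧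
      (Maps W.order a c ∨ a = c ∧ Maps W.order b d)

instance {Γ : Type w} [Ctx A Γ] (a b c d : Γ → A) [Tm a] [Tm b] [Tm c] [Tm d] :
    D0 fun γ => PairLT W (a γ) (b γ) (c γ) (d γ) := by
  unfold PairLT
  infer_instance

theorem pairLT_iff {i j k l : ℕ} : PairLT W (W.num i) (W.num j) (W.num k) (W.num l) ↔
    Nat.pair i j < Nat.pair k l := by
  simp only [PairLT, W.maps_order, pair_lt_pair_iff, W.num_injective.eq_iff]

/-- `t` is the finite relation following `s` in the enumeration `bitPairs`: with `(i, j)` the first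
pair outside `s`, it is obtained from `s` by adding `(i, j)` and removing the earlier pairs. -/
def NextBits (s t : A) : Prop :=
  IsSet t ∧ ∃ i, i ε W.carrier ∧ ∃ j, j ε W.carrier ∧ ¬ Maps s i j ∧
    (∀ k, k ε W.carrier → ∀ l, l ε W.carrier → PairLT W k l i j → Maps s k l) ∧
    (∀ p, p ε t → ∃ k, k ε W.carrier ∧ ∃ l, l ε W.carrier ∧ IsOPair p k l) ∧
    ∀ k, k ε W.carrier → ∀ l, l ε W.carrier →
      (Maps t k l ↔ (k = i ∧ l = j) ∨ PairLT W i j k l ∧ Maps s k l)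

theorem NextBits.unique {s t t' : A} (h : NextBits W s t) (h' : NextBits W s t') : t = t' := by
  simp only [NextBits, W.bex, W.ball, pairLT_iff, W.num_injective.eq_iff] at h h'
  obtain ⟨ht, i, j, hij, hlt, hp, h⟩ := h
  obtain ⟨ht', i', j', hij', hlt', hp', h'⟩ := h'
  have hpair : Nat.pair i j = Nat.pair i' j' := by
    by_contra hne
    rcases Nat.lt_or_gt_of_ne hne with hlt₁ | hlt₁
    · exact hij (hlt' _ _ hlt₁)
    · exact hij' (hlt _ _ hlt₁)
  obtain ⟨rfl, rfl⟩ := Nat.pair_eq_pair.1 hpair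
  have key : ∀ k l, Maps t (W.num k) (W.num l) ↔ Maps t' (W.num k) (W.num l) := fun k l => by
    rw [h, h']
  refine ht.ext ht' fun p => ⟨fun hpt => ?_, fun hpt => ?_⟩
  · obtain ⟨k, l, hkl⟩ := hp p hpt
    obtain ⟨q, hq, hqkl⟩ := (key k l).1 ⟨p, hpt, hkl⟩
    rwa [hkl.unique hqkl]
  · obtain ⟨k, l, hkl⟩ := hp' p hpt
    obtain ⟨q, hq, hqkl⟩ := (key k l).2 ⟨p, hpt, hkl⟩
    rwa [hkl.unique hqkl]

theorem nextBits_bitPairs {n : ℕ} {s t : A} (hs : CodesFinBij W (bitPairs n) s)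
    (ht : CodesFinBij W (bitPairs (n + 1)) t) : NextBits W s t := by
  simp only [NextBits, W.bex, W.ball, pairLT_iff, W.num_injective.eq_iff, hs.maps_num, ht.maps_num,
    mem_bitPairs]
  obtain ⟨m, hm, hlt, h⟩ := exists_testBit_succ n
  obtain ⟨i, j, rfl⟩ : ∃ i j, Nat.pair i j = m := ⟨_, _, Nat.pair_unpair m⟩
  refine ⟨ht.1, i, j, by simp [hm], fun k l hkl => hlt _ hkl, fun p hp => ?_, fun k l => ?_⟩
  · obtain ⟨q, _, hq⟩ := (ht.2 p).1 hp
    exact ⟨q.1, q.2, hq⟩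
  · rw [h, Nat.pair_eq_pair]

/-- The set of all finite binary relations on the copy of `ω` has an enumeration in `A`. -/
theorem exists_enumeration : ∃ E, ∀ n y, Maps E (W.num n) y ↔ CodesFinBij W (bitPairs n) y := by
  choose e he using fun n => exists_codesFinBij W (bitPairs n)
  have : D0 fun p : (NilCtx A × A) × A => NextBits W p.1.2 p.2 := by
    unfold NextBits
    infer_instance
  obtain ⟨E, _, _, h⟩ := W.exists_seq (NextBits W) (fun s t t' h h' => h.unique W h') e
    fun n => nextBits_bitPairs W (he n) (he (n + 1))
  exact ⟨E, fun n y => (h n y).trans ⟨by rintro rfl; exact he n, fun hy => hy.unique (he n)⟩⟩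

end Omega

/-! ### The `α`-sets -/

section AlphaSets

variable {G : Subgroup (Equiv.Perm ℕ)}

theorem exists_finset_of_mem_nhds {f : G} {N : Set G} (hN : N ∈ nhds f) :
    ∃ e : Finset ℕ, ∀ g : G, (∀ n ∈ e, (g : Equiv.Perm ℕ) n = (f : Equiv.Perm ℕ) n) → g ∈ N := by
  rw [nhds_subtype_eq_comap, nhds_induced, Filter.comap_comap, nhds_pi, Filter.mem_comap] at hN
  obtain ⟨t, ht, htN⟩ := hN
  obtain ⟨e, s, hs, hst⟩ := Filter.mem_pi'.1 ht
  refine ⟨e, fun g hg => htN (hst fun n hn => ?_)⟩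
  change (g : Equiv.Perm ℕ) n ∈ s n
  rw [hg n hn]
  exact mem_of_mem_nhds (hs n)

/-- The restriction of a permutation to a finite set. -/
def restr (f : Equiv.Perm ℕ) (e : Finset ℕ) : Finset (ℕ × ℕ) := e.image fun k => (k, f k)

theorem mem_restr {f : Equiv.Perm ℕ} {e : Finset ℕ} {i j : ℕ} :
    (i, j) ∈ restr f e ↔ i ∈ e ∧ f i = j := by
  simp [restr]

theorem restr_mem (f : G) (e : Finset ℕ) : restr f e ∈ finRestrictions G := ⟨f, f.2, e, rfl⟩

theorem mem_extensions_restr {f g : G} {e : Finset ℕ} :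
    g ∈ extensions G (restr f e) ↔ ∀ n ∈ e, (g : Equiv.Perm ℕ) n = (f : Equiv.Perm ℕ) n := by
  simp [extensions, restr]

theorem exists_extension {σ : Finset (ℕ × ℕ)} (hσ : σ ∈ finRestrictions G) :
    ∃ f : G, f ∈ extensions G σ := by
  obtain ⟨f, hf, e, rfl⟩ := hσ
  exact ⟨⟨f, hf⟩, mem_extensions_restr (f := ⟨f, hf⟩).2 fun _ _ => rfl⟩

theorem isFinBij_of_mem {σ : Finset (ℕ × ℕ)} (hσ : σ ∈ finRestrictions G) : IsFinBij σ := by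
  obtain ⟨f, hf⟩ := exists_extension hσ
  intro p hp q hq
  rw [← hf p hp, ← hf q hq, (f : Equiv.Perm ℕ).injective.eq_iff]

variable {X : Type z} [MulAction G X]

theorem mem_saturation {c : Finset ℕ} {B : Set X} {y : X} :
    y ∈ saturation G c B ↔ ∃ f ∈ pointStab G c, f • y ∈ B := by
  have inv : ∀ {f : G}, f ∈ pointStab G c → f⁻¹ ∈ pointStab G c := by
    intro f hf k hk
    change (f : Equiv.Perm ℕ)⁻¹ k = k
    rw [Equiv.Perm.inv_eq_iff_eq, hf k hk]
  constructor
  · rintro ⟨f, hf, t, ht, rfl⟩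
    exact ⟨f⁻¹, inv hf, by rwa [inv_smul_smul]⟩
  · rintro ⟨f, hf, h⟩
    exact ⟨f⁻¹, inv hf, _, h, by rw [inv_smul_smul]⟩

theorem mul_mem_extensions {σ : Finset (ℕ × ℕ)} {f g : G} (hg : g ∈ pointStab G (frng σ))
    (hf : f ∈ extensions G σ) : g * f ∈ extensions G σ := by
  intro p hp
  rw [Subgroup.coe_mul, Equiv.Perm.mul_apply, hf p hp]
  exact hg _ (Finset.mem_image_of_mem _ hp)

variable (U : ℕ → Set X) (x : X)

theorem alphaSet_zero (σ : Finset (ℕ × ℕ)) : alphaSet G U x (0 : Ordinal.{w}) σ = Set.univ := by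
  rw [alphaSet, Ordinal.limitRecOn_zero]

theorem mem_alphaSet_one {σ : Finset (ℕ × ℕ)} {y : X} : y ∈ alphaSet G U x (1 : Ordinal.{w}) σ ↔
    ∀ l, Meets G x σ (U l) ↔ y ∈ saturation G (frng σ) (U l) := by
  have h : (1 : Ordinal.{w}) = 0 + 1 := by simp
  rw [h, alphaSet, Ordinal.limitRecOn_add_one]
  simp only [mem_ofPred_eq, ne_eq, not_true_eq_false, false_implies, and_true, true_implies]
  rw [← forall_and]
  exact forall_congr' fun l => by tauto

theorem mem_alphaSet_succ {β : Ordinal.{w}} (hβ : β ≠ 0) {σ : Finset (ℕ × ℕ)} {y : X} :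
    y ∈ alphaSet G U x (β + 1) σ ↔
      (∀ b : Finset ℕ, fdom σ ⊆ b →
        ∃ σ' ∈ finRestrictions G, σ ⊆ σ' ∧ fdom σ' = b ∧ y ∈ alphaSet G U x β σ') ∧
      ∀ a : Finset ℕ, frng σ ⊆ a →
        ∃ σ' ∈ finRestrictions G, σ ⊆ σ' ∧ frng σ' = a ∧ y ∈ alphaSet G U x β σ' := by
  rw [alphaSet, Ordinal.limitRecOn_add_one]
  simp only [mem_ofPred_eq, hβ, false_implies, true_and, ne_eq, not_false_eq_true, true_implies]
  rfl

theorem mem_alphaSet_limit {α : Ordinal.{w}} (hα : Order.IsSuccLimit α) {σ : Finset (ℕ × ℕ)}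
    {y : X} : y ∈ alphaSet G U x α σ ↔ ∀ β < α, y ∈ alphaSet G U x β σ := by
  rw [alphaSet, Ordinal.limitRecOn_limit _ _ _ _ hα]
  rfl

/-- A sufficient condition for `U k` to be contained in the saturation of the closure of `U l` under
the stabilizer of the range of `σ`, as far as points in the closure of the orbit of `x` are concerned:
some finite part `τ` of an element of the stabilizer is such that all its extensions `τ'` move `U k`
into `U l`, as far as this can be seen from the sets of basic open sets met by the sets
`V_ρ x`. Unlike the saturation itself, this condition only refers to the code of `x`. -/
def MovesInto (G : Subgroup (Equiv.Perm ℕ)) [MulAction G X] (U : ℕ → Set X) (x : X)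
    (σ : Finset (ℕ × ℕ)) (l k : ℕ) : Prop :=
  ∃ τ ∈ finRestrictions G, (∀ p ∈ σ, (p.2, p.2) ∈ τ) ∧
    ∀ τ' ∈ finRestrictions G, τ ⊆ τ' → ∀ ρ ∈ finRestrictions G, ∀ η ∈ finRestrictions G,
      (∀ p ∈ η, ∃ b, (p.1, b) ∈ ρ ∧ (b, p.2) ∈ τ') →
        Meets G x ρ (U k) → Meets G x η (U l)

variable [TopologicalSpace X] [ContinuousSMul G X]

/-- Joint continuity of the action, in terms of finite sets and basic open sets. -/
theorem exists_finset_smul_mem {U : ℕ → Set X} (hU : IsTopologicalBasis (Set.range U)) (f : G)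
    {y : X} {N : Set X} (hN : IsOpen N) (h : f • y ∈ N) :
    ∃ (e : Finset ℕ) (k : ℕ), y ∈ U k ∧ ∀ g : G,
      (∀ n ∈ e, (g : Equiv.Perm ℕ) n = (f : Equiv.Perm ℕ) n) → ∀ t ∈ U k, g • t ∈ N := by
  have hc : Continuous fun p : G × X => p.1 • p.2 := continuous_smul
  have hmem : (fun p : G × X => p.1 • p.2) ⁻¹' N ∈ nhds (f, y) :=
    (hN.preimage hc).mem_nhds h
  rw [nhds_prod_eq, Filter.mem_prod_iff] at hmem
  obtain ⟨s, hs, t, ht, hst⟩ := hmem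
  obtain ⟨e, he⟩ := exists_finset_of_mem_nhds hs
  obtain ⟨_, ⟨k, rfl⟩, hyk, hkt⟩ := hU.mem_nhds_iff.1 ht
  exact ⟨e, k, hyk, fun g hg u hu => hst (Set.mk_mem_prod (he g hg) (hkt hu))⟩

variable {U x}

/-- A point of `U k` which is in the closure of the orbit part `V_σ x` can be moved into the closure
of `U l`, if `MovesInto` holds. -/
theorem MovesInto.exists_smul_mem_closure (hU : IsTopologicalBasis (Set.range U))
    {σ : Finset (ℕ × ℕ)} {l k : ℕ} (h : MovesInto G U x σ l k) {y : X} (hy : y ∈ U k)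
    (hcl : ∀ m, y ∈ U m → Meets G x σ (U m)) :
    ∃ g ∈ pointStab G (frng σ), g • y ∈ closure (U l) := by
  obtain ⟨τ, hτ, hτσ, h⟩ := h
  obtain ⟨g, hg⟩ := exists_extension hτ
  have hgσ : g ∈ pointStab G (frng σ) := by
    intro b hb
    obtain ⟨p, hp, rfl⟩ := Finset.mem_image.1 hb
    exact hg _ (hτσ p hp)
  refine ⟨g, hgσ, hU.mem_closure_iff.2 ?_⟩
  rintro _ ⟨n, rfl⟩ hn
  -- a point `f • x` of the orbit, close to `y`, is moved by `g` into `U n`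
  have hopen : ∀ m, IsOpen (U m) := fun m => hU.isOpen ⟨m, rfl⟩
  have hnear : U k ∩ (fun t => g • t) ⁻¹' U n ∈ nhds y :=
    ((hopen k).inter ((hopen n).preimage (continuous_const_smul g))).mem_nhds ⟨hy, hn⟩
  obtain ⟨_, ⟨m, rfl⟩, hym, hm⟩ := hU.mem_nhds_iff.1 hnear
  obtain ⟨f, _, hfm⟩ := hcl m hym
  obtain ⟨hfk, hfn⟩ := hm hfm
  rw [Set.mem_preimage, smul_smul] at hfn
  -- finite parts of `f`, `g` and `g * f` suffice for this
  obtain ⟨e, j, hj, he⟩ := exists_finset_smul_mem hU (g * f) (hopen n) hfn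
  obtain ⟨e₀, he₀⟩ : ∃ e₀ : Finset ℕ, τ ⊆ restr g e₀ := by
    refine ⟨fdom τ, fun p hp => ?_⟩
    exact mem_restr.2 ⟨Finset.mem_image_of_mem _ hp, hg p hp⟩
  obtain ⟨f', hf', hl⟩ := h (restr g (e₀ ∪ e.image (f : Equiv.Perm ℕ))) (restr_mem _ _)
    (fun p hp => mem_restr.2 ⟨Finset.mem_union_left _ (mem_restr.1 (he₀ hp)).1,
      (mem_restr.1 (he₀ hp)).2⟩)
    (restr f e) (restr_mem _ _) (restr (g * f : G) e) (restr_mem _ _)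
    (by
      rintro ⟨a, b⟩ hab
      obtain ⟨ha, rfl⟩ := mem_restr.1 hab
      exact ⟨(f : Equiv.Perm ℕ) a, mem_restr.2 ⟨ha, rfl⟩, mem_restr.2
        ⟨Finset.mem_union_right _ (Finset.mem_image_of_mem _ ha), rfl⟩⟩)
    ⟨f, mem_extensions_restr.2 fun _ _ => rfl, hfk⟩
  exact ⟨f' • x, he f' (mem_extensions_restr.1 hf') x hj, hl⟩

/-- A point of the saturation of `U l` is in a basic open set which is moved into `U l`. -/
theorem exists_movesInto (hU : IsTopologicalBasis (Set.range U)) {σ : Finset (ℕ × ℕ)} {l : ℕ}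
    {y : X} (hy : y ∈ saturation G (frng σ) (U l)) : ∃ k, MovesInto G U x σ l k ∧ y ∈ U k := by
  obtain ⟨g, hg, hgy⟩ := mem_saturation.1 hy
  obtain ⟨e, k, hyk, he⟩ := exists_finset_smul_mem hU g (hU.isOpen ⟨l, rfl⟩) hgy
  refine ⟨k, ⟨restr g (e ∪ frng σ), restr_mem _ _, fun p hp => ?_, ?_⟩, hyk⟩
  · have hp' := Finset.mem_image_of_mem Prod.snd hp
    exact mem_restr.2 ⟨Finset.mem_union_right _ hp', hg _ hp'⟩
  · rintro τ' hτ' hsub ρ _ η _ hη ⟨f, hf, hfk⟩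
    obtain ⟨g', hg'⟩ := exists_extension hτ'
    refine ⟨g' * f, fun p hp => ?_, ?_⟩
    · obtain ⟨b, hb, hb'⟩ := hη p hp
      rw [Subgroup.coe_mul, Equiv.Perm.mul_apply, hf _ hb, hg' _ hb']
    · rw [mul_smul]
      refine he g' (fun n hn => ?_) _ hfk
      exact hg' _ (hsub (mem_restr.2 ⟨Finset.mem_union_left _ hn, rfl⟩))

/-- The `1`-set `B_1(x, σ)` consists of the points of the closure of `V_σ x` which, for each `U l`
meeting `V_σ x`, belong to some `U k` which is moved into `U l`. -/
theorem mem_alphaSet_one_iff [RegularSpace X] (hU : IsTopologicalBasis (Set.range U))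
    {σ : Finset (ℕ × ℕ)} {y : X} : y ∈ alphaSet G U x (1 : Ordinal.{w}) σ ↔
      ∀ l, (¬ Meets G x σ (U l) → y ∉ U l) ∧
        (Meets G x σ (U l) → ∃ k, MovesInto G U x σ l k ∧ y ∈ U k) := by
  rw [mem_alphaSet_one]
  constructor
  · refine fun h l => ⟨fun hl hy => hl ((h l).2 ?_), fun hl => exists_movesInto hU ((h l).1 hl)⟩
    exact mem_saturation.2 ⟨1, fun _ _ => rfl, by rwa [one_smul]⟩
  · intro h
    have hcl : ∀ m, y ∈ U m → Meets G x σ (U m) := fun m hm => by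
      by_contra hn
      exact (h m).1 hn hm
    refine fun l => ⟨fun hl => ?_, fun hl => ?_⟩
    · -- by regularity, `U l` contains the closure of a basic open set meeting `V_σ x`
      obtain ⟨f, hf, hfl⟩ := hl
      obtain ⟨s, ⟨hs, hsc⟩, hsl⟩ := (closed_nhds_basis (f • x)).mem_iff.1
        ((hU.isOpen ⟨l, rfl⟩).mem_nhds hfl)
      obtain ⟨_, ⟨m, rfl⟩, hfm, hms⟩ := hU.mem_nhds_iff.1 hs
      obtain ⟨k, hk, hyk⟩ := (h m).2 ⟨f, hf, hfm⟩
      obtain ⟨g, hg, hgy⟩ := hk.exists_smul_mem_closure hU hyk hcl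
      exact mem_saturation.2 ⟨g, hg, hsl (closure_minimal hms hsc hgy)⟩
    · obtain ⟨g, hg, t, ht, rfl⟩ := hl
      have hy : g • t ∈ (fun u => g⁻¹ • u) ⁻¹' U l := by simpa using ht
      obtain ⟨_, ⟨m, rfl⟩, hm, hml⟩ := hU.mem_nhds_iff.1
        (((hU.isOpen ⟨l, rfl⟩).preimage (continuous_const_smul g⁻¹)).mem_nhds hy)
      obtain ⟨f, hf, hfm⟩ := hcl m hm
      refine ⟨g⁻¹ * f, mul_mem_extensions (fun k hk => ?_) hf, ?_⟩
      · change (g : Equiv.Perm ℕ)⁻¹ k = k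
        rw [Equiv.Perm.inv_eq_iff_eq, hg k hk]
      · rw [mul_smul]
        exact hml hfm

theorem isOpen_saturation (c : Finset ℕ) {B : Set X} (hB : IsOpen B) :
    IsOpen (saturation G c B) := by
  have : saturation G c B = ⋃ f ∈ pointStab G c, (fun y => f • y) ⁻¹' B := by
    ext y
    simp [mem_saturation]
  rw [this]
  exact isOpen_biUnion fun f _ => hB.preimage (continuous_const_smul f)

theorem measurableSet_alphaSet (hU : IsTopologicalBasis (Set.range U)) (α : Ordinal.{w})
    (hα : (Set.Iio α).Countable) :
    ∀ σ, @MeasurableSet X (borel X) (alphaSet G U x α σ) := by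
  let _ : MeasurableSpace X := borel X
  have : BorelSpace X := ⟨rfl⟩
  induction α using Ordinal.limitRecOn with
  | zero => exact fun σ => by rw [alphaSet_zero]; exact .univ
  | add_one β ih =>
    intro σ
    have ih := ih (hα.mono (Set.Iio_subset_Iio (Order.le_succ β)))
    by_cases hβ : β = 0
    · subst hβ
      have : alphaSet G U x ((0 : Ordinal.{w}) + 1) σ =
          ⋂ l, {y | Meets G x σ (U l) ↔ y ∈ saturation G (frng σ) (U l)} := by
        ext y
        rw [zero_add, mem_alphaSet_one]
        simp
      rw [this]
      exact .iInter fun l => .iff (.const _)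
        (isOpen_saturation _ (hU.isOpen ⟨l, rfl⟩)).measurableSet
    · have : alphaSet G U x (β + 1) σ =
          (⋂ (b : Finset ℕ) (_ : fdom σ ⊆ b), ⋃ (τ : Finset (ℕ × ℕ))
            (_ : τ ∈ finRestrictions G ∧ σ ⊆ τ ∧ fdom τ = b), alphaSet G U x β τ) ∩
          ⋂ (a : Finset ℕ) (_ : frng σ ⊆ a), ⋃ (τ : Finset (ℕ × ℕ))
            (_ : τ ∈ finRestrictions G ∧ σ ⊆ τ ∧ frng τ = a), alphaSet G U x β τ := by
        ext y
        rw [mem_alphaSet_succ U x hβ]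
        simp [and_assoc]
      rw [this]
      exact .inter (.iInter fun b => .iInter fun _ => .iUnion fun τ => .iUnion fun _ => ih τ)
        (.iInter fun b => .iInter fun _ => .iUnion fun τ => .iUnion fun _ => ih τ)
  | limit α hlim ih =>
    intro σ
    have : alphaSet G U x α σ = ⋂ β ∈ Set.Iio α, alphaSet G U x β σ := by
      ext y
      rw [mem_alphaSet_limit U x hlim]
      simp
    rw [this]
    exact .biInter hα fun β hβ => ih β hβ (hα.mono (Set.Iio_subset_Iio (le_of_lt hβ))) σ

end AlphaSets

/-! ### The sets described by multicodes -/

section Codes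

variable {A : Type w} [TransitiveUniverse A] {W : OmegaCopy A} {X : Type z} {U : ℕ → Set X}

/-- `q` has a nonempty element. This distinguishes the multicodes and co-multicodes from `0` and
`1`. -/
def HasDepth (q : A) : Prop := ∃ t, t ε q ∧ ∃ u, u ε t

theorem IsOPair.exists_mem_of_mem {p x y t : A} (h : IsOPair p x y) (ht : t ε p) : ∃ u, u ε t := by
  obtain ⟨s, d, hs, hd, hp⟩ := h
  rcases (hp.2 t).1 ht with rfl | rfl
  · exact ⟨x, (hs.2 x).2 (.inl rfl)⟩
  · exact ⟨x, (hd.2 x).2 (.inl rfl)⟩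

theorem IsCoOf.exists_empty_mem {q q' p : A} (h : IsCoOf q q') (hp : p ε q) :
    ∃ t, t ε p ∧ IsEmptySet t := by
  obtain ⟨o, ho, s, d, hs, hd, hq⟩ := h
  rcases (hq.2 p).1 hp with rfl | rfl
  · exact ⟨o, (hs.2 o).2 (.inl rfl), ho⟩
  · exact ⟨o, (hd.2 o).2 (.inl rfl), ho⟩

/-- Elements of a pair `(0, q')` are not ordered pairs, since they contain `0`. -/
theorem IsCoOf.not_maps {q q' x y : A} (h : IsCoOf q q') : ¬ Maps q x y := by
  rintro ⟨p, hp, hxy⟩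
  obtain ⟨t, ht, hte⟩ := h.exists_empty_mem hp
  obtain ⟨u, hu⟩ := hxy.exists_mem_of_mem ht
  exact hte.2 u hu

theorem IsCoOf.hasDepth {q q' : A} (h : IsCoOf q q') : HasDepth q := by
  obtain ⟨_, _, h⟩ := h
  obtain ⟨d, hd, ho, _⟩ := h.exists_mem
  exact ⟨d, hd, _, ho⟩

theorem Maps.hasDepth {q x y : A} (h : Maps q x y) : HasDepth q := by
  obtain ⟨p, hp, h⟩ := h
  obtain ⟨d, hd, _⟩ := h.exists_mem
  exact ⟨p, hp, d, hd⟩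

theorem HasDepth.not_isOneCode {q q' : A} (h : HasDepth q') (hq : InRange q q') :
    ¬ IsOneCode W q := by
  obtain ⟨t, ht, u, hu⟩ := h
  rintro ⟨_, _, h⟩
  rcases h q' hq with h | h
  · exact h.2 t ht
  · exact ((h.2 t).1 ht).2 u hu

theorem codedSet_of_isOneCode {q : A} (h : IsOneCode W q) :
    codedSet W U q = {y | ∃ n, (∃ i, IsOne i ∧ Maps q (W.num n) i) ∧ y ∈ U n} := by
  rw [codedSet]
  simp [h]

theorem codedSet_of_isCoOf {q q' : A} (h : IsCoOf q q') :
    codedSet W U q = (codedSet W U q')ᶜ := by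
  have h₁ : ¬ IsOneCode W q := fun h' => by
    obtain ⟨y, hy⟩ := (h'.2.1 _).1 (W.num_mem 0)
    exact h.not_maps hy
  ext y
  rw [codedSet]
  simp only [h₁, false_and, not_false_eq_true, true_and, false_or]
  constructor
  · rintro (⟨q'', hq'', hy⟩ | ⟨q'', ⟨x, hq''⟩, _⟩)
    · rwa [h.unique hq'']
    · exact (h.not_maps hq'').elim
  · exact fun hy => .inl ⟨q', h, hy⟩

theorem mem_codedSet_of_isFunction {q : A} (h : IsFunction q) (h₁ : ¬ IsOneCode W q) {y : X} :
    y ∈ codedSet W U q ↔ ∃ q', InRange q q' ∧ y ∈ codedSet W U q' := by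
  have h₂ : ∀ q', ¬ IsCoOf q q' := fun q' hq' => by
    obtain ⟨p, hp, _⟩ := hq'.hasDepth
    obtain ⟨a, b, hab⟩ := h.2.1 p hp
    exact hq'.not_maps ⟨p, hp, hab⟩
  rw [codedSet]
  simp [h₁, h₂]

variable (W) in
/-- `q` is an `o`-multicode, for an ordinal `o` which need not be given as an element of `A`. -/
def IsCode (o : Ordinal.{w}) (q : A) : Prop := ∃ b, IsOrd b ∧ ordOf b = o ∧ BSigma W b q

variable [KPU A]

theorem IsOneCode.isCode {q : A} (h : IsOneCode W q) : IsCode W 1 q := by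
  obtain ⟨a, ha⟩ := exists_isOne (A := A)
  exact ⟨a, ha.isOrd, ha.isOrd.isOne_iff.1 ha, by rw [BSigma]; exact .inl ⟨ha, h⟩⟩

theorem isCode_of_isFunction {a q : A} (ha : IsOrd a) (h1 : 1 < ordOf a) (hq : IsFunction q)
    (hl : Order.IsSuccLimit (ordOf a) → HasDomain q a)
    (hs : (∃ o, ordOf a = o + 1) → HasDomain q W.carrier)
    (h : ∀ q', InRange q q' → ∃ o < ordOf a, (∃ q'', IsCoOf q' q'' ∧ IsCode W o q'') ∨ IsCode W o q') :
    IsCode W (ordOf a) q := by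
  refine ⟨a, ha, rfl, ?_⟩
  rw [BSigma]
  refine .inr ⟨ha, ?_, hq, fun h => hl (ha.isLimitOrd_iff.1 h),
    fun h => hs (ha.isSuccOrd_iff.1 h), fun q' hq' => ?_⟩
  · obtain ⟨b, hb, hb'⟩ := ha.exists_ordOf_eq h1
    exact ⟨b, hb, (ha.of_mem hb).isOne_iff.2 hb'⟩
  · obtain ⟨o, ho, ⟨q'', hco, b, hb, rfl, hq''⟩ | ⟨b, hb, rfl, hq''⟩⟩ := h q' hq'
    · exact ⟨b, (ha.mem_iff hb).2 ho, .inl ⟨q'', hco, hq''⟩⟩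
    · exact ⟨b, (ha.mem_iff hb).2 ho, .inr hq''⟩

theorem isCode_succ {o : Ordinal.{w}} {q : A} (ho : 1 ≤ o) (hoA : ∃ b : A, IsOrd b ∧ ordOf b = o)
    (hq : IsFunction q) (hd : HasDomain q W.carrier)
    (h : ∀ q', InRange q q' → ∃ o' ≤ o, (∃ q'', IsCoOf q' q'' ∧ IsCode W o' q'') ∨ IsCode W o' q') :
    IsCode W (o + 1) q := by
  obtain ⟨b, hb, rfl⟩ := hoA
  obtain ⟨a, ha, hab⟩ := hb.exists_add_nat 1
  rw [Nat.cast_one] at hab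
  have hlt : ordOf b < ordOf a := by rw [hab]; exact Order.lt_add_one_iff.2 le_rfl
  rw [← hab]
  refine isCode_of_isFunction ha (ho.trans_lt hlt) hq (fun hl => ?_) (fun _ => hd) fun q' hq' => ?_
  · have := hl.succ_lt hlt
    rw [hab, Order.succ_eq_add_one] at this
    exact (lt_irrefl _ this).elim
  · obtain ⟨o', ho', h⟩ := h q' hq'
    exact ⟨o', ho'.trans_lt hlt, h⟩

variable (W) in
/-- `q` is the characteristic function of `P` on the copy of `ω`. -/
def IsChar (P : A → Prop) (q : A) : Prop :=
  IsMapOn W.carrier (fun k b => P k ∧ IsOne b ∨ ¬ P k ∧ IsEmptySet b) q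

instance {Γ : Type w} [Ctx A Γ] (P : Γ → A → Prop) (q : Γ → A) [Tm q]
    [hP : D0 fun p : Γ × A => P p.1 p.2] : Sg fun γ => IsChar W (P γ) (q γ) := by
  have := hP.comp (Δ := (Γ × A) × A) Subst.id.weaken
  unfold IsChar
  infer_instance

omit [KPU A] in
theorem IsOne.unique {a b : A} (ha : IsOne a) (hb : IsOne b) : a = b :=
  ha.1.ext hb.1 fun x => (ha.2 x).trans (hb.2 x).symm

theorem IsOne.not_isEmptySet {a : A} (ha : IsOne a) : ¬ IsEmptySet a := by
  obtain ⟨o, ho⟩ := exists_empty (A := A)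
  exact fun h => h.2 o ((ha.2 o).2 ho)

omit [KPU A] in
theorem char_unique (P : A → Prop) (k b b' : A) (_ : k ε W.carrier)
    (h : P k ∧ IsOne b ∨ ¬ P k ∧ IsEmptySet b) (h' : P k ∧ IsOne b' ∨ ¬ P k ∧ IsEmptySet b') :
    b = b' := by
  rcases h with ⟨h, hb⟩ | ⟨h, hb⟩ <;> rcases h' with ⟨h', hb'⟩ | ⟨h', hb'⟩
  · exact hb.unique hb'
  · exact (h' h).elim
  · exact (h h').elim
  · exact hb.unique hb'

omit [KPU A] in
theorem IsChar.unique {P : A → Prop} {q q' : A} (h : IsChar W P q) (h' : IsChar W P q') : q = q' :=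
  IsMapOn.unique h h' (char_unique P)

variable (W) in
theorem exists_isChar (P : A → Prop) [D0 fun p : NilCtx A × A => P p.2] : ∃ q, IsChar W P q := by
  have := D0.app₁ (Γ := (NilCtx A × A) × A) ‹_› fun p => p.1.2
  refine exists_isMapOn _ _ (fun k _ => ?_) (char_unique P)
  by_cases hk : P k
  · obtain ⟨b, hb⟩ := exists_isOne (A := A)
    exact ⟨b, .inl ⟨hk, hb⟩⟩
  · obtain ⟨b, hb⟩ := exists_empty (A := A)
    exact ⟨b, .inr ⟨hk, hb⟩⟩

omit [KPU A] in
theorem IsChar.isOneCode {P : A → Prop} {q : A} (h : IsChar W P q) : IsOneCode W q := by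
  refine ⟨h.1, h.2.1, ?_⟩
  rintro y ⟨k, hk⟩
  rcases (h.value hk).2 with ⟨_, h⟩ | ⟨_, h⟩
  · exact .inr h
  · exact .inl h

theorem IsChar.mem_codedSet {P : A → Prop} {q : A} (h : IsChar W P q) {y : X} :
    y ∈ codedSet W U q ↔ ∃ n, P (W.num n) ∧ y ∈ U n := by
  rw [codedSet_of_isOneCode h.isOneCode]
  refine exists_congr fun n => and_congr_left fun _ => ⟨?_, fun hn => ?_⟩
  · rintro ⟨i, hi, hm⟩
    rcases (h.value hm).2 with ⟨h, _⟩ | ⟨_, h⟩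
    · exact h
    · exact (hi.not_isEmptySet h).elim
  · obtain ⟨i, hi⟩ := exists_isOne (A := A)
    exact ⟨i, hi, (IsMapOn.maps_iff h (char_unique P)).2 ⟨W.num_mem n, .inl ⟨hn, hi⟩⟩⟩

omit [KPU A] in
theorem IsMapOn.hasDepth {Q : A → A → Prop} {d x q : A} (h : IsMapOn d Q q) (hx : x ε d) :
    HasDepth q := by
  obtain ⟨y, _, hy⟩ := h.2.2 x hx
  exact hy.hasDepth

omit [KPU A] in
/-- The set described by a function all of whose values are nontrivial codes. -/
theorem IsMapOn.mem_codedSet {Q : A → A → Prop} {d x q : A} (h : IsMapOn d Q q) (hx : x ε d)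
    (huniq : ∀ x y y', x ε d → Q x y → Q x y' → y = y') (hQ : ∀ x y, x ε d → Q x y → HasDepth y)
    {y : X} : y ∈ codedSet W U q ↔ ∃ x, x ε d ∧ ∃ t, Q x t ∧ y ∈ codedSet W U t := by
  obtain ⟨t, ht, hxt⟩ := h.2.2 x hx
  rw [mem_codedSet_of_isFunction h.1 ((hQ x t hx ht).not_isOneCode ⟨x, hxt⟩)]
  constructor
  · rintro ⟨t, ⟨x, hxt⟩, hy⟩
    exact ⟨x, (h.value hxt).1, t, (h.value hxt).2, hy⟩
  · rintro ⟨x, hx, t, ht, hy⟩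
    exact ⟨t, ⟨x, (h.maps_iff huniq).2 ⟨hx, ht⟩⟩, hy⟩

end Codes

/-! ### The code of a point -/

section Point

variable {A : Type w} [TransitiveUniverse A]

/-- `r` belongs to the value of the function `f` at `s`. -/
def ValueMem (f s r : A) : Prop := ∃ t, Maps f s t ∧ r ε t

instance {Γ : Type w} [Ctx A Γ] (f g h : Γ → A) [Tm f] [Tm g] [Tm h] :
    D0 fun γ => ValueMem (f γ) (g γ) (h γ) :=
  D0.app₃ (D0.congr (Q := fun γ : ((NilCtx A × A) × A) × A => ∃ p, p ε γ.1.1.2 ∧ ∃ d, d ε p ∧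
    ∃ t, t ε d ∧ IsOPair p γ.1.2 t ∧ γ.2 ε t) (fun γ => by
      constructor
      · rintro ⟨t, ⟨p, hp, h⟩, ht⟩
        obtain ⟨d, hd, _, htd⟩ := h.exists_mem
        exact ⟨p, hp, d, hd, t, htd, h, ht⟩
      · rintro ⟨p, hp, _, _, t, _, h, ht⟩
        exact ⟨t, ⟨p, hp, h⟩, ht⟩) inferInstance) f g h

variable {W : OmegaCopy A} {G : Subgroup (Equiv.Perm ℕ)} {X : Type z} [MulAction G X]
  {U : ℕ → Set X} {x : X}

variable (W G U x) in
/-- The elements of `A` representing the point `x`: the set `S` of the finite restrictions of elements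
of `G`, and a function `C` which maps each of them to the set of (indices of) basic
open sets met by `V_σ x`. -/
structure IsPointCode (S C : A) : Prop where
  mem_iff : ∀ s, s ε S ↔ ∃ σ ∈ finRestrictions G, CodesFinBij W σ s
  valueMem_iff : ∀ σ ∈ finRestrictions G, ∀ s, CodesFinBij W σ s →
    ∀ l, ValueMem C s (W.num l) ↔ Meets G x σ (U l)

variable [KPU A]

theorem Codable.exists_isPointCode [TopologicalSpace X] (hU : IsTopologicalBasis (Set.range U))
    (hx : Codable W G U x) : ∃ S C : A, IsPointCode W G U x S C := by
  obtain ⟨C, _, hC, hC'⟩ := hx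
  have hval : ∀ σ ∈ finRestrictions G, ∀ s, CodesFinBij W σ s →
      ∀ l, ValueMem C s (W.num l) ↔ Meets G x σ (U l) := by
    intro σ hσ s hs l
    constructor
    · rintro ⟨t, ⟨p, hp, hst⟩, hl⟩
      obtain ⟨σ', s', t', _, hs', ht', hst'⟩ := hC p hp
      obtain ⟨rfl, rfl⟩ := hst.inj hst'
      obtain rfl := hs.inj hs'
      obtain ⟨_, l', hl', hll⟩ := (ht'.2 _).1 hl
      rwa [W.num_injective hll]
    · intro hl
      obtain ⟨s', t, hs', ht, hst⟩ := hC' σ (isFinBij_of_mem hσ)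
      obtain rfl := hs.unique hs'
      exact ⟨t, hst, (ht.2 _).2 ⟨hσ, l, hl, rfl⟩⟩
  obtain ⟨B, _, hB⟩ := exists_sUnion C
  obtain ⟨D, _, hD⟩ := exists_sUnion B
  obtain ⟨S, _, hS⟩ := KPU.separation (fun s => ∃ l, l ε W.carrier ∧ ValueMem C s l) D
  refine ⟨S, C, fun s => (hS s).trans ⟨?_, ?_⟩, hval⟩
  · rintro ⟨_, l, _, t, ⟨p, hp, hst⟩, hl⟩
    obtain ⟨σ, s', t', _, hs', ht', hst'⟩ := hC p hp
    obtain ⟨rfl, rfl⟩ := hst.inj hst'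
    exact ⟨σ, ((ht'.2 _).1 hl).1, hs'⟩
  · rintro ⟨σ, hσ, hs⟩
    obtain ⟨f, hf⟩ := exists_extension hσ
    obtain ⟨_, ⟨l, rfl⟩, hl, _⟩ := hU.exists_subset_of_mem_open (Set.mem_univ (f • x)) isOpen_univ
    have hv := (hval σ hσ s hs l).2 ⟨f, hf, hl⟩
    refine ⟨?_, W.num l, W.num_mem l, hv⟩
    obtain ⟨t, ⟨p, hp, hst⟩, _⟩ := hv
    obtain ⟨d, hd, hsd, _⟩ := hst.exists_mem
    exact (hD s).2 ⟨d, (hB d).2 ⟨p, hp, hd⟩, hsd⟩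

variable {S C : A}

omit [KPU A] in
theorem IsPointCode.ball (h : IsPointCode W G U x S C) {P : A → Prop} :
    (∀ s, s ε S → P s) ↔ ∀ σ ∈ finRestrictions G, ∀ s, CodesFinBij W σ s → P s := by
  simp only [h.mem_iff]
  exact ⟨fun H σ hσ s hs => H s ⟨σ, hσ, hs⟩, fun H s ⟨σ, hσ, hs⟩ => H σ hσ s hs⟩

omit [KPU A] in
theorem IsPointCode.bex (h : IsPointCode W G U x S C) {P : A → Prop} :
    (∃ s, s ε S ∧ P s) ↔ ∃ σ ∈ finRestrictions G, ∃ s, CodesFinBij W σ s ∧ P s := by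
  simp only [h.mem_iff]
  exact ⟨fun ⟨s, ⟨σ, hσ, hs⟩, H⟩ => ⟨σ, hσ, s, hs, H⟩, fun ⟨σ, hσ, s, hs, H⟩ => ⟨s, ⟨σ, hσ, hs⟩, H⟩⟩

variable (W S C) in
/-- The relation `MovesInto`, in `A`. -/
def MovesIntoIn (s l k : A) : Prop :=
  ∃ t, t ε S ∧ (∀ b, b ε W.carrier → (∃ a, a ε W.carrier ∧ Maps s a b) → Maps t b b) ∧
    ∀ t', t' ε S → (∀ p, p ε t → p ε t') → ∀ r, r ε S → ∀ h, h ε S →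
      (∀ a, a ε W.carrier → ∀ c, c ε W.carrier → Maps h a c →
        ∃ b, b ε W.carrier ∧ Maps r a b ∧ Maps t' b c) →
      ValueMem C r k → ValueMem C h l

instance {Γ : Type w} [Ctx A Γ] (f g h : Γ → A) [Tm f] [Tm g] [Tm h] :
    D0 fun γ => MovesIntoIn W S C (f γ) (g γ) (h γ) :=
  have : D0 fun p : ((NilCtx A × A) × A) × A => MovesIntoIn W S C p.1.1.2 p.1.2 p.2 := by
    unfold MovesIntoIn
    infer_instance
  D0.app₃ this f g h

theorem IsPointCode.movesIntoIn_iff (h : IsPointCode W G U x S C) {σ : Finset (ℕ × ℕ)} {s : A}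
    (hs : CodesFinBij W σ s) {l k : ℕ} :
    MovesIntoIn W S C s (W.num l) (W.num k) ↔ MovesInto G U x σ l k := by
  simp only [MovesIntoIn, h.bex, h.ball, W.ball, W.bex, MovesInto]
  constructor
  · rintro ⟨τ, hτ, t, ht, hst, H⟩
    simp only [hs.maps_num, ht.maps_num] at hst
    refine ⟨τ, hτ, fun p hp => hst p.2 ⟨p.1, hp⟩, fun τ' hτ' hsub ρ hρ η hη hc hm => ?_⟩
    obtain ⟨t', ht'⟩ := exists_codesFinBij W τ'
    obtain ⟨r, hr⟩ := exists_codesFinBij W ρ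
    obtain ⟨e, he⟩ := exists_codesFinBij W η
    refine (h.valueMem_iff η hη e he l).1 (H τ' hτ' t' ht' ((ht.subset_iff ht').2 hsub) ρ hρ r hr
      η hη e he (fun a c hac => ?_) ((h.valueMem_iff ρ hρ r hr k).2 hm))
    simp only [hr.maps_num, ht'.maps_num]
    exact hc _ (he.maps_num.1 hac)
  · rintro ⟨τ, hτ, hst, H⟩
    obtain ⟨t, ht⟩ := exists_codesFinBij W τ
    refine ⟨τ, hτ, t, ht, ?_, ?_⟩
    · rintro b ⟨a, ha⟩
      exact ht.maps_num.2 (hst _ (hs.maps_num.1 ha))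
    · intro τ' hτ' t' ht' hsub ρ hρ r hr η hη e he hc hm
      simp only [hr.maps_num, ht'.maps_num, he.maps_num] at hc
      exact (h.valueMem_iff η hη e he l).2 (H τ' hτ' ((ht.subset_iff ht').1 hsub) ρ hρ η hη
        (fun p hp => hc _ _ hp) ((h.valueMem_iff ρ hρ r hr k).1 hm))

end Point

/-! ### The steps of the recursion -/

section AlphaCodes

/-- A finite relation `δ` stands for a requirement on extensions of finite bijections: the numbers
`i` with `(i, 1) ∈ δ` have to be added to the domain or to the range. -/
def demand (δ : Finset (ℕ × ℕ)) : Finset ℕ := (δ.filter fun p => p.2 = 1).image Prod.fst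

theorem mem_demand {δ : Finset (ℕ × ℕ)} {i : ℕ} : i ∈ demand δ ↔ (i, 1) ∈ δ := by
  simp [demand]

/-- `τ` is an extension of `σ` which meets the requirement `δ`, about the domain if `(0, 0) ∈ δ`, and
about the range otherwise. -/
def Answers (σ δ τ : Finset (ℕ × ℕ)) : Prop :=
  σ ⊆ τ ∧ ((0, 0) ∈ δ ∧ fdom τ = fdom σ ∪ demand δ ∨ (0, 0) ∉ δ ∧ frng τ = frng σ ∪ demand δ)

theorem forall_answers_iff {σ : Finset (ℕ × ℕ)} {P : Finset (ℕ × ℕ) → Prop} :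
    (∀ δ, ∃ τ, Answers σ δ τ ∧ P τ) ↔
      (∀ b : Finset ℕ, fdom σ ⊆ b → ∃ τ, σ ⊆ τ ∧ fdom τ = b ∧ P τ) ∧
        ∀ a : Finset ℕ, frng σ ⊆ a → ∃ τ, σ ⊆ τ ∧ frng τ = a ∧ P τ := by
  constructor
  · refine fun h => ⟨fun b hb => ?_, fun a ha => ?_⟩
    · obtain ⟨τ, ⟨hsub, hd⟩, hP⟩ := h (insert (0, 0) (b.image fun i => (i, 1)))
      have hdem : demand (insert (0, 0) (b.image fun i => (i, 1))) = b := by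
        ext i
        simp [mem_demand]
      rw [hdem, Finset.union_eq_right.2 hb] at hd
      simp only [Finset.mem_insert_self, true_and, not_true_eq_false, false_and, or_false] at hd
      exact ⟨τ, hsub, hd, hP⟩
    · obtain ⟨τ, ⟨hsub, hd⟩, hP⟩ := h (a.image fun i => (i, 1))
      have hdem : demand (a.image fun i => (i, 1)) = a := by
        ext i
        simp [mem_demand]
      have h0 : (0, 0) ∉ a.image fun i => (i, 1) := by simp
      rw [hdem, Finset.union_eq_right.2 ha] at hd
      simp only [h0, false_and, not_false_eq_true, true_and, false_or] at hd
      exact ⟨τ, hsub, hd, hP⟩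
  · rintro ⟨h₁, h₂⟩ δ
    by_cases h0 : (0, 0) ∈ δ
    · obtain ⟨τ, hsub, hd, hP⟩ := h₁ (fdom σ ∪ demand δ) Finset.subset_union_left
      exact ⟨τ, ⟨hsub, .inl ⟨h0, hd⟩⟩, hP⟩
    · obtain ⟨τ, hsub, hd, hP⟩ := h₂ (frng σ ∪ demand δ) Finset.subset_union_left
      exact ⟨τ, ⟨hsub, .inr ⟨h0, hd⟩⟩, hP⟩

variable {A : Type w} [TransitiveUniverse A] (W : OmegaCopy A) {G : Subgroup (Equiv.Perm ℕ)}
  {X : Type z} [MulAction G X] {U : ℕ → Set X} {x : X} {S C : A}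

/-- The relation `Answers`, in `A`, for elements `t` of `S`. -/
def AnswersIn (S s d t : A) : Prop :=
  t ε S ∧ (∀ p, p ε s → p ε t) ∧
    (Maps d (W.num 0) (W.num 0) ∧ (∀ i, i ε W.carrier → ((∃ j, j ε W.carrier ∧ Maps t i j) ↔
      (∃ j, j ε W.carrier ∧ Maps s i j) ∨ Maps d i (W.num 1))) ∨
    ¬ Maps d (W.num 0) (W.num 0) ∧ ∀ j, j ε W.carrier → ((∃ i, i ε W.carrier ∧ Maps t i j) ↔
      (∃ i, i ε W.carrier ∧ Maps s i j) ∨ Maps d j (W.num 1)))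

instance {Γ : Type w} [Ctx A Γ] (f g h : Γ → A) [Tm f] [Tm g] [Tm h] :
    D0 fun γ => AnswersIn W S (f γ) (g γ) (h γ) :=
  have : D0 fun p : ((NilCtx A × A) × A) × A => AnswersIn W S p.1.1.2 p.1.2 p.2 := by
    unfold AnswersIn
    infer_instance
  D0.app₃ this f g h

/-- The value `q` at `s` of the function coding the complements of the `1`-sets: the sequence
of the complements of the sets `⋃ {U k | MovesInto σ l k}` for those `l` for which `U l` meets
`V_σ x`, and of the sets `U l` for the other `l`. -/
def OneStep (S C s q : A) : Prop :=
  IsMapOn W.carrier (fun l t =>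
    ValueMem C s l ∧ (∃ v, IsCoOf t v ∧ IsChar W (fun k => MovesIntoIn W S C s l k) v) ∨
      ¬ ValueMem C s l ∧ IsChar W (fun k => k = l) t) q

/-- The value `c` at `m` of the multicode coding the union of the sets coded by the values at
extensions of `s` meeting the requirement `d` of the function `z`, in the enumeration `E`; the code
`o` of the empty set is used for the other indices. -/
def ExtensionStep (S E o z s d m c : A) : Prop :=
  ∃ t, Maps E m t ∧
    (AnswersIn W S s d t ∧ (∃ c', Maps z t c' ∧ IsCoOf c c') ∨ ¬ AnswersIn W S s d t ∧ c = o)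

/-- The value `q` at `s` of the function coding the complements of the `(α + 1)`-sets, where the
function `z` codes the complements of the `α`-sets. -/
def SuccStep (S E o z s q : A) : Prop :=
  IsMapOn W.carrier (fun n t => ∃ v, IsCoOf t v ∧ ∃ d, Maps E n d ∧
    IsMapOn W.carrier (fun m c => ExtensionStep W S E o z s d m c) v) q

/-- The value `q` at `s` of the function coding the complements of the `a`-sets for a limit `a`, where
`r` maps the smaller ordinals to the functions coding the complements of their sets. -/
def LimitStep (a r s q : A) : Prop :=
  IsMapOn a (fun b c => ∃ z, Maps r b z ∧ IsFunction z ∧ Maps z s c) q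

/-- The recursion: `y` is the function on `S` coding the complements of the `a`-sets, where `r` is the
restriction of the recursion to `a`. The parameters `y₀` and `y₁` are the functions for `a = 0`, which
is included in order to have a uniform limit case, and `a = 1`. -/
def Step (S E o y₀ y₁ a r y : A) : Prop :=
  IsEmptySet a ∧ y = y₀ ∨ IsOne a ∧ y = y₁ ∨
    (∃ b, b ε a ∧ ¬ IsEmptySet b ∧ (∀ c, c ε a → c ε b ∨ c = b) ∧
      ∃ z, Maps r b z ∧ IsFunction z ∧ IsFunction r ∧
        IsMapOn S (fun s q => SuccStep W S E o z s q) y) ∨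
    IsLimitOrd a ∧ IsFunction r ∧ IsMapOn S (fun s q => LimitStep a r s q) y

variable [KPU A]

instance {Γ : Type w} [Ctx A Γ] (f g : Γ → A) [Tm f] [Tm g] :
    Sg fun γ => OneStep W S C (f γ) (g γ) :=
  have : Sg fun p : (NilCtx A × A) × A => OneStep W S C p.1.2 p.2 := by
    unfold OneStep
    infer_instance
  Sg.app₂ this f g

instance {Γ : Type w} [Ctx A Γ] (E o : A) (f g h : Γ → A) [Tm f] [Tm g] [Tm h] :
    Sg fun γ => SuccStep W S E o (f γ) (g γ) (h γ) :=
  have : Sg fun p : ((NilCtx A × A) × A) × A => SuccStep W S E o p.1.1.2 p.1.2 p.2 := by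
    unfold SuccStep ExtensionStep
    infer_instance
  Sg.app₃ this f g h

instance {Γ : Type w} [Ctx A Γ] (f g h k : Γ → A) [Tm f] [Tm g] [Tm h] [Tm k] :
    Sg fun γ => LimitStep (f γ) (g γ) (h γ) (k γ) :=
  have : Sg fun p : (((NilCtx A × A) × A) × A) × A => LimitStep p.1.1.1.2 p.1.1.2 p.1.2 p.2 := by
    unfold LimitStep
    infer_instance
  this.comp (((((Subst.const .nil).pair f).pair g).pair h).pair k)

instance (E o y₀ y₁ : A) : Sg fun p : ((NilCtx A × A) × A) × A =>
    Step W S E o y₀ y₁ p.1.1.2 p.1.2 p.2 := by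
  unfold Step
  infer_instance

variable {W}

theorem answersIn_iff (h : IsPointCode W G U x S C) {σ δ : Finset (ℕ × ℕ)} {s d t : A}
    (hs : CodesFinBij W σ s) (hd : CodesFinBij W δ d) :
    AnswersIn W S s d t ↔ ∃ τ ∈ finRestrictions G, CodesFinBij W τ t ∧ Answers σ δ τ := by
  have dom_iff : ∀ {σ : Finset (ℕ × ℕ)} {i : ℕ}, i ∈ fdom σ ↔ ∃ j, (i, j) ∈ σ := by simp [fdom]
  have rng_iff : ∀ {σ : Finset (ℕ × ℕ)} {j : ℕ}, j ∈ frng σ ↔ ∃ i, (i, j) ∈ σ := by simp [frng]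
  have key : ∀ τ, CodesFinBij W τ t → (((∀ p, p ε s → p ε t) ∧
    (Maps d (W.num 0) (W.num 0) ∧ (∀ i, i ε W.carrier → ((∃ j, j ε W.carrier ∧ Maps t i j) ↔
      (∃ j, j ε W.carrier ∧ Maps s i j) ∨ Maps d i (W.num 1))) ∨
    ¬ Maps d (W.num 0) (W.num 0) ∧ ∀ j, j ε W.carrier → ((∃ i, i ε W.carrier ∧ Maps t i j) ↔
      (∃ i, i ε W.carrier ∧ Maps s i j) ∨ Maps d j (W.num 1)))) ↔ Answers σ δ τ) := by
    intro τ ht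
    simp only [hs.subset_iff ht, W.ball, W.bex, hs.maps_num, hd.maps_num, ht.maps_num, Answers,
      Finset.ext_iff, Finset.mem_union, mem_demand, dom_iff, rng_iff]
  rw [AnswersIn, h.mem_iff]
  constructor
  · rintro ⟨⟨τ, hτ, ht⟩, H⟩
    exact ⟨τ, hτ, ht, (key τ ht).1 H⟩
  · rintro ⟨τ, hτ, ht, H⟩
    exact ⟨⟨τ, hτ, ht⟩, (key τ ht).2 H⟩

omit [KPU A] in
theorem oneStep_unique (s l t t' : A) (_ : l ε W.carrier)
    (h : ValueMem C s l ∧ (∃ v, IsCoOf t v ∧ IsChar W (fun k => MovesIntoIn W S C s l k) v) ∨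
      ¬ ValueMem C s l ∧ IsChar W (fun k => k = l) t)
    (h' : ValueMem C s l ∧ (∃ v, IsCoOf t' v ∧ IsChar W (fun k => MovesIntoIn W S C s l k) v) ∨
      ¬ ValueMem C s l ∧ IsChar W (fun k => k = l) t') : t = t' := by
  rcases h with ⟨h, v, hv, hc⟩ | ⟨h, hc⟩ <;> rcases h' with ⟨h', v', hv', hc'⟩ | ⟨h', hc'⟩
  · obtain rfl := hc.unique hc'
    exact hv.unique_left hv'
  · exact (h' h).elim
  · exact (h h').elim
  · exact hc.unique hc'

theorem exists_oneStep (S C s : A) : ∃ q, OneStep W S C s q := by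
  refine exists_isMapOn _ _ (fun l _ => ?_) (oneStep_unique s)
  by_cases hl : ValueMem C s l
  · obtain ⟨v, hv⟩ := exists_isChar W (fun k => MovesIntoIn W S C s l k)
    obtain ⟨t, ht⟩ := exists_isCoOf v
    exact ⟨t, .inl ⟨hl, v, ht, hv⟩⟩
  · obtain ⟨t, ht⟩ := exists_isChar W (fun k => k = l)
    exact ⟨t, .inr ⟨hl, ht⟩⟩

omit [KPU A] in
theorem OneStep.unique {s q q' : A} (h : OneStep W S C s q) (h' : OneStep W S C s q') : q = q' :=
  IsMapOn.unique h h' (oneStep_unique s)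

omit [KPU A] in
theorem IsChar.hasDepth {P : A → Prop} {q : A} (h : IsChar W P q) : HasDepth q :=
  IsMapOn.hasDepth h (W.num_mem 0)

omit [KPU A] in
theorem OneStep.hasDepth {s q : A} (h : OneStep W S C s q) : HasDepth q :=
  IsMapOn.hasDepth h (W.num_mem 0)

theorem OneStep.isCode {s q : A} (h : OneStep W S C s q) : IsCode W 2 q := by
  have hone : ∃ b : A, IsOrd b ∧ ordOf b = 1 := by
    obtain ⟨b, hb⟩ := exists_isOne (A := A)
    exact ⟨b, hb.isOrd, hb.isOrd.isOne_iff.1 hb⟩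
  rw [← one_add_one_eq_two]
  refine isCode_succ le_rfl hone h.1 h.2.1 ?_
  rintro t ⟨l, hl⟩
  rcases (h.value hl).2 with ⟨_, v, hv, hc⟩ | ⟨_, hc⟩
  · exact ⟨1, le_rfl, .inl ⟨v, hv, hc.isOneCode.isCode⟩⟩
  · exact ⟨1, le_rfl, .inr hc.isOneCode.isCode⟩

theorem OneStep.codedSet_eq [TopologicalSpace X] [ContinuousSMul G X] [RegularSpace X]
    (hU : IsTopologicalBasis (Set.range U)) (hSC : IsPointCode W G U x S C) {σ : Finset (ℕ × ℕ)}
    (hσ : σ ∈ finRestrictions G) {s q : A} (hs : CodesFinBij W σ s) (h : OneStep W S C s q) :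
    codedSet W U q = (alphaSet G U x (1 : Ordinal.{w}) σ)ᶜ := by
  ext y
  rw [IsMapOn.mem_codedSet h (W.num_mem 0) (oneStep_unique s) fun l t _ ht => ?_, W.bex,
    Set.mem_compl_iff, mem_alphaSet_one_iff hU, not_forall]
  · refine exists_congr fun l => ?_
    simp only [hSC.valueMem_iff σ hσ s hs]
    by_cases hl : Meets G x σ (U l)
    · obtain ⟨v, hv⟩ := exists_isChar W (fun k => MovesIntoIn W S C s (W.num l) k)
      obtain ⟨t, ht⟩ := exists_isCoOf v
      have hset : y ∈ codedSet W U t ↔ ¬ ∃ k, MovesInto G U x σ l k ∧ y ∈ U k := by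
        rw [codedSet_of_isCoOf ht, Set.mem_compl_iff, hv.mem_codedSet]
        simp only [hSC.movesIntoIn_iff hs]
      simp only [hl, not_true_eq_false, true_and, false_and, or_false, true_implies, false_implies]
      rw [← hset]
      constructor
      · rintro ⟨t', ⟨v', hv', hc'⟩, hy⟩
        obtain rfl := hv.unique hc'
        rwa [ht.unique_left hv']
      · exact fun hy => ⟨t, ⟨v, ht, hv⟩, hy⟩
    · obtain ⟨t, ht⟩ := exists_isChar W (fun k => k = W.num l)
      have hset : y ∈ codedSet W U t ↔ y ∈ U l := by
        rw [ht.mem_codedSet]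
        simp [W.num_injective.eq_iff]
      simp only [hl, not_false_eq_true, true_and, false_and, false_or, and_true, true_implies,
        false_implies, not_not]
      rw [← hset]
      constructor
      · rintro ⟨t', ht', hy⟩
        rwa [ht.unique ht']
      · exact fun hy => ⟨t, ht, hy⟩
  · rcases ht with ⟨_, v, hv, _⟩ | ⟨_, hc⟩
    · exact hv.hasDepth
    · exact hc.hasDepth

end AlphaCodes

/-! ### The codes of the `α`-sets, by recursion on `α` -/

section AlphaCodes

theorem one_le_codeLevel {o : Ordinal.{w}} (h : o ≠ 0) : 1 ≤ codeLevel o := by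
  rw [Order.one_le_iff_ne_zero]
  intro h0
  rw [codeLevel, Ordinal.add_eq_zero_iff] at h0
  have h2 : o % Ordinal.omega0 = 0 := by simpa using h0.2
  apply h
  rw [← Ordinal.div_add_mod o Ordinal.omega0, h0.1, h2, add_zero]

variable {A : Type w} [TransitiveUniverse A] {W : OmegaCopy A} {G : Subgroup (Equiv.Perm ℕ)}
  {X : Type z} [MulAction G X] {U : ℕ → Set X} {x : X} {S C : A}

variable (W G U x) in
/-- The function `y` on `S` codes the complements of the `α`-sets `B_α(x, σ)`. The index
`α = 0` needs a code as well, although its level is not `codeLevel 0`. -/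
def CodesAlphaSets (S : A) (α : Ordinal.{w}) (y : A) : Prop :=
  IsFunction y ∧ HasDomain y S ∧ ∀ σ ∈ finRestrictions G, ∀ s, CodesFinBij W σ s →
    ∀ q, Maps y s q → HasDepth q ∧ IsCode W (max 1 (codeLevel α)) q ∧
      codedSet W U q = (alphaSet G U x α σ)ᶜ

variable [KPU A] {E o : A}

omit [KPU A] in
theorem ExtensionStep.unique (hE : ∀ n y, Maps E (W.num n) y ↔ CodesFinBij W (bitPairs n) y)
    {z s d m c c' : A} (hz : IsFunction z) (hm : m ε W.carrier)
    (h : ExtensionStep W S E o z s d m c) (h' : ExtensionStep W S E o z s d m c') : c = c' := by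
  obtain ⟨n, rfl⟩ := (W.mem_carrier m).1 hm
  obtain ⟨t, ht, h⟩ := h
  obtain ⟨t', ht', h'⟩ := h'
  obtain rfl := ((hE n t).1 ht).unique ((hE n t').1 ht')
  rcases h with ⟨h, e, he, hc⟩ | ⟨h, rfl⟩ <;> rcases h' with ⟨h', e', he', hc'⟩ | ⟨h', rfl⟩
  · obtain rfl := hz.2.2 _ _ _ he he'
    exact hc.unique_left hc'
  · exact (h' h).elim
  · exact (h h').elim
  · rfl

theorem exists_extensionStep (hE : ∀ n y, Maps E (W.num n) y ↔ CodesFinBij W (bitPairs n) y)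
    {z : A} (hz : IsFunction z) (hd : HasDomain z S) (s d : A) :
    ∃ v, IsMapOn W.carrier (fun m c => ExtensionStep W S E o z s d m c) v := by
  have : Sg fun p : (NilCtx A × A) × A => ExtensionStep W S E o z s d p.1.2 p.2 := by
    unfold ExtensionStep
    infer_instance
  refine exists_isMapOn _ _ (W.ball.2 fun n => ?_) fun m c c' hm h h' => h.unique hE hz hm h'
  obtain ⟨t, ht⟩ := exists_codesFinBij W (bitPairs n)
  by_cases h : AnswersIn W S s d t
  · obtain ⟨e, he⟩ := (hd t).1 h.1
    obtain ⟨c, hc⟩ := exists_isCoOf e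
    exact ⟨c, t, (hE n t).2 ht, .inl ⟨h, e, he, hc⟩⟩
  · exact ⟨o, t, (hE n t).2 ht, .inr ⟨h, rfl⟩⟩

omit [KPU A] in
theorem ExtensionStep.hasDepth (ho : HasDepth o) {z s d m c : A}
    (h : ExtensionStep W S E o z s d m c) : HasDepth c := by
  obtain ⟨t, _, ⟨_, e, _, hc⟩ | ⟨_, rfl⟩⟩ := h
  · exact hc.hasDepth
  · exact ho

/-- The union over the extensions `τ` of `σ` meeting a requirement of the sets `B_α(x, τ)`. -/
theorem mem_codedSet_extensionStep (hSC : IsPointCode W G U x S C)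
    (hE : ∀ n y, Maps E (W.num n) y ↔ CodesFinBij W (bitPairs n) y)
    (ho : IsChar W (fun _ => False) o) {α : Ordinal.{w}} {z : A}
    (hz : CodesAlphaSets W G U x S α z) {σ δ : Finset (ℕ × ℕ)} {s d v : A}
    (hs : CodesFinBij W σ s) (hd : CodesFinBij W δ d)
    (hv : IsMapOn W.carrier (fun m c => ExtensionStep W S E o z s d m c) v) {y : X} :
    y ∈ codedSet W U v ↔
      ∃ τ, Answers σ δ τ ∧ τ ∈ finRestrictions G ∧ y ∈ alphaSet G U x α τ := by
  rw [hv.mem_codedSet (W.num_mem 0) (fun m c c' hm h h' => h.unique hE hz.1 hm h')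
    fun m c _ h => h.hasDepth ho.hasDepth, W.bex]
  have hempty : y ∉ codedSet W U o := by
    rw [ho.mem_codedSet]
    simp
  constructor
  · rintro ⟨n, c, ⟨t, ht, ⟨h, e, he, hc⟩ | ⟨_, rfl⟩⟩, hy⟩
    · obtain ⟨τ, hτ, htτ, hans⟩ := (answersIn_iff hSC hs hd).1 h
      rw [codedSet_of_isCoOf hc, (hz.2.2 τ hτ t htτ e he).2.2, compl_compl] at hy
      exact ⟨τ, hans, hτ, hy⟩
    · exact (hempty hy).elim
  · rintro ⟨τ, hans, hτ, hy⟩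
    obtain ⟨n, rfl⟩ := bitPairs_surjective τ
    obtain ⟨t, ht⟩ := exists_codesFinBij W (bitPairs n)
    obtain ⟨e, he⟩ := (hz.2.1 t).1 ((hSC.mem_iff t).2 ⟨_, hτ, ht⟩)
    obtain ⟨c, hc⟩ := exists_isCoOf e
    refine ⟨n, c, ⟨t, (hE n t).2 ht, .inl ⟨(answersIn_iff hSC hs hd).2 ⟨_, hτ, ht, hans⟩,
      e, he, hc⟩⟩, ?_⟩
    rwa [codedSet_of_isCoOf hc, (hz.2.2 _ hτ t ht e he).2.2, compl_compl]

theorem isCode_extensionStep (hSC : IsPointCode W G U x S C)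
    (ho : IsChar W (fun _ => False) o) {a : A} (ha : IsOrd a) (ha0 : ordOf a ≠ 0) {z : A}
    (hz : CodesAlphaSets W G U x S (ordOf a) z) {s d v : A}
    (hv : IsMapOn W.carrier (fun m c => ExtensionStep W S E o z s d m c) v) :
    IsCode W (codeLevel (ordOf a) + 1) v := by
  have h1 := one_le_codeLevel ha0
  refine isCode_succ h1 ha.exists_codeLevel hv.1 hv.2.1 ?_
  rintro c ⟨m, hm⟩
  obtain ⟨t, _, ⟨⟨h, _⟩, e, he, hc⟩ | ⟨_, rfl⟩⟩ := (hv.value hm).2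
  · obtain ⟨τ, hτ, ht⟩ := (hSC.mem_iff t).1 h
    have := (hz.2.2 τ hτ t ht e he).2.1
    rw [max_eq_right h1] at this
    exact ⟨_, le_rfl, .inl ⟨e, hc, this⟩⟩
  · exact ⟨1, h1, .inr ho.isOneCode.isCode⟩

omit [KPU A] in
theorem succStep_unique (hE : ∀ n y, Maps E (W.num n) y ↔ CodesFinBij W (bitPairs n) y)
    {z : A} (hz : IsFunction z) (s n t t' : A) (hn : n ε W.carrier)
    (h : ∃ v, IsCoOf t v ∧ ∃ d, Maps E n d ∧
      IsMapOn W.carrier (fun m c => ExtensionStep W S E o z s d m c) v)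
    (h' : ∃ v, IsCoOf t' v ∧ ∃ d, Maps E n d ∧
      IsMapOn W.carrier (fun m c => ExtensionStep W S E o z s d m c) v) : t = t' := by
  obtain ⟨n, rfl⟩ := (W.mem_carrier n).1 hn
  obtain ⟨v, ht, d, hd, hv⟩ := h
  obtain ⟨v', ht', d', hd', hv'⟩ := h'
  obtain rfl := ((hE n d).1 hd).unique ((hE n d').1 hd')
  obtain rfl := hv.unique hv' fun m c c' hm h h' => h.unique hE hz hm h'
  exact ht.unique_left ht'

omit [KPU A] in
theorem SuccStep.unique (hE : ∀ n y, Maps E (W.num n) y ↔ CodesFinBij W (bitPairs n) y)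
    {z s q q' : A} (hz : IsFunction z) (h : SuccStep W S E o z s q) (h' : SuccStep W S E o z s q') :
    q = q' :=
  IsMapOn.unique h h' (succStep_unique hE hz s)

theorem exists_succStep (hE : ∀ n y, Maps E (W.num n) y ↔ CodesFinBij W (bitPairs n) y)
    {z : A} (hz : IsFunction z) (hd : HasDomain z S) (s : A) : ∃ q, SuccStep W S E o z s q := by
  have : Sg fun p : (NilCtx A × A) × A => ∃ v, IsCoOf p.2 v ∧ ∃ d, Maps E p.1.2 d ∧
      IsMapOn W.carrier (fun m c => ExtensionStep W S E o z s d m c) v := by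
    unfold ExtensionStep
    infer_instance
  refine exists_isMapOn _ _ (W.ball.2 fun n => ?_) (succStep_unique hE hz s)
  obtain ⟨d, hd'⟩ := exists_codesFinBij W (bitPairs n)
  obtain ⟨v, hv⟩ := exists_extensionStep (o := o) hE hz hd s d
  obtain ⟨t, ht⟩ := exists_isCoOf v
  exact ⟨t, v, ht, d, (hE n d).2 hd', hv⟩

theorem codesAlphaSets_succ (hSC : IsPointCode W G U x S C)
    (hE : ∀ n y, Maps E (W.num n) y ↔ CodesFinBij W (bitPairs n) y)
    (ho : IsChar W (fun _ => False) o) {a : A} (ha : IsOrd a) (ha0 : ordOf a ≠ 0) {z y : A}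
    (hz : CodesAlphaSets W G U x S (ordOf a) z)
    (hy : IsMapOn S (fun s q => SuccStep W S E o z s q) y) :
    CodesAlphaSets W G U x S (ordOf a + 1) y := by
  refine ⟨hy.1, hy.2.1, fun σ hσ s hs q hq => ?_⟩
  have hq : SuccStep W S E o z s q := (hy.value hq).2
  refine ⟨IsMapOn.hasDepth hq (W.num_mem 0), ?_, ?_⟩
  · obtain ⟨b, hb, hba⟩ := ha.exists_codeLevel
    obtain ⟨c, hc, hcb⟩ := hb.exists_add_nat 1
    rw [hba, Nat.cast_one] at hcb
    rw [← Order.succ_eq_add_one (ordOf a), codeLevel_succ]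
    simp only [Order.succ_eq_add_one]
    have h1 : 1 ≤ codeLevel (ordOf a) + 1 := Order.one_le_iff_ne_zero.2 (by simp)
    rw [max_eq_right (h1.trans (Order.lt_add_one_iff.2 le_rfl).le)]
    refine isCode_succ h1 ⟨c, hc, hcb⟩ hq.1 hq.2.1 ?_
    rintro t ⟨n, hn⟩
    obtain ⟨v, ht, d, _, hv⟩ := (hq.value hn).2
    exact ⟨_, le_rfl, .inl ⟨v, ht, isCode_extensionStep hSC ho ha ha0 hz hv⟩⟩
  · ext u
    rw [IsMapOn.mem_codedSet hq (W.num_mem 0) (succStep_unique hE hz.1 s), W.bex, Set.mem_compl_iff,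
      mem_alphaSet_succ U x ha0]
    · have key : ∀ n, (∃ t, (∃ v, IsCoOf t v ∧ ∃ d, Maps E (W.num n) d ∧
          IsMapOn W.carrier (fun m c => ExtensionStep W S E o z s d m c) v) ∧ u ∈ codedSet W U t) ↔
          ¬ ∃ τ, Answers σ (bitPairs n) τ ∧ τ ∈ finRestrictions G ∧
            u ∈ alphaSet G U x (ordOf a) τ := by
        intro n
        constructor
        · rintro ⟨t, ⟨v, ht, d, hd, hv⟩, hu⟩
          rw [codedSet_of_isCoOf ht] at hu
          rwa [← mem_codedSet_extensionStep hSC hE ho hz hs ((hE n d).1 hd) hv]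
        · intro hu
          obtain ⟨d, hd⟩ := exists_codesFinBij W (bitPairs n)
          obtain ⟨v, hv⟩ := exists_extensionStep (o := o) hE hz.1 hz.2.1 s d
          obtain ⟨t, ht⟩ := exists_isCoOf v
          refine ⟨t, ⟨v, ht, d, (hE n d).2 hd, hv⟩, ?_⟩
          rwa [codedSet_of_isCoOf ht, Set.mem_compl_iff,
            mem_codedSet_extensionStep hSC hE ho hz hs hd hv]
      have hall := forall_answers_iff (σ := σ)
        (P := fun τ => τ ∈ finRestrictions G ∧ u ∈ alphaSet G U x (ordOf a) τ)
      rw [bitPairs_surjective.forall] at hall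
      rw [exists_congr key, ← not_forall, hall]
      refine not_congr (and_congr ?_ ?_) <;>
        exact forall₂_congr fun b _ => exists_congr fun τ => by tauto
    · rintro n t _ ⟨v, ht, _⟩
      exact ht.hasDepth

omit [KPU A] in
theorem limitStep_unique {r : A} (hr : IsFunction r) (s b c c' : A)
    (h : ∃ z, Maps r b z ∧ IsFunction z ∧ Maps z s c)
    (h' : ∃ z, Maps r b z ∧ IsFunction z ∧ Maps z s c') : c = c' := by
  obtain ⟨z, hz, hzf, hc⟩ := h
  obtain ⟨z', hz', _, hc'⟩ := h'
  obtain rfl := hr.2.2 _ _ _ hz hz'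
  exact hzf.2.2 _ _ _ hc hc'

theorem exists_limitStep {a r s : A} (hr : IsFunction r) (hd : HasDomain r a)
    (h : ∀ b z, Maps r b z → CodesAlphaSets W G U x S (ordOf b) z) (hs : s ε S) :
    ∃ q, LimitStep a r s q := by
  refine exists_isMapOn _ _ (fun b hb => ?_) fun b c c' _ => limitStep_unique hr s b c c'
  obtain ⟨z, hz⟩ := (hd b).1 hb
  obtain ⟨c, hc⟩ := ((h b z hz).2.1 s).1 hs
  exact ⟨c, z, hz, (h b z hz).1, hc⟩

theorem codesAlphaSets_limit {a r y : A} (ha : IsOrd a) (hlim : Order.IsSuccLimit (ordOf a))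
    (hr : IsFunction r) (h : ∀ b z, Maps r b z → CodesAlphaSets W G U x S (ordOf b) z)
    (hy : IsMapOn S (fun s q => LimitStep a r s q) y) :
    CodesAlphaSets W G U x S (ordOf a) y := by
  refine ⟨hy.1, hy.2.1, fun σ hσ s hs q hq => ?_⟩
  have hq : LimitStep a r s q := (hy.value hq).2
  have h1 : 1 < ordOf a := Ordinal.one_lt_of_isSuccLimit hlim
  obtain ⟨b₀, hb₀, _⟩ := ha.exists_ordOf_eq h1
  refine ⟨IsMapOn.hasDepth hq hb₀, ?_, ?_⟩
  · rw [codeLevel_limit hlim, max_eq_right h1.le]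
    refine isCode_of_isFunction ha h1 hq.1 (fun _ => hq.2.1) ?_ ?_
    · rintro ⟨β, hβ⟩
      have hlt : β < ordOf a := hβ.symm ▸ Order.lt_add_one_iff.2 le_rfl
      have := hlim.succ_lt hlt
      rw [Order.succ_eq_add_one, hβ] at this
      exact (lt_irrefl _ this).elim
    · rintro c ⟨b, hb⟩
      obtain ⟨hba, z, hz, _, hc⟩ := hq.value hb
      exact ⟨_, max_lt h1 (codeLevel_lt_limit hlim (ordOf_lt_of_mem hba)),
        .inr ((h b z hz).2.2 σ hσ s hs c hc).2.1⟩
  · ext u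
    rw [IsMapOn.mem_codedSet hq hb₀ fun b c c' _ => limitStep_unique hr s b c c',
      Set.mem_compl_iff, mem_alphaSet_limit U x hlim]
    · push Not
      constructor
      · rintro ⟨b, hb, c, ⟨z, hz, _, hc⟩, hu⟩
        refine ⟨ordOf b, ordOf_lt_of_mem hb, ?_⟩
        rwa [((h b z hz).2.2 σ hσ s hs c hc).2.2] at hu
      · rintro ⟨β, hβ, hu⟩
        obtain ⟨b, hb, rfl⟩ := ha.exists_ordOf_eq hβ
        obtain ⟨c, ⟨z, hz, hzf, hc⟩, _⟩ := hq.2.2 b hb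
        refine ⟨b, hb, c, ⟨z, hz, hzf, hc⟩, ?_⟩
        rwa [((h b z hz).2.2 σ hσ s hs c hc).2.2]
    · rintro b c _ ⟨z, hz, _, hc⟩
      exact ((h b z hz).2.2 σ hσ s hs c hc).1

theorem step_unique (hE : ∀ n y, Maps E (W.num n) y ↔ CodesFinBij W (bitPairs n) y)
    {y₀ y₁ a r y y' : A} (ha : IsOrd a) (h : Step W S E o y₀ y₁ a r y)
    (h' : Step W S E o y₀ y₁ a r y') : y = y' := by
  have h0 : IsEmptySet a → ordOf a = 0 := ha.isEmptySet_iff.1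
  have h1 : IsOne a → ordOf a = 1 := ha.isOne_iff.1
  have hl : IsLimitOrd a → Order.IsSuccLimit (ordOf a) := ha.isLimitOrd_iff.1
  have hs : ∀ b, b ε a → ¬ IsEmptySet b → (∀ c, c ε a → c ε b ∨ c = b) →
      ordOf b ≠ 0 ∧ ordOf a = ordOf b + 1 := by
    intro b hb hb0 hba
    refine ⟨fun h => hb0 ((ha.of_mem hb).isEmptySet_iff.2 h), ?_⟩
    rw [← Order.succ_eq_add_one]
    refine ordOf_succ fun c => ⟨hba c, ?_⟩
    rintro (hc | rfl)
    · exact ha.2.1 b hb c hc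
    · exact hb
  have hlim0 : ¬ Order.IsSuccLimit (0 : Ordinal.{w}) := fun h => h.ne_bot rfl
  have hlims : ∀ β : Ordinal.{w}, ¬ Order.IsSuccLimit (β + 1) := fun β h =>
    by
    have := h.succ_lt (Order.lt_add_one_iff.2 le_rfl : β < β + 1)
    rw [Order.succ_eq_add_one] at this
    exact lt_irrefl _ this
  have hlim1 : ¬ Order.IsSuccLimit (1 : Ordinal.{w}) := by simpa using hlims 0
  have hsucc0 : ∀ β : Ordinal.{w}, 0 ≠ β + 1 := fun β =>
    (Order.lt_add_one_iff.2 (zero_le : 0 ≤ β)).ne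
  have hsucc1 : ∀ β : Ordinal.{w}, 1 = β + 1 → β = 0 := fun β h => by
    rw [← Order.succ_eq_add_one, ← zero_add (1 : Ordinal.{w}), ← Order.succ_eq_add_one] at h
    exact (Order.succ_injective h).symm
  rcases h with ⟨h, hy⟩ | ⟨h, hy⟩ | ⟨b, hb, hb0, hba, z, hz, hzf, hr, hy⟩ | ⟨h, hr, hy⟩ <;>
  rcases h' with ⟨h', hy'⟩ | ⟨h', hy'⟩ | ⟨b', hb', hb0', hba', z', hz', _, hr', hy'⟩ | ⟨h', hr', hy'⟩
  · rw [hy, hy']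
  · simpa [h0 h] using h1 h'
  · exact (hsucc0 _ ((h0 h).symm.trans (hs b' hb' hb0' hba').2)).elim
  · exact (hlim0 (h0 h ▸ hl h')).elim
  · simpa [h0 h'] using h1 h
  · rw [hy, hy']
  · obtain ⟨hne, heq⟩ := hs b' hb' hb0' hba'
    rw [h1 h] at heq
    exact (hne (hsucc1 _ heq)).elim
  · exact (hlim1 (h1 h ▸ hl h')).elim
  · exact (hsucc0 _ ((h0 h').symm.trans (hs b hb hb0 hba).2)).elim
  · obtain ⟨hne, heq⟩ := hs b hb hb0 hba
    rw [h1 h'] at heq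
    exact (hne (hsucc1 _ heq)).elim
  · obtain rfl : b = b' := by
      refine (ha.of_mem hb).eq_of_ordOf_eq (ha.of_mem hb') ?_
      have := (hs b hb hb0 hba).2.symm.trans (hs b' hb' hb0' hba').2
      simpa using this
    obtain rfl := hr.2.2 _ _ _ hz hz'
    exact hy.unique hy' fun s q q' _ h h' => h.unique hE hzf h'
  · exact (hlims _ ((hs b hb hb0 hba).2 ▸ hl h')).elim
  · exact (hlim0 (h0 h' ▸ hl h)).elim
  · exact (hlim1 (h1 h' ▸ hl h)).elim
  · exact (hlims _ ((hs b' hb' hb0' hba').2 ▸ hl h)).elim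
  · exact hy.unique hy' fun s q q' _ h h' =>
      IsMapOn.unique h h' fun b c c' _ => limitStep_unique hr s b c c'

/-- There is a `Σ`-definable function on the ordinals of `A` whose value at `α` codes the
complements of the `α`-sets. -/
theorem exists_alphaCodes [TopologicalSpace X] [ContinuousSMul G X] [RegularSpace X]
    (hU : IsTopologicalBasis (Set.range U)) (hSC : IsPointCode W G U x S C) :
    ∃ F : A → A → Prop, (Sg fun p : (NilCtx A × A) × A => F p.1.2 p.2) ∧
      (∀ a y y', IsOrd a → F a y → F a y' → y = y') ∧
      ∀ a, IsOrd a → ∃ y, F a y ∧ CodesAlphaSets W G U x S (ordOf a) y := by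
  obtain ⟨E, hE⟩ := exists_enumeration W
  obtain ⟨o, ho⟩ := exists_isChar W fun _ : A => False
  obtain ⟨y₀, hy₀⟩ := exists_isMapOn (fun _ q : A => q = o) S (fun _ _ => ⟨o, rfl⟩)
    (by rintro _ _ _ _ rfl rfl; rfl)
  obtain ⟨y₁, hy₁⟩ := exists_isMapOn (fun s q => OneStep W S C s q) S
    (fun s _ => exists_oneStep S C s) fun s q q' _ h h' => h.unique h'
  refine exists_recursion (fun a r y => Step W S E o y₀ y₁ a r y)
    (fun a r y y' ha h h' => step_unique hE ha h h')
    (fun a y => CodesAlphaSets W G U x S (ordOf a) y) fun a r ha hr hd h => ?_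
  rcases Ordinal.zero_or_succ_or_isSuccLimit (ordOf a) with h0 | ⟨β, hβ⟩ | hlim
  · refine ⟨y₀, .inl ⟨ha.isEmptySet_iff.2 h0, rfl⟩, hy₀.1, hy₀.2.1, fun σ hσ s hs q hq => ?_⟩
    obtain rfl := (hy₀.value hq).2
    refine ⟨ho.hasDepth, ?_, ?_⟩
    · rw [h0, codeLevel_zero, max_eq_left zero_le_one]
      exact ho.isOneCode.isCode
    · ext u
      rw [ho.mem_codedSet, h0, alphaSet_zero]
      simp
  · replace hβ : ordOf a = β + 1 := hβ.symm
    have hlt : β < ordOf a := hβ.symm ▸ Order.lt_add_one_iff.2 le_rfl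
    obtain ⟨b, hb, rfl⟩ := ha.exists_ordOf_eq hlt
    have hbo := ha.of_mem hb
    rcases eq_or_ne (ordOf b) 0 with hb0 | hb0
    · rw [hb0, zero_add] at hβ
      refine ⟨y₁, .inr (.inl ⟨ha.isOne_iff.2 hβ, rfl⟩), hy₁.1, hy₁.2.1, fun σ hσ s hs q hq => ?_⟩
      have hq : OneStep W S C s q := (hy₁.value hq).2
      rw [hβ, codeLevel_one, max_eq_right one_le_two]
      exact ⟨hq.hasDepth, hq.isCode, hq.codedSet_eq hU hSC hσ hs⟩
    · obtain ⟨z, hz⟩ := (hd b).1 hb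
      have hzc := h b z hz
      have hex : ∃ y, IsMapOn S (fun s q => SuccStep W S E o z s q) y :=
        exists_isMapOn _ _ (fun s _ => exists_succStep hE hzc.1 hzc.2.1 s)
          fun s q q' _ h h' => h.unique hE hzc.1 h'
      obtain ⟨y, hy⟩ := hex
      refine ⟨y, .inr (.inr (.inl ⟨b, hb, fun h => hb0 (hbo.isEmptySet_iff.1 h), fun c hc => ?_,
        z, hz, hzc.1, hr, hy⟩)), ?_⟩
      · have hco := ha.of_mem hc
        have hcb := ordOf_lt_of_mem hc
        rw [hβ, Order.lt_add_one_iff] at hcb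
        rcases hcb.lt_or_eq with h | h
        · exact .inl ((hbo.mem_iff hco).2 h)
        · exact .inr (hco.eq_of_ordOf_eq hbo h)
      · rw [hβ]
        exact codesAlphaSets_succ hSC hE ho hbo hb0 hzc hy
  · have hex : ∃ y, IsMapOn S (fun s q => LimitStep a r s q) y :=
      exists_isMapOn _ _ (fun s hs => exists_limitStep hr hd h hs) fun s q q' _ h h' =>
        IsMapOn.unique h h' fun b c c' _ => limitStep_unique hr s b c c'
    obtain ⟨y, hy⟩ := hex
    exact ⟨y, .inr (.inr (.inr ⟨ha.isLimitOrd_iff.2 hlim, hr, hy⟩)),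
      codesAlphaSets_limit ha hlim hr h hy⟩

end AlphaCodes

/-! ### Countability of the levels -/

section Countability

/-- The level of the codes of the `α`-sets is countable for countable `α`. -/
theorem countable_Iio_codeLevel {o : Ordinal.{w}} (h : (Set.Iio o).Countable) :
    (Set.Iio (codeLevel o)).Countable := by
  obtain ⟨l, n, hl, heq, -⟩ := exists_codeLevel_eq o
  rw [heq]
  clear heq
  induction n with
  | zero => simpa using h.mono (Set.Iio_subset_Iio hl)
  | succ n ih =>
    rw [Nat.cast_succ, ← add_assoc, ← Order.succ_eq_add_one, Order.Iio_succ, ← Set.Iio_insert]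
    exact ih.insert _

variable {A : Type w} [TransitiveUniverse A]

theorem IsOrd.countable_Iio_iff {a : A} (ha : IsOrd a) :
    (Set.Iio (ordOf a)).Countable ↔ {b | b ε a}.Countable := by
  have h : Set.Iio (ordOf a) = ordOf '' {b | b ε a} := by
    ext o
    constructor
    · exact fun ho => ha.exists_ordOf_eq ho
    · rintro ⟨b, hb, rfl⟩
      exact ordOf_lt_of_mem hb
  rw [h]
  refine ⟨fun h => ?_, fun h => h.image _⟩
  refine Set.countable_of_injective_of_countable_image (fun b hb c hc hbc => ?_) h
  exact (ha.of_mem hb).eq_of_ordOf_eq (ha.of_mem hc) hbc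

end Countability

end AdmCoding

open AdmCoding
theorem theorem27 {L : FirstOrder.Language.{u, v}} {A : Type w} [TransitiveUniverse A] [L.Structure A]
    (hA : Admissible L A)
    (G : Subgroup (Equiv.Perm ℕ)) (hG : IsClosed (G : Set (Equiv.Perm ℕ)))
    {X : Type z} [TopologicalSpace X] [PolishSpace X] [MulAction G X] [ContinuousSMul G X]
    (U : ℕ → Set X) (hU : IsTopologicalBasis (Set.range U))
    (W : OmegaCopy A) (x : X) (hx : Codable W G U x)
    (hImp : SigmaDefinable L (Imp W G U)) :
    (∀ σ ∈ finRestrictions G, ∀ a : A, IsOrd a → ¬ IsEmptySet a → {b | b ε a}.Countable →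
      Constructible W U (alphaSet G U x (ordOf a) σ)) ∧
    ∃ R : A → A → A → Prop,
      SigmaDefinable L (fun s : Fin 3 → A => R (s 0) (s 1) (s 2)) ∧
      (∀ a s q q', R a s q → R a s q' → q = q') ∧
      (∀ a s, (∃ q, R a s q) ↔
        IsOrd a ∧ ¬ IsEmptySet a ∧ ∃ σ ∈ finRestrictions G, CodesFinBij W σ s) ∧
      ∀ a s q σ, R a s q → CodesFinBij W σ s → {b | b ε a}.Countable →
        (∃ b : A, IsOrd b ∧ ordOf b = codeLevel (ordOf a) ∧ BPi W b q) ∧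
        codedSet W U q = alphaSet G U x (ordOf a) σ := by
  have := hA.kpu
  obtain ⟨S, C, hSC⟩ := hx.exists_isPointCode hU
  obtain ⟨F, hF, hFu, hFe⟩ := exists_alphaCodes hU hSC
  let R : A → A → A → Prop := fun a s q =>
    IsOrd a ∧ ¬ IsEmptySet a ∧ ∃ y, F a y ∧ ∃ q', Maps y s q' ∧ IsCoOf q q'
  have hRS : SigmaDefinable L (fun s : Fin 3 → A => R (s 0) (s 1) (s 2)) := by
    have : Sg fun p : ((NilCtx A × A) × A) × A => R p.1.1.2 p.1.2 p.2 := by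
      have := Sg.app₂ (Γ := (((NilCtx A × A) × A) × A) × A) hF (fun p => p.1.1.1.2) fun p => p.2
      infer_instance
    exact Sg.sigmaDefinable L R
  have hRu : ∀ a s q q', R a s q → R a s q' → q = q' := by
    rintro a s q q' ⟨ha, _, y, hy, t, ht, hq⟩ ⟨_, _, y', hy', t', ht', hq'⟩
    obtain rfl := hFu a y y' ha hy hy'
    obtain ⟨y'', hy'', hc⟩ := hFe a ha
    obtain rfl := hFu a y y'' ha hy hy''
    obtain rfl := hc.1.2.2 _ _ _ ht ht'
    exact hq.unique_left hq'
  have hRd : ∀ a s, (∃ q, R a s q) ↔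
      IsOrd a ∧ ¬ IsEmptySet a ∧ ∃ σ ∈ finRestrictions G, CodesFinBij W σ s := by
    intro a s
    constructor
    · rintro ⟨q, ha, ha0, y, hy, t, ht, _⟩
      obtain ⟨y', hy', hc⟩ := hFe a ha
      obtain rfl := hFu a y y' ha hy hy'
      exact ⟨ha, ha0, (hSC.mem_iff s).1 ((hc.2.1 s).2 ⟨t, ht⟩)⟩
    · rintro ⟨ha, ha0, hs⟩
      obtain ⟨y, hy, hc⟩ := hFe a ha
      obtain ⟨t, ht⟩ := (hc.2.1 s).1 ((hSC.mem_iff s).2 hs)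
      obtain ⟨q, hq⟩ := exists_isCoOf t
      exact ⟨q, ha, ha0, y, hy, t, ht, hq⟩
  have hRc : ∀ a s q σ, R a s q → CodesFinBij W σ s →
      (∃ b : A, IsOrd b ∧ ordOf b = codeLevel (ordOf a) ∧ BPi W b q) ∧
        codedSet W U q = alphaSet G U x (ordOf a) σ := by
    intro a s q σ h hs
    obtain ⟨ha, ha0, σ', hσ', hs'⟩ := (hRd a s).1 ⟨q, h⟩
    obtain rfl := hs.inj hs'
    obtain ⟨_, _, y, hy, t, ht, hq⟩ := h
    obtain ⟨y', hy', hc⟩ := hFe a ha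
    obtain rfl := hFu a y y' ha hy hy'
    obtain ⟨_, hcode, hset⟩ := hc.2.2 σ hσ' s hs t ht
    rw [max_eq_right (one_le_codeLevel (mt ha.isEmptySet_iff.2 ha0))] at hcode
    obtain ⟨b, hb, hbo, hbs⟩ := hcode
    exact ⟨⟨b, hb, hbo, t, hq, hbs⟩, by rw [codedSet_of_isCoOf hq, hset, compl_compl]⟩
  refine ⟨fun σ hσ a ha ha0 hc => ?_, R, hRS, hRu, hRd, fun a s q σ h hs _ => hRc a s q σ h hs⟩
  have hcount := ha.countable_Iio_iff.2 hc
  refine ⟨measurableSet_alphaSet hU _ hcount σ, ?_⟩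
  obtain ⟨s, hs⟩ := exists_codesFinBij W σ
  obtain ⟨q, hq⟩ := (hRd a s).2 ⟨ha, ha0, σ, hσ, hs⟩
  obtain ⟨⟨b, hb, hbo, hbq⟩, hset⟩ := hRc a s q σ hq hs
  refine ⟨q, b, hb, hb.countable_Iio_iff.1 ?_, .inr hbq, hset⟩
  rw [hbo]
  exact countable_Iio_codeLevel hcount
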